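/- **Proposition 1.5.** There exists a bounded vector field $b:\mathbb{R}^2\to\mathbb{R}^2$ (i.e. $b\in L^\infty(\mathbb{R}^2;\mathbb{R}^2)$) such that 1. $\operatorname{div} b=0$ in the sense of distributions; 2. $b\in W^{1,p}_{\rm loc}(\mathbb{R}^2;\mathbb{R}^2)$ for every $p\in[1,\infty)$; 3. $b(z)\cdot e_1>0$ for $\mathscr L^2$-a.e. $z\in\mathbb{R}^2$; 4. $b$ has a regular Lagrangian flow on $[0,\infty)$; for every $T\in(0,\infty]$ any two regular Lagrangian flows $X,Y$ of $b$ on $[0,T)$ satisfy, for $\mathscr L^2$-a.e. $z$, $X(t,z)=Y(t,z)$ for all $t\in[0,T)$; and for every $T\in(0,\infty]$, every regular Lagrangian flow $X$ of $b$ on $[0,T)$ and every $0<t<T$, $$X(t,\cdot)\notin BV_{\rm loc}(\mathbb{R}^2;\mathbb{R}^2).$$ Here a regular Lagrangian flow of $b$ on $[0,T)$ is a map $X:[0,T)\times\mathbb{R}^2\to\mathbb{R}^2$ such that (i) for $\mathscr L^2$-a.e. $z$ the curve $t\mapsto X(t,z)$ is absolutely continuous on every compact interval $[0,s]\subset[0,T)$,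 $X(0,z)=z$, and $\partial_tX(t,z)=b(X(t,z))$ for $\mathscr L^1$-a.e. $t\in(0,T)$; and (ii) there is a constant $L>0$ such that, for every $t\in[0,T)$, the map $X(t,\cdot)$ is Lebesgue measurable and $X(t,\cdot)_\sharp\mathscr L^2\le L\,\mathscr L^2$. A map $u=(u_1,u_2)$ belongs to $BV_{\rm loc}(\mathbb{R}^2;\mathbb{R}^2)$ if, for $i=1,2$, $u_i\in L^1_{\rm loc}(\mathbb{R}^2)$ and for every bounded open $V\subset\mathbb{R}^2$ one has $\sup\{\int u_i\operatorname{div}\varphi\,dz:\varphi\in C^1_c(V;\mathbb{R}^2),\ |\varphi|\le1\}<\infty$. -/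

import Mathlib

open MeasureTheory Set
open scoped NNReal ENNReal ContDiff

/-- The Euclidean space `ℝ^d`; it carries the Euclidean norm and Lebesgue measure `volume`. -/
abbrev Euc (d : ℕ) : Type := EuclideanSpace ℝ (Fin d)

/-- The classical divergence `∑ᵢ ∂ᵢ φᵢ` of a differentiable vector field. -/
noncomputable def classicalDiv {d : ℕ} (φ : Euc d → Euc d) (x : Euc d) : ℝ :=
  ∑ i : Fin d, (fderiv ℝ φ x (EuclideanSpace.single i 1)) i

/-- `f ∈ L^p_loc(ℝ^d; F)`. -/
def MemLpLoc {d : ℕ} {F : Type*} [NormedAddCommGroup F] (f : Euc d → F) (p : ℝ≥0∞) : Prop :=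
  ∀ K : Set (Euc d), IsCompact K → MemLp f p (volume.restrict K)

/-- `G` is the weak derivative of `f` on `ℝ^d`: for every test function `φ ∈ C_c^∞(ℝ^d)` and
every direction `v`, `∫ (∂_v φ) f = - ∫ φ (G v)`. -/
def IsWeakDeriv {d m : ℕ} (f : Euc d → Euc m) (G : Euc d → (Euc d →L[ℝ] Euc m)) : Prop :=
  LocallyIntegrable f volume ∧ LocallyIntegrable G volume ∧
    ∀ φ : Euc d → ℝ, ContDiff ℝ ∞ φ → HasCompactSupport φ → ∀ v : Euc d,
      ∫ x, (fderiv ℝ φ x v) • f x = - ∫ x, φ x • G x v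

/-- `f ∈ W^{1,p}_loc(ℝ^d; ℝ^m)`. -/
def MemW1pLoc {d m : ℕ} (f : Euc d → Euc m) (p : ℝ≥0∞) : Prop :=
  MemLpLoc f p ∧ ∃ G : Euc d → (Euc d →L[ℝ] Euc m), IsWeakDeriv f G ∧ MemLpLoc G p

/-- `div b = 0` in the sense of distributions: `∫ b · ∇φ = 0` for every `φ ∈ C_c^∞(ℝ^d)`. -/
def IsDivFree {d : ℕ} (b : Euc d → Euc d) : Prop :=
  LocallyIntegrable b volume ∧
    ∀ φ : Euc d → ℝ, ContDiff ℝ ∞ φ → HasCompactSupport φ → ∫ x, fderiv ℝ φ x (b x) = 0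

/-- A real function `u` is in `BV_loc(ℝ^d)`: `u ∈ L^1_loc` and for every bounded open set `V` its
variation `sup {∫ u div φ : φ ∈ C_c^1(V; ℝ^d), |φ| ≤ 1}` in `V` is finite. -/
def MemBVLocReal {d : ℕ} (u : Euc d → ℝ) : Prop :=
  LocallyIntegrable u volume ∧
    ∀ V : Set (Euc d), IsOpen V → Bornology.IsBounded V →
      BddAbove {r : ℝ | ∃ φ : Euc d → Euc d, ContDiff ℝ 1 φ ∧ HasCompactSupport φ ∧
        tsupport φ ⊆ V ∧ (∀ x, ‖φ x‖ ≤ 1) ∧ r = ∫ x, u x * classicalDiv φ x}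

/-- `f ∈ BV_loc(ℝ^d; ℝ^m)`: every component of `f` is in `BV_loc(ℝ^d)`. -/
def MemBVLoc {d m : ℕ} (f : Euc d → Euc m) : Prop :=
  ∀ i : Fin m, MemBVLocReal fun x => f x i

/-- `X : [0,T) × ℝ^d → ℝ^d` is a regular Lagrangian flow of the vector field `b` on
`(0,T) × ℝ^d`, where `T` may be `⊤` (that is, `+∞`). Only the values `X t x` with `0 ≤ t < T`
matter. Absolute continuity is required on all compact intervals `[0,s] ⊆ [0,T)`. -/
structure IsRegularLagrangianFlow {d : ℕ} (T : EReal) (b : ℝ → Euc d → Euc d)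
    (X : ℝ → Euc d → Euc d) : Prop where
  trajectory : ∀ᵐ x : Euc d,
    (∀ s : ℝ, 0 ≤ s → (s : EReal) < T → AbsolutelyContinuousOnInterval (fun t => X t x) 0 s) ∧
    X 0 x = x ∧
    ∀ᵐ t : ℝ, 0 < t → (t : EReal) < T → HasDerivAt (fun s => X s x) (b t (X t x)) t
  compression : ∃ L : ℝ≥0, 0 < L ∧ ∀ t : ℝ, 0 ≤ t → (t : EReal) < T →
    AEMeasurable (X t) volume ∧ Measure.map (X t) volume ≤ L • (volume : Measure (Euc d))

/-! The field is b = (∂_y H, -∂_x H) with H = y M(r²) (1 + q g(log(y M)) / 20), where r² = x² + y²,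
q = y² / r², g(u) = u sin u² / (1 + u²), and M(r²) is comparable to r log² r near the origin.

Flow. Every level set of H is a graph over the x-axis, and the axis itself is the null level 0.
Along a level c ≠ 0 the field moves to the right with positive speed; the clock T is the travel time
from abscissa 0. In the coordinates (T, H) Lebesgue measure is again Lebesgue measure
(`lintegral_clock_stream`) and the flow is a translation in T, hence measure preserving. Since b is
continuous, a trajectory of any regular Lagrangian flow is a classical solution; off the axis it
conserves H and T - t, which determines it (`eq_flow_of_hasDerivAt`).

Regularity. A derivative of b costs the factor M / r, which is two logarithms, and g'', which is one
more. So |∇b| is bounded by a multiple of (1 + |log |y||)³, which is locally in every L^p with p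
finite; the single bad point 0 does not disturb integration by parts.

Failure of BV. The integral of 1 / (r log² r) converges at 0, so particles that start close to the
origin on its left pass it within any prescribed time, uniformly in c (`saddleClock_le`). The curve
of level c has height Y with Y² log² Y ~ c over the core |x| ≲ Y, and crosses the core in a time of
order Y / M(Y²) ~ 1 / log² c. At the crests c_n = exp(-√(nπ)) one has g = 0 and g' ≈ 2 (-1)^n: the
curve is the unperturbed one, but the speed is alternately raised and lowered by a fixed fraction.
Consecutive crests thus differ in travel time by a multiple of 1 / log² c_n = 1 / (nπ)
(`gain_le_saddleClock_sub`), and so do the abscissae at time t (`exists_gain_saddleAbscissa`). These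
differences are not summable, whereas testing a BV flow against the vertical fields ζ(x) g(H) e₂
would bound the variation in c of the ζ-average of the abscissa (`exists_integral_deriv_mul_le`). -/

open Filter Topology

/-! ### Level sets as graphs: heights, travel times and abscissae -/

/-- The inverse of a family of strictly increasing functions depends continuously on the
parameter. -/
theorem continuous_inverse_of_strictMono {P : Type*} [TopologicalSpace P] {F G : P → ℝ → ℝ}
    (hF : ∀ y, Continuous fun p => F p y) (hm : ∀ p, StrictMono (F p))
    (hG : ∀ p c, F p (G p c) = c) : Continuous fun z : P × ℝ => G z.1 z.2 := by
  rw [continuous_iff_continuousAt]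
  rintro ⟨p, c⟩
  refine tendsto_order.2 ⟨fun a ha => ?_, fun a ha => ?_⟩
  · have h1 : F p a < c := by simpa only [hG] using hm p ha
    have h2 : ∀ᶠ z : P × ℝ in 𝓝 (p, c), F z.1 a < z.2 :=
      (((hF a).comp continuous_fst).continuousAt).eventually_lt continuousAt_snd h1
    filter_upwards [h2] with z hz
    rw [← hG z.1 z.2] at hz
    exact (hm z.1).lt_iff_lt.1 hz
  · have h1 : c < F p a := by simpa only [hG] using hm p ha
    have h2 : ∀ᶠ z : P × ℝ in 𝓝 (p, c), z.2 < F z.1 a :=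
      continuousAt_snd.eventually_lt (((hF a).comp continuous_fst).continuousAt) h1
    filter_upwards [h2] with z hz
    rw [← hG z.1 z.2] at hz
    exact (hm z.1).lt_iff_lt.1 hz

/-- `H` is a stream function of the bounded continuous field `(b₁, b₂)`, whose first component is
positive off the horizontal axis; the axis is a level set and all level sets are graphs. -/
structure IsGraphStreamFunction (H b₁ b₂ : ℝ → ℝ → ℝ) (B : ℝ) : Prop where
  hasFDerivAt : ∀ x y, HasFDerivAt (fun z : ℝ × ℝ => H z.1 z.2)
    (b₁ x y • ContinuousLinearMap.snd ℝ ℝ ℝ - b₂ x y • ContinuousLinearMap.fst ℝ ℝ ℝ) (x, y)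
  cont_fst : Continuous fun z : ℝ × ℝ => b₁ z.1 z.2
  cont_snd : Continuous fun z : ℝ × ℝ => b₂ z.1 z.2
  abs_fst_le : ∀ x y, |b₁ x y| ≤ B
  abs_snd_le : ∀ x y, |b₂ x y| ≤ B
  pos : ∀ x y, y ≠ 0 → 0 < b₁ x y
  map_zero : ∀ x, H x 0 = 0
  surjective : ∀ x, Function.Surjective (H x)

/-- The height over `x` of the level set `{H = c}`. -/
noncomputable def streamHeight (H : ℝ → ℝ → ℝ) (x c : ℝ) : ℝ := Function.invFun (H x) c

/-- The horizontal speed over `x` along the level set `{H = c}`. -/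
noncomputable def streamSpeed (H b₁ : ℝ → ℝ → ℝ) (c x : ℝ) : ℝ := b₁ x (streamHeight H x c)

/-- The time needed to travel from abscissa `0` to abscissa `x` along `{H = c}`, `c ≠ 0`. -/
noncomputable def streamClock (H b₁ : ℝ → ℝ → ℝ) (c x : ℝ) : ℝ :=
  if c = 0 then 0 else ∫ r in (0 : ℝ)..x, 1 / streamSpeed H b₁ c r

/-- The abscissa at time `τ` along `{H = c}`. -/
noncomputable def streamAbscissa (H b₁ : ℝ → ℝ → ℝ) (c τ : ℝ) : ℝ :=
  if c = 0 then 0 else Function.invFun (streamClock H b₁ c) τ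

/-- The point with time `τ` on `{H = c}`. -/
noncomputable def streamPoint (H b₁ : ℝ → ℝ → ℝ) (τ c : ℝ) : ℝ × ℝ :=
  (streamAbscissa H b₁ c τ, streamHeight H (streamAbscissa H b₁ c τ) c)

/-- The flow along the level sets of `H`. -/
noncomputable def streamFlow (H b₁ : ℝ → ℝ → ℝ) (t x y : ℝ) : ℝ × ℝ :=
  streamPoint H b₁ (streamClock H b₁ (H x y) x + t) (H x y)

namespace IsGraphStreamFunction

variable {H b₁ b₂ : ℝ → ℝ → ℝ} {B : ℝ}

theorem hasDerivAt_snd (h : IsGraphStreamFunction H b₁ b₂ B) (x y : ℝ) :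
    HasDerivAt (H x) (b₁ x y) y := by
  have h1 : HasDerivAt (fun r : ℝ => (x, r)) ((0 : ℝ), (1 : ℝ)) y :=
    (hasDerivAt_const y x).prodMk (hasDerivAt_id y)
  have h2 := (h.hasFDerivAt x y).comp_hasDerivAt y h1
  have h3 : (b₁ x y • ContinuousLinearMap.snd ℝ ℝ ℝ - b₂ x y • ContinuousLinearMap.fst ℝ ℝ ℝ)
      ((0 : ℝ), (1 : ℝ)) = b₁ x y := by simp
  rw [h3] at h2
  exact h2

theorem continuous_stream (h : IsGraphStreamFunction H b₁ b₂ B) :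
    Continuous fun z : ℝ × ℝ => H z.1 z.2 :=
  continuous_iff_continuousAt.2 fun z => (h.hasFDerivAt z.1 z.2).continuousAt

theorem continuous_stream_right (h : IsGraphStreamFunction H b₁ b₂ B) (x : ℝ) :
    Continuous (H x) := h.continuous_stream.comp (by fun_prop : Continuous fun y => (x, y))

/-- Positivity of b₁ is only known off the axis, so the two half lines are treated separately and
glued at 0. -/
theorem strictMono (h : IsGraphStreamFunction H b₁ b₂ B) (x : ℝ) : StrictMono (H x) := by
  refine StrictMonoOn.Iic_union_Ici (a := 0) ?_ ?_
  · refine strictMonoOn_of_deriv_pos (convex_Iic 0) (h.continuous_stream_right x).continuousOn ?_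
    intro y hy
    rw [interior_Iic] at hy
    rw [(h.hasDerivAt_snd x y).deriv]
    exact h.pos x y (ne_of_lt hy)
  · refine strictMonoOn_of_deriv_pos (convex_Ici 0) (h.continuous_stream_right x).continuousOn ?_
    intro y hy
    rw [interior_Ici] at hy
    rw [(h.hasDerivAt_snd x y).deriv]
    exact h.pos x y (ne_of_gt hy)

theorem stream_height (h : IsGraphStreamFunction H b₁ b₂ B) (x c : ℝ) :
    H x (streamHeight H x c) = c := Function.rightInverse_invFun (h.surjective x) c

theorem height_stream (h : IsGraphStreamFunction H b₁ b₂ B) (x y : ℝ) :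
    streamHeight H x (H x y) = y := Function.leftInverse_invFun (h.strictMono x).injective y

theorem stream_eq_zero (h : IsGraphStreamFunction H b₁ b₂ B) {x y : ℝ} :
    H x y = 0 ↔ y = 0 := by
  simpa only [h.map_zero] using (h.strictMono x).injective.eq_iff (a := y) (b := 0)

theorem height_ne_zero (h : IsGraphStreamFunction H b₁ b₂ B) (x : ℝ) {c : ℝ} (hc : c ≠ 0) :
    streamHeight H x c ≠ 0 := fun h0 => hc (by rw [← h.stream_height x c, h0, h.map_zero])

theorem continuous_height (h : IsGraphStreamFunction H b₁ b₂ B) :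
    Continuous fun z : ℝ × ℝ => streamHeight H z.1 z.2 :=
  continuous_inverse_of_strictMono
    (fun y => h.continuous_stream.comp (by fun_prop : Continuous fun x => (x, y)))
    h.strictMono h.stream_height

theorem continuous_speed (h : IsGraphStreamFunction H b₁ b₂ B) :
    Continuous fun z : ℝ × ℝ => streamSpeed H b₁ z.1 z.2 :=
  h.cont_fst.comp (continuous_snd.prodMk (h.continuous_height.comp continuous_swap))

theorem speed_pos (h : IsGraphStreamFunction H b₁ b₂ B) {c : ℝ} (hc : c ≠ 0) (x : ℝ) :
    0 < streamSpeed H b₁ c x := h.pos _ _ (h.height_ne_zero x hc)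

theorem speed_le (h : IsGraphStreamFunction H b₁ b₂ B) (c x : ℝ) :
    streamSpeed H b₁ c x ≤ B := (le_abs_self _).trans (h.abs_fst_le _ _)

theorem bound_pos (h : IsGraphStreamFunction H b₁ b₂ B) : 0 < B :=
  (h.pos 0 1 one_ne_zero).trans_le ((le_abs_self _).trans (h.abs_fst_le 0 1))

theorem continuous_one_div_speed (h : IsGraphStreamFunction H b₁ b₂ B) {c : ℝ} (hc : c ≠ 0) :
    Continuous fun x => 1 / streamSpeed H b₁ c x :=
  continuous_const.div (h.continuous_speed.comp (by fun_prop : Continuous fun x => (c, x)))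
    fun x => (h.speed_pos hc x).ne'

theorem hasDerivAt_clock (h : IsGraphStreamFunction H b₁ b₂ B) {c : ℝ} (hc : c ≠ 0) (x : ℝ) :
    HasDerivAt (streamClock H b₁ c) (1 / streamSpeed H b₁ c x) x := by
  have h1 := (h.continuous_one_div_speed hc).integral_hasStrictDerivAt 0 x
  have h2 : streamClock H b₁ c = fun x => ∫ r in (0 : ℝ)..x, 1 / streamSpeed H b₁ c r := by
    funext x; simp [streamClock, hc]
  rw [h2]; exact h1.hasDerivAt

theorem clock_sub (h : IsGraphStreamFunction H b₁ b₂ B) {c : ℝ} (hc : c ≠ 0) (x x' : ℝ) :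
    streamClock H b₁ c x' - streamClock H b₁ c x = ∫ r in x..x', 1 / streamSpeed H b₁ c r := by
  have hi : ∀ a b, IntervalIntegrable (fun r => 1 / streamSpeed H b₁ c r) volume a b :=
    fun a b => (h.continuous_one_div_speed hc).intervalIntegrable a b
  simp only [streamClock, hc, if_false]
  exact intervalIntegral.integral_interval_sub_left (hi _ _) (hi _ _)

theorem strictMono_clock (h : IsGraphStreamFunction H b₁ b₂ B) {c : ℝ} (hc : c ≠ 0) :
    StrictMono (streamClock H b₁ c) :=
  strictMono_of_deriv_pos fun x => by
    rw [(h.hasDerivAt_clock hc x).deriv]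
    exact one_div_pos.2 (h.speed_pos hc x)

/-- The speed is at most B, so the slowness is at least 1 / B. This makes the clock unbounded in
both directions, so that trajectories exist for all times. -/
theorem le_clock_sub (h : IsGraphStreamFunction H b₁ b₂ B) {c : ℝ} (hc : c ≠ 0) {x x' : ℝ}
    (hx : x ≤ x') : (x' - x) / B ≤ streamClock H b₁ c x' - streamClock H b₁ c x := by
  rw [h.clock_sub hc]
  have h1 : ∫ _r in x..x', 1 / B = (x' - x) / B := by
    rw [intervalIntegral.integral_const]; simp [div_eq_mul_inv]
  rw [← h1]
  refine intervalIntegral.integral_mono_on hx (by simp)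
    ((h.continuous_one_div_speed hc).intervalIntegrable _ _) fun r _ => ?_
  exact one_div_le_one_div_of_le (h.speed_pos hc r) (h.speed_le c r)

theorem clock_zero {c : ℝ} : streamClock H b₁ c 0 = 0 := by
  simp [streamClock]

theorem surjective_clock (h : IsGraphStreamFunction H b₁ b₂ B) {c : ℝ} (hc : c ≠ 0) :
    Function.Surjective (streamClock H b₁ c) := by
  have hB := h.bound_pos
  have hcont : Continuous (streamClock H b₁ c) :=
    continuous_iff_continuousAt.2 fun x => (h.hasDerivAt_clock hc x).continuousAt
  refine hcont.surjective ?_ ?_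
  · refine tendsto_atTop_mono' atTop ?_
      ((tendsto_id.atTop_div_const hB : Tendsto (fun x : ℝ => x / B) atTop atTop))
    filter_upwards [eventually_ge_atTop 0] with x hx
    simpa [clock_zero] using h.le_clock_sub hc hx
  · refine tendsto_atBot_mono' atBot ?_
      ((tendsto_id.atBot_div_const hB : Tendsto (fun x : ℝ => x / B) atBot atBot))
    filter_upwards [eventually_le_atBot 0] with x hx
    have := h.le_clock_sub hc hx
    simp only [clock_zero, zero_sub, neg_div] at this
    linarith

theorem clock_abscissa (h : IsGraphStreamFunction H b₁ b₂ B) {c : ℝ} (hc : c ≠ 0) (τ : ℝ) :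
    streamClock H b₁ c (streamAbscissa H b₁ c τ) = τ := by
  simp only [streamAbscissa, hc, if_false]
  exact Function.rightInverse_invFun (h.surjective_clock hc) τ

theorem abscissa_clock (h : IsGraphStreamFunction H b₁ b₂ B) {c : ℝ} (hc : c ≠ 0) (x : ℝ) :
    streamAbscissa H b₁ c (streamClock H b₁ c x) = x := by
  simp only [streamAbscissa, hc, if_false]
  exact Function.leftInverse_invFun (h.strictMono_clock hc).injective x

theorem continuous_clock (h : IsGraphStreamFunction H b₁ b₂ B) :
    Continuous fun z : {c : ℝ // c ≠ 0} × ℝ => streamClock H b₁ z.1 z.2 := by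
  have h1 : Continuous (Function.uncurry fun (c : {c : ℝ // c ≠ 0}) (r : ℝ) =>
      1 / streamSpeed H b₁ c r) :=
    continuous_const.div (h.continuous_speed.comp
      (by fun_prop : Continuous fun z : {c : ℝ // c ≠ 0} × ℝ => (z.1.1, z.2)))
      fun z => (h.speed_pos z.1.2 z.2).ne'
  have h2 := intervalIntegral.continuous_parametric_primitive_of_continuous
    (μ := volume) (a₀ := 0) h1
  refine h2.congr fun z => ?_
  simp [streamClock, z.1.2]

theorem continuous_abscissa (h : IsGraphStreamFunction H b₁ b₂ B) :
    Continuous fun z : {c : ℝ // c ≠ 0} × ℝ => streamAbscissa H b₁ z.1 z.2 :=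
  continuous_inverse_of_strictMono (P := {c : ℝ // c ≠ 0})
    (F := fun c x => streamClock H b₁ c x)
    (G := fun c x => streamAbscissa H b₁ c x)
    (fun x => h.continuous_clock.comp (by fun_prop : Continuous fun c => (c, x)))
    (fun c => h.strictMono_clock c.2) (fun c => h.clock_abscissa c.2)

end IsGraphStreamFunction

/-! ### Measurability and preservation of Lebesgue measure -/

theorem measurable_of_continuous_off_zero {F : ℝ → ℝ → ℝ} (h0 : ∀ x, F 0 x = 0)
    (hF : Continuous fun z : {c : ℝ // c ≠ 0} × ℝ => F z.1 z.2) :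
    Measurable fun z : ℝ × ℝ => F z.1 z.2 := by
  have hs : MeasurableSet {z : ℝ × ℝ | z.1 = 0} := measurableSet_eq_fun measurable_fst
    measurable_const
  refine measurable_of_restrict_of_restrict_compl hs ?_ ?_
  · have : ({z : ℝ × ℝ | z.1 = 0}.domRestrict fun z : ℝ × ℝ => F z.1 z.2) = fun _ => 0 := by
      funext z
      obtain ⟨⟨c, x⟩, hz⟩ := z
      simp only [mem_ofPred_eq] at hz
      subst hz
      simp [Set.domRestrict, h0]
    rw [this]; exact measurable_const
  · have h1 : Continuous fun z : ({z : ℝ × ℝ | z.1 = 0}ᶜ : Set (ℝ × ℝ)) =>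
        ((⟨z.1.1, z.2⟩, z.1.2) : {c : ℝ // c ≠ 0} × ℝ) := by fun_prop
    exact (hF.comp h1).measurable

namespace IsGraphStreamFunction

variable {H b₁ b₂ : ℝ → ℝ → ℝ} {B : ℝ}

/-- The speed may vanish on the level c = 0, so joint continuity is only available off that level;
the conventional value 0 there keeps the clock measurable. -/
theorem measurable_clock (h : IsGraphStreamFunction H b₁ b₂ B) :
    Measurable fun z : ℝ × ℝ => streamClock H b₁ z.1 z.2 :=
  measurable_of_continuous_off_zero (fun x => by simp [streamClock]) h.continuous_clock

theorem measurable_abscissa (h : IsGraphStreamFunction H b₁ b₂ B) :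
    Measurable fun z : ℝ × ℝ => streamAbscissa H b₁ z.1 z.2 :=
  measurable_of_continuous_off_zero (fun x => by simp [streamAbscissa]) h.continuous_abscissa

theorem measurable_point (h : IsGraphStreamFunction H b₁ b₂ B) :
    Measurable fun z : ℝ × ℝ => streamPoint H b₁ z.1 z.2 := by
  have h1 : Measurable fun z : ℝ × ℝ => streamAbscissa H b₁ z.2 z.1 :=
    h.measurable_abscissa.comp measurable_swap
  exact h1.prodMk (h.continuous_height.measurable.comp (h1.prodMk measurable_snd))

theorem measurable_flow (h : IsGraphStreamFunction H b₁ b₂ B) (t : ℝ) :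
    Measurable fun z : ℝ × ℝ => streamFlow H b₁ t z.1 z.2 := by
  have h1 := h.continuous_stream.measurable
  exact h.measurable_point.comp
    (((h.measurable_clock.comp (h1.prodMk measurable_fst)).add_const t).prodMk h1)

theorem flow_zero (h : IsGraphStreamFunction H b₁ b₂ B) (x : ℝ) {y : ℝ} (hy : y ≠ 0) :
    streamFlow H b₁ 0 x y = (x, y) := by
  have hc : H x y ≠ 0 := fun h0 => hy (h.stream_eq_zero.1 h0)
  simp only [streamFlow, streamPoint, add_zero, h.abscissa_clock hc, h.height_stream]

/-- In the coordinates given by the clock and the stream function, Lebesgue measure is Lebesgue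
measure. -/
theorem lintegral_clock_stream (h : IsGraphStreamFunction H b₁ b₂ B) {F : ℝ × ℝ → ℝ≥0∞}
    (hF : Measurable F) :
    ∫⁻ z : ℝ × ℝ, F (streamClock H b₁ (H z.1 z.2) z.1, H z.1 z.2) = ∫⁻ z : ℝ × ℝ, F z := by
  have hcs := h.measurable_clock
  have hst := h.continuous_stream.measurable
  have hsp := h.continuous_speed.measurable
  rw [Measure.volume_eq_prod, lintegral_prod _ (by fun_prop),
    lintegral_prod_symm _ hF.aemeasurable]
  -- Two substitutions: dc = b₁ dy at fixed x and, after swapping the integrals, dτ = dx / speed at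
  -- fixed c. The Jacobians cancel.
  have h1 : ∀ x, ∫⁻ y, F (streamClock H b₁ (H x y) x, H x y) =
      ∫⁻ c, ENNReal.ofReal (1 / streamSpeed H b₁ c x) * F (streamClock H b₁ c x, c) := by
    intro x
    have h2 := lintegral_image_eq_lintegral_abs_deriv_mul (f := H x) (f' := b₁ x)
      MeasurableSet.univ (fun y _ => (h.hasDerivAt_snd x y).hasDerivWithinAt)
      (h.strictMono x).injective.injOn
      (fun c => ENNReal.ofReal (1 / streamSpeed H b₁ c x) * F (streamClock H b₁ c x, c))
    rw [image_univ, (h.surjective x).range_eq, Measure.restrict_univ] at h2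
    rw [h2]
    have h0 : ∀ᵐ y : ℝ, y ≠ 0 := by simp [ae_iff]
    refine lintegral_congr_ae ?_
    filter_upwards [h0] with y hy
    have hp := h.pos x y hy
    rw [streamSpeed, h.height_stream, ← mul_assoc, ← ENNReal.ofReal_mul (abs_nonneg _),
      abs_of_pos hp, mul_one_div_cancel hp.ne', ENNReal.ofReal_one, one_mul]
  have h3 : ∀ c, c ≠ 0 → ∫⁻ x, ENNReal.ofReal (1 / streamSpeed H b₁ c x) *
      F (streamClock H b₁ c x, c) = ∫⁻ τ, F (τ, c) := by
    intro c hc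
    have h2 := lintegral_image_eq_lintegral_abs_deriv_mul (f := streamClock H b₁ c)
      (f' := fun x => 1 / streamSpeed H b₁ c x)
      MeasurableSet.univ (fun x _ => (h.hasDerivAt_clock hc x).hasDerivWithinAt)
      (h.strictMono_clock hc).injective.injOn (fun τ => F (τ, c))
    rw [image_univ, (h.surjective_clock hc).range_eq, Measure.restrict_univ] at h2
    rw [h2]
    refine lintegral_congr fun x => ?_
    rw [abs_of_pos (one_div_pos.2 (h.speed_pos hc x))]
  simp_rw [h1]
  rw [lintegral_lintegral_swap]
  · have h0 : ∀ᵐ y : ℝ, y ≠ 0 := by simp [ae_iff]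
    refine lintegral_congr_ae ?_
    filter_upwards [h0] with c hc
    exact h3 c hc
  · have h4 : Measurable fun p : ℝ × ℝ => streamSpeed H b₁ p.2 p.1 := hsp.comp measurable_swap
    have h5 : Measurable fun p : ℝ × ℝ => streamClock H b₁ p.2 p.1 := hcs.comp measurable_swap
    refine Measurable.aemeasurable ?_
    show Measurable fun p : ℝ × ℝ => ENNReal.ofReal (1 / streamSpeed H b₁ p.2 p.1) *
      F (streamClock H b₁ p.2 p.1, p.2)
    fun_prop

theorem ae_snd_ne_zero : ∀ᵐ z : ℝ × ℝ, z.2 ≠ 0 := by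
  have h0 : ∀ᵐ y : ℝ, y ≠ 0 := by simp [ae_iff]
  rw [Measure.volume_eq_prod]
  exact Measure.quasiMeasurePreserving_snd.ae h0

/-- In the coordinates (clock, level) the flow by time r translates the first coordinate by r, so
the measure of the preimage of a set does not depend on r. At r = 0 the flow is the identity off the
axis. -/
theorem measurePreserving_flow (h : IsGraphStreamFunction H b₁ b₂ B) (t : ℝ) :
    MeasurePreserving (fun z : ℝ × ℝ => streamFlow H b₁ t z.1 z.2) volume volume := by
  refine ⟨h.measurable_flow t, Measure.ext fun A hA => ?_⟩
  rw [Measure.map_apply (h.measurable_flow t) hA]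
  have hpt := h.measurable_point
  have hind : ∀ r : ℝ, Measurable fun z : ℝ × ℝ =>
      A.indicator (1 : ℝ × ℝ → ℝ≥0∞) (streamPoint H b₁ (z.1 + r) z.2) := fun r =>
    (measurable_one.indicator hA).comp
      (hpt.comp ((measurable_fst.add_const r).prodMk measurable_snd))
  have key : ∀ r : ℝ, volume ((fun z : ℝ × ℝ => streamFlow H b₁ r z.1 z.2) ⁻¹' A) =
      ∫⁻ z : ℝ × ℝ, A.indicator (1 : ℝ × ℝ → ℝ≥0∞) (streamPoint H b₁ z.1 z.2) := by
    intro r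
    rw [← lintegral_indicator_one ((h.measurable_flow r) hA)]
    have h1 := h.lintegral_clock_stream (hind r)
    have h2 : ∫⁻ z : ℝ × ℝ, A.indicator (1 : ℝ × ℝ → ℝ≥0∞) (streamPoint H b₁ (z.1 + r) z.2) =
        ∫⁻ z : ℝ × ℝ, A.indicator (1 : ℝ × ℝ → ℝ≥0∞) (streamPoint H b₁ z.1 z.2) := by
      have := lintegral_add_right_eq_self (μ := (volume : Measure (ℝ × ℝ)))
        (fun z => A.indicator (1 : ℝ × ℝ → ℝ≥0∞) (streamPoint H b₁ z.1 z.2)) (r, 0)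
      simpa using this
    rw [← h2, ← h1]
    rfl
  rw [key t, ← key 0]
  refine measure_congr ?_
  filter_upwards [ae_snd_ne_zero] with z hz
  refine propext ?_
  show streamFlow H b₁ 0 z.1 z.2 ∈ A ↔ z ∈ A
  rw [h.flow_zero z.1 hz]

end IsGraphStreamFunction

/-! ### Flow curves solve the differential equation and are its only solutions -/

namespace IsGraphStreamFunction

variable {H b₁ b₂ : ℝ → ℝ → ℝ} {B : ℝ}

/-- Off the axis the map (x, y) ↦ (x, H x y) has an invertible differential, and its inverse (x, c)
↦ (x, height) is already known to be continuous, hence it is differentiable. -/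
theorem hasDerivAt_height (h : IsGraphStreamFunction H b₁ b₂ B) {c : ℝ} (hc : c ≠ 0) (x : ℝ) :
    HasDerivAt (fun r => streamHeight H r c)
      (b₂ x (streamHeight H x c) / b₁ x (streamHeight H x c)) x := by
  set y := streamHeight H x c with hy
  have hp : b₁ x y ≠ 0 := (h.pos x y (h.height_ne_zero x hc)).ne'
  let L : (ℝ × ℝ) →L[ℝ] ℝ × ℝ := (ContinuousLinearMap.fst ℝ ℝ ℝ).prod
    (b₁ x y • ContinuousLinearMap.snd ℝ ℝ ℝ - b₂ x y • ContinuousLinearMap.fst ℝ ℝ ℝ)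
  let L' : (ℝ × ℝ) →L[ℝ] ℝ × ℝ := (ContinuousLinearMap.fst ℝ ℝ ℝ).prod
    ((b₁ x y)⁻¹ • ContinuousLinearMap.snd ℝ ℝ ℝ +
      (b₂ x y / b₁ x y) • ContinuousLinearMap.fst ℝ ℝ ℝ)
  let e : (ℝ × ℝ) ≃L[ℝ] ℝ × ℝ := ContinuousLinearEquiv.equivOfInverse L L'
    (fun z => by ext <;> simp [L, L']; field_simp; ring)
    (fun z => by ext <;> simp [L, L']; field_simp; ring)
  have hf : HasFDerivAt (fun z : ℝ × ℝ => (z.1, H z.1 z.2)) (e : (ℝ × ℝ) →L[ℝ] ℝ × ℝ)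
      ((fun w : ℝ × ℝ => (w.1, streamHeight H w.1 w.2)) (x, c)) :=
    hasFDerivAt_fst.prodMk (h.hasFDerivAt x y)
  have hg : ContinuousAt (fun w : ℝ × ℝ => (w.1, streamHeight H w.1 w.2)) (x, c) :=
    (continuous_fst.prodMk h.continuous_height).continuousAt
  have h1 := HasFDerivAt.of_local_left_inverse hg hf
    (Eventually.of_forall fun w => by simp [h.stream_height])
  have h2 : HasDerivAt (fun r : ℝ => (r, c)) ((1 : ℝ), (0 : ℝ)) x :=
    (hasDerivAt_id x).prodMk (hasDerivAt_const x c)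
  have h3 := (hasFDerivAt_snd.comp _ h1).comp_hasDerivAt x h2
  have h4 : ((ContinuousLinearMap.snd ℝ ℝ ℝ).comp (e.symm : (ℝ × ℝ) →L[ℝ] ℝ × ℝ))
      ((1 : ℝ), (0 : ℝ)) = b₂ x y / b₁ x y := by
    show (L' (1, 0)).2 = _
    simp [L']
  rw [h4] at h3
  exact h3

theorem hasDerivAt_abscissa (h : IsGraphStreamFunction H b₁ b₂ B) {c : ℝ} (hc : c ≠ 0) (τ : ℝ) :
    HasDerivAt (streamAbscissa H b₁ c) (streamSpeed H b₁ c (streamAbscissa H b₁ c τ)) τ := by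
  have h1 : Continuous (streamAbscissa H b₁ c) :=
    h.continuous_abscissa.comp
      (by fun_prop : Continuous fun τ : ℝ => ((⟨c, hc⟩ : {c : ℝ // c ≠ 0}), τ))
  have h2 := h.hasDerivAt_clock hc (streamAbscissa H b₁ c τ)
  have h3 := HasDerivAt.of_local_left_inverse h1.continuousAt h2
    (one_div_pos.2 (h.speed_pos hc _)).ne' (Eventually.of_forall (h.clock_abscissa hc))
  simpa using h3

theorem stream_ne_zero (h : IsGraphStreamFunction H b₁ b₂ B) (x : ℝ) {y : ℝ} (hy : y ≠ 0) :
    H x y ≠ 0 := fun h0 => hy (h.stream_eq_zero.1 h0)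

theorem hasDerivAt_flow_fst (h : IsGraphStreamFunction H b₁ b₂ B) (x : ℝ) {y : ℝ} (hy : y ≠ 0)
    (t : ℝ) : HasDerivAt (fun t => (streamFlow H b₁ t x y).1)
      (b₁ (streamFlow H b₁ t x y).1 (streamFlow H b₁ t x y).2) t := by
  have hc := h.stream_ne_zero x hy
  exact (h.hasDerivAt_abscissa hc _).comp_const_add (streamClock H b₁ (H x y) x) t

theorem hasDerivAt_flow_snd (h : IsGraphStreamFunction H b₁ b₂ B) (x : ℝ) {y : ℝ} (hy : y ≠ 0)
    (t : ℝ) : HasDerivAt (fun t => (streamFlow H b₁ t x y).2)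
      (b₂ (streamFlow H b₁ t x y).1 (streamFlow H b₁ t x y).2) t := by
  have hc := h.stream_ne_zero x hy
  have h1 := (h.hasDerivAt_height hc _).comp t (h.hasDerivAt_flow_fst x hy t)
  have h2 : b₁ (streamFlow H b₁ t x y).1 (streamFlow H b₁ t x y).2 ≠ 0 :=
    (h.pos _ _ (h.height_ne_zero _ hc)).ne'
  have h3 := div_mul_cancel₀ (b₂ (streamFlow H b₁ t x y).1 (streamFlow H b₁ t x y).2) h2
  rw [← h3]
  exact h1

end IsGraphStreamFunction

theorem eq_left_of_hasDerivAt_zero {f : ℝ → ℝ} {a b : ℝ} (hab : a ≤ b)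
    (hc : ContinuousOn f (Icc a b)) (hd : ∀ t ∈ Ioo a b, HasDerivAt f 0 t) : f b = f a := by
  rcases hab.eq_or_lt with rfl | hlt
  · rfl
  · obtain ⟨t, _, h2⟩ := exists_hasDerivAt_eq_slope f (fun _ => 0) hlt hc hd
    have h3 := (div_eq_zero_iff.1 h2.symm).resolve_right (sub_pos.2 hlt).ne'
    linarith

/-- An absolutely continuous function is the integral of its derivative; if this agrees almost
everywhere with a continuous v, the fundamental theorem of calculus applies at every interior point.
This upgrades the almost everywhere equation of a regular Lagrangian flow to a classical one. -/
theorem AbsolutelyContinuousOnInterval.hasDerivAt_of_ae {f v : ℝ → ℝ} {s : ℝ}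
    (hf : AbsolutelyContinuousOnInterval f 0 s) (hv : ContinuousOn v (Icc 0 s))
    (hd : ∀ᵐ t, t ∈ Ioo 0 s → HasDerivAt f (v t) t) {t : ℝ} (ht : t ∈ Ioo 0 s) :
    HasDerivAt f (v t) t := by
  have hs : 0 ≤ s := (ht.1.trans ht.2).le
  have h1 : ∀ r ∈ Icc 0 s, f r = f 0 + ∫ q in (0 : ℝ)..r, v q := by
    intro r hr
    have h2 : AbsolutelyContinuousOnInterval f 0 r := hf.mono (by
      rw [uIcc_of_le hr.1, uIcc_of_le hs]; exact Icc_subset_Icc_right hr.2)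
    have h3 := h2.integral_deriv_eq_sub
    have hne : ∀ᵐ q : ℝ, q ≠ r := by simp [ae_iff]
    have h4 : ∫ q in (0 : ℝ)..r, deriv f q = ∫ q in (0 : ℝ)..r, v q := by
      refine intervalIntegral.integral_congr_ae ?_
      filter_upwards [hd, hne] with q hq hqr hmem
      rw [uIoc_of_le hr.1] at hmem
      exact (hq ⟨hmem.1, (lt_of_le_of_ne hmem.2 hqr).trans_le hr.2⟩).deriv
    linarith
  have hnhds : Icc 0 s ∈ 𝓝 t := Icc_mem_nhds ht.1 ht.2
  have hvt : ContinuousAt v t := hv.continuousAt hnhds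
  have h5 : HasDerivAt (fun r => f 0 + ∫ q in (0 : ℝ)..r, v q) (v t) t := by
    refine (intervalIntegral.integral_hasDerivAt_right ?_ ?_ hvt).const_add _
    · refine ContinuousOn.intervalIntegrable ?_
      rw [uIcc_of_le ht.1.le]
      exact hv.mono (Icc_subset_Icc_right ht.2.le)
    · exact ContinuousOn.stronglyMeasurableAtFilter_nhdsWithin
        (hv.mono Ioo_subset_Icc_self) measurableSet_Ioo t |>.filter_mono
          (by rw [isOpen_Ioo.nhdsWithin_eq ht])
  refine h5.congr_of_eventuallyEq ?_
  filter_upwards [hnhds] with r hr using h1 r hr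

namespace IsGraphStreamFunction

variable {H b₁ b₂ : ℝ → ℝ → ℝ} {B : ℝ}

/-- A curve that solves the differential equation in the interior of `[0, s]` and starts off the
axis is the flow curve. -/
theorem eq_flow_of_hasDerivAt (h : IsGraphStreamFunction H b₁ b₂ B) {γ₁ γ₂ : ℝ → ℝ} {s : ℝ}
    (hs : 0 ≤ s) (hc₁ : ContinuousOn γ₁ (Icc 0 s)) (hc₂ : ContinuousOn γ₂ (Icc 0 s))
    (hd₁ : ∀ t ∈ Ioo 0 s, HasDerivAt γ₁ (b₁ (γ₁ t) (γ₂ t)) t)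
    (hd₂ : ∀ t ∈ Ioo 0 s, HasDerivAt γ₂ (b₂ (γ₁ t) (γ₂ t)) t) (h0 : γ₂ 0 ≠ 0) :
    streamFlow H b₁ s (γ₁ 0) (γ₂ 0) = (γ₁ s, γ₂ s) := by
  -- H is conserved because its differential b₁ dy - b₂ dx annihilates (b₁, b₂).
  have hconst : ∀ t ∈ Icc 0 s, H (γ₁ t) (γ₂ t) = H (γ₁ 0) (γ₂ 0) := by
    intro r hr
    refine eq_left_of_hasDerivAt_zero (f := fun t => H (γ₁ t) (γ₂ t)) hr.1
      ((h.continuous_stream.comp_continuousOn (hc₁.prodMk hc₂)).mono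
        (Icc_subset_Icc_right hr.2)) fun t ht => ?_
    have ht' : t ∈ Ioo 0 s := ⟨ht.1, ht.2.trans_le hr.2⟩
    have h1 := (h.hasFDerivAt (γ₁ t) (γ₂ t)).comp_hasDerivAt t
      ((hd₁ t ht').prodMk (hd₂ t ht'))
    have h2 : (b₁ (γ₁ t) (γ₂ t) • ContinuousLinearMap.snd ℝ ℝ ℝ -
        b₂ (γ₁ t) (γ₂ t) • ContinuousLinearMap.fst ℝ ℝ ℝ)
        (b₁ (γ₁ t) (γ₂ t), b₂ (γ₁ t) (γ₂ t)) = 0 := by simp; ring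
    rw [h2] at h1
    exact h1
  have hc := h.stream_ne_zero (γ₁ 0) h0
  set c := H (γ₁ 0) (γ₂ 0) with hcdef
  have hht : ∀ t ∈ Icc 0 s, streamHeight H (γ₁ t) c = γ₂ t := fun t ht => by
    rw [← hconst t ht, h.height_stream]
  -- On a fixed level the clock runs at unit rate, so clock minus time is conserved too; the two
  -- constants determine the curve.
  have hclock : streamClock H b₁ c (γ₁ s) - s = streamClock H b₁ c (γ₁ 0) - 0 := by
    have hcc : Continuous (streamClock H b₁ c) :=
      continuous_iff_continuousAt.2 fun x => (h.hasDerivAt_clock hc x).continuousAt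
    refine eq_left_of_hasDerivAt_zero (f := fun t => streamClock H b₁ c (γ₁ t) - t) hs
      ((hcc.comp_continuousOn hc₁).sub continuousOn_id) fun t ht => ?_
    have h1 := ((h.hasDerivAt_clock hc (γ₁ t)).comp t (hd₁ t ht)).sub (hasDerivAt_id t)
    have hp := h.speed_pos hc (γ₁ t)
    have h2 : 1 / streamSpeed H b₁ c (γ₁ t) * b₁ (γ₁ t) (γ₂ t) - 1 = 0 := by
      rw [streamSpeed, hht t (Ioo_subset_Icc_self ht)] at hp ⊢
      rw [one_div_mul_cancel hp.ne', sub_self]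
    rw [h2] at h1
    exact h1
  have h3 : streamClock H b₁ c (γ₁ 0) + s = streamClock H b₁ c (γ₁ s) := by linarith
  simp only [streamFlow, streamPoint, ← hcdef, h3, h.abscissa_clock hc,
    hht s (right_mem_Icc.2 hs)]

end IsGraphStreamFunction

/-! ### Existence and uniqueness of the regular Lagrangian flow -/

/-- The plane field with components `b₁` and `b₂`. -/
noncomputable def planeField (b₁ b₂ : ℝ → ℝ → ℝ) (z : Euc 2) : Euc 2 :=
  !₂[b₁ (z 0) (z 1), b₂ (z 0) (z 1)]

/-- The flow along the level sets of `H`, as a map of the Euclidean plane. -/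
noncomputable def planeFlow (H b₁ : ℝ → ℝ → ℝ) (t : ℝ) (z : Euc 2) : Euc 2 :=
  !₂[(streamFlow H b₁ t (z 0) (z 1)).1, (streamFlow H b₁ t (z 0) (z 1)).2]

/-- The identification of the Euclidean plane with `ℝ × ℝ`. -/
noncomputable def planeEquiv : Euc 2 ≃ᵐ ℝ × ℝ :=
  (MeasurableEquiv.toLp 2 (Fin 2 → ℝ)).symm.trans MeasurableEquiv.finTwoArrow

theorem measurePreserving_planeEquiv : MeasurePreserving planeEquiv volume volume :=
  (volume_preserving_finTwoArrow ℝ).comp (PiLp.volume_preserving_ofLp (Fin 2))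

theorem ae_plane_snd_ne_zero : ∀ᵐ z : Euc 2, z 1 ≠ 0 :=
  measurePreserving_planeEquiv.quasiMeasurePreserving.ae IsGraphStreamFunction.ae_snd_ne_zero

theorem hasDerivAt_plane_iff {γ : ℝ → Euc 2} {v : Euc 2} {t : ℝ} :
    HasDerivAt γ v t ↔ ∀ i : Fin 2, HasDerivAt (fun t => γ t i) (v i) t := by
  constructor
  · intro h i
    exact (EuclideanSpace.proj (𝕜 := ℝ) (ι := Fin 2) i).hasFDerivAt.comp_hasDerivAt t h
  · intro h
    exact (PiLp.continuousLinearEquiv 2 ℝ fun _ : Fin 2 => ℝ).symm.hasFDerivAt.comp_hasDerivAt t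
      (hasDerivAt_pi.2 h)

theorem AbsolutelyContinuousOnInterval.apply {γ : ℝ → Euc 2} {a b : ℝ}
    (hγ : AbsolutelyContinuousOnInterval γ a b) (i : Fin 2) :
    AbsolutelyContinuousOnInterval (fun t => γ t i) a b := by
  rw [absolutelyContinuousOnInterval_iff] at hγ ⊢
  intro ε hε
  obtain ⟨δ, hδ, h⟩ := hγ ε hε
  refine ⟨δ, hδ, fun E hE hE' => lt_of_le_of_lt (Finset.sum_le_sum fun j _ => ?_) (h E hE hE')⟩
  rw [dist_eq_norm, dist_eq_norm]
  exact PiLp.norm_apply_le (γ (E.2 j).1 - γ (E.2 j).2) i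

namespace IsGraphStreamFunction

variable {H b₁ b₂ : ℝ → ℝ → ℝ} {B : ℝ}

theorem hasDerivAt_planeFlow (h : IsGraphStreamFunction H b₁ b₂ B) {z : Euc 2} (hz : z 1 ≠ 0)
    (t : ℝ) : HasDerivAt (fun t => planeFlow H b₁ t z)
      (planeField b₁ b₂ (planeFlow H b₁ t z)) t := by
  rw [hasDerivAt_plane_iff]
  intro i
  fin_cases i
  · simpa [planeFlow, planeField] using h.hasDerivAt_flow_fst (z 0) hz t
  · simpa [planeFlow, planeField] using h.hasDerivAt_flow_snd (z 0) hz t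

theorem norm_planeField_le (h : IsGraphStreamFunction H b₁ b₂ B) (z : Euc 2) :
    ‖planeField b₁ b₂ z‖ ≤ 2 * B := by
  have h1 := abs_le.1 (h.abs_fst_le (z 0) (z 1))
  have h2 := abs_le.1 (h.abs_snd_le (z 0) (z 1))
  have hB := h.bound_pos
  rw [EuclideanSpace.norm_eq, Real.sqrt_le_left (by positivity)]
  simp only [Fin.sum_univ_two, planeField, Real.norm_eq_abs, sq_abs]
  simp
  nlinarith

theorem continuous_planeField (h : IsGraphStreamFunction H b₁ b₂ B) :
    Continuous (planeField b₁ b₂) := by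
  have hz : Continuous fun z : Euc 2 => (z 0, z 1) := by fun_prop
  have h1 := h.cont_fst.comp hz
  have h2 := h.cont_snd.comp hz
  refine (PiLp.continuous_toLp 2 _).comp (continuous_pi fun i => ?_)
  fin_cases i
  · exact h1
  · exact h2

theorem measurePreserving_planeFlow (h : IsGraphStreamFunction H b₁ b₂ B) (t : ℝ) :
    MeasurePreserving (planeFlow H b₁ t) volume volume :=
  (measurePreserving_planeEquiv.symm _).comp
    ((h.measurePreserving_flow t).comp measurePreserving_planeEquiv)

theorem isRegularLagrangianFlow_planeFlow (h : IsGraphStreamFunction H b₁ b₂ B) :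
    IsRegularLagrangianFlow ⊤ (fun _ => planeField b₁ b₂) (planeFlow H b₁) where
  trajectory := by
    filter_upwards [ae_plane_snd_ne_zero] with z hz
    refine ⟨fun s _ _ => ?_, ?_, ?_⟩
    · have hl : LipschitzWith (2 * B).toNNReal fun t => planeFlow H b₁ t z := by
        refine lipschitzWith_of_nnnorm_deriv_le
          (fun t => (h.hasDerivAt_planeFlow hz t).differentiableAt) fun t => ?_
        rw [(h.hasDerivAt_planeFlow hz t).deriv, ← NNReal.coe_le_coe,
          Real.coe_toNNReal _ (by have := h.bound_pos; positivity)]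
        exact h.norm_planeField_le _
      exact (hl.lipschitzOnWith).absolutelyContinuousOnInterval
    · rw [planeFlow, h.flow_zero (z 0) hz]
      ext i
      fin_cases i <;> rfl
    · exact Eventually.of_forall fun t _ _ => h.hasDerivAt_planeFlow hz t
  compression := ⟨1, one_pos, fun t _ _ =>
    ⟨(h.measurePreserving_planeFlow t).aemeasurable,
      by rw [(h.measurePreserving_planeFlow t).map_eq, one_smul]⟩⟩

/-- The field is continuous, so almost every trajectory solves the equation classically; those
starting off the axis are identified by `eq_flow_of_hasDerivAt`, and the axis is null. -/
theorem regularLagrangianFlow_eq (h : IsGraphStreamFunction H b₁ b₂ B) {T : EReal}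
    {X : ℝ → Euc 2 → Euc 2} (hX : IsRegularLagrangianFlow T (fun _ => planeField b₁ b₂) X) :
    ∀ᵐ z : Euc 2, ∀ t : ℝ, 0 ≤ t → (t : EReal) < T → X t z = planeFlow H b₁ t z := by
  filter_upwards [hX.trajectory, ae_plane_snd_ne_zero] with z hz hz1 s hs hsT
  obtain ⟨hac, h0, hd⟩ := hz
  have hac' := hac s hs hsT
  have hcont : ContinuousOn (fun t => X t z) (Icc 0 s) := by
    simpa only [uIcc_of_le hs] using hac'.continuousOn
  have hv : ContinuousOn (fun t => planeField b₁ b₂ (X t z)) (Icc 0 s) :=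
    h.continuous_planeField.comp_continuousOn hcont
  have hcomp : ∀ i : Fin 2, ∀ t ∈ Ioo 0 s,
      HasDerivAt (fun t => X t z i) (planeField b₁ b₂ (X t z) i) t := by
    intro i t ht
    refine (hac'.apply i).hasDerivAt_of_ae
      ((EuclideanSpace.proj (𝕜 := ℝ) i).continuous.comp_continuousOn hv) ?_ ht
    filter_upwards [hd] with r hr hr'
    exact hasDerivAt_plane_iff.1 (hr hr'.1 (lt_trans (by exact_mod_cast hr'.2) hsT)) i
  have hci : ∀ i : Fin 2, ContinuousOn (fun t => X t z i) (Icc 0 s) := fun i =>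
    (EuclideanSpace.proj (𝕜 := ℝ) i).continuous.comp_continuousOn hcont
  have key := h.eq_flow_of_hasDerivAt hs (hci 0) (hci 1)
    (fun t ht => by simpa [planeField] using hcomp 0 t ht)
    (fun t ht => by simpa [planeField] using hcomp 1 t ht) (by rw [h0]; exact hz1)
  rw [h0] at key
  rw [planeFlow, key]
  ext i
  fin_cases i <;> rfl

end IsGraphStreamFunction

/-! ### The radial profile M and its exponent -/

/-- The logarithmic factor `8 + log (1 + 1 / s)`. -/
noncomputable def logFactor (s : ℝ) : ℝ := 8 + Real.log (1 + s⁻¹)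

/-- The speed profile, comparable to `√s log² s` as `s → 0` and bounded. -/
noncomputable def speedProfile (s : ℝ) : ℝ := √(s / (1 + s)) * logFactor s ^ 2

/-- The logarithmic derivative `s M' / M` of the speed profile `M`. -/
noncomputable def speedExponent (s : ℝ) : ℝ := (1 / 2 - 2 / logFactor s) / (1 + s)

theorem eight_le_logFactor {s : ℝ} (hs : 0 ≤ s) : 8 ≤ logFactor s := by
  have : 0 ≤ Real.log (1 + s⁻¹) := Real.log_nonneg (by have := inv_nonneg.2 hs; linarith)
  rw [logFactor]; linarith

theorem logFactor_pos {s : ℝ} (hs : 0 ≤ s) : 0 < logFactor s := by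
  linarith [eight_le_logFactor hs]

theorem hasDerivAt_logFactor {s : ℝ} (hs : 0 < s) :
    HasDerivAt logFactor (-1 / (s * (1 + s))) s := by
  have h1 : HasDerivAt (fun s : ℝ => 1 + s⁻¹) (-(s ^ 2)⁻¹) s := (hasDerivAt_inv hs.ne').const_add 1
  have h2 : (1 : ℝ) + s⁻¹ ≠ 0 := by positivity
  have h3 := (h1.log h2).const_add 8
  convert! h3 using 1
  field_simp
  ring

theorem hasDerivAt_speedProfile {s : ℝ} (hs : 0 < s) :
    HasDerivAt speedProfile (speedExponent s * speedProfile s / s) s := by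
  have h0 : (1 : ℝ) + s ≠ 0 := by positivity
  have h1 : HasDerivAt (fun s : ℝ => s / (1 + s)) ((1 * (1 + s) - s * 1) / (1 + s) ^ 2) s :=
    (hasDerivAt_id s).div ((hasDerivAt_id s).const_add 1) h0
  have hw : 0 < s / (1 + s) := by positivity
  have h2 := (h1.sqrt hw.ne').mul ((hasDerivAt_logFactor hs).pow 2)
  convert! h2 using 1
  have hl := (logFactor_pos hs.le).ne'
  have hq : √(s / (1 + s)) ^ 2 = s / (1 + s) := Real.sq_sqrt hw.le
  have hq0 : √(s / (1 + s)) ≠ 0 := (Real.sqrt_pos.2 hw).ne'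
  simp only [speedExponent, speedProfile]
  generalize √(s / (1 + s)) = p at *
  have h4 : s = p ^ 2 * (1 + s) := by rw [hq]; field_simp
  field_simp
  norm_num
  linear_combination (-1 : ℝ) * logFactor s ^ 2 * h4

theorem speedProfile_zero : speedProfile 0 = 0 := by simp [speedProfile]

theorem speedProfile_nonneg (s : ℝ) : 0 ≤ speedProfile s := by
  unfold speedProfile; positivity

theorem speedProfile_pos {s : ℝ} (hs : 0 < s) : 0 < speedProfile s := by
  have := logFactor_pos hs.le
  have : 0 < s / (1 + s) := by positivity
  unfold speedProfile; positivity

/-- With s / (1 + s) = t⁸ the logarithmic factor is 8 + 8 log(1 / t) ≤ 8 / t, whence M ≤ t⁴ (8 / t)²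
= 64 t². -/
theorem speedProfile_le {s : ℝ} (hs : 0 ≤ s) : speedProfile s ≤ 64 * √√(s / (1 + s)) := by
  rcases hs.eq_or_lt with rfl | hs
  · simp [speedProfile]
  have hw : 0 < s / (1 + s) := by positivity
  set w := s / (1 + s) with hwdef
  set t := √√√w with ht
  have ht0 : 0 < t := by positivity
  have h1 : t ^ 2 = √√w := Real.sq_sqrt (by positivity)
  have h2 : t ^ 4 = √w := by
    have : t ^ 4 = (t ^ 2) ^ 2 := by ring
    rw [this, h1, Real.sq_sqrt (by positivity)]
  have h3 : t ^ 8 = w := by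
    have : t ^ 8 = (t ^ 4) ^ 2 := by ring
    rw [this, h2, Real.sq_sqrt hw.le]
  have h4 : logFactor s ≤ 8 / t := by
    have h5 : 1 + s⁻¹ = (t⁻¹) ^ 8 := by
      rw [inv_pow, h3, hwdef]; field_simp; ring
    rw [logFactor, h5, Real.log_pow]
    have := Real.log_le_sub_one_of_pos (inv_pos.2 ht0)
    rw [div_eq_mul_inv]
    push_cast
    linarith
  have h6 := logFactor_pos hs.le
  calc speedProfile s = t ^ 4 * logFactor s ^ 2 := by rw [speedProfile, ← h2]
    _ ≤ t ^ 4 * (8 / t) ^ 2 := by gcongr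
    _ = 64 * t ^ 2 := by field_simp; norm_num
    _ = 64 * √√w := by rw [h1]

theorem speedProfile_le_const {s : ℝ} (hs : 0 ≤ s) : speedProfile s ≤ 64 := by
  have h1 : s / (1 + s) ≤ 1 := by rw [div_le_one (by positivity)]; linarith
  have h2 : √√(s / (1 + s)) ≤ 1 := by
    rw [Real.sqrt_le_left zero_le_one, Real.sqrt_le_left (by norm_num)]; simpa using h1
  linarith [speedProfile_le hs]

theorem speedProfile_le_sqrt_sqrt {s : ℝ} (hs : 0 ≤ s) : speedProfile s ≤ 64 * √√s := by
  have h1 : s / (1 + s) ≤ s := div_le_self hs (by linarith)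
  have h2 : √√(s / (1 + s)) ≤ √√s := by gcongr
  linarith [speedProfile_le hs]

/-- The constant 8 in `logFactor` gives 2 / `logFactor` ≤ 1/4. Nonnegativity of the exponent is what
makes M monotone. -/
theorem speedExponent_nonneg {s : ℝ} (hs : 0 ≤ s) : 0 ≤ speedExponent s := by
  have h := eight_le_logFactor hs
  have : 2 / logFactor s ≤ 1 / 4 := by rw [div_le_div_iff₀ (by linarith) (by norm_num)]; linarith
  exact div_nonneg (by linarith) (by linarith)

theorem speedExponent_le {s : ℝ} (hs : 0 ≤ s) : speedExponent s ≤ 1 / 2 := by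
  have h := logFactor_pos hs
  have : 0 ≤ 2 / logFactor s := by positivity
  rw [speedExponent, div_le_iff₀ (by linarith)]
  linarith

theorem continuousOn_speedProfile : ContinuousOn speedProfile (Ici 0) := by
  intro s hs
  rcases (show (0 : ℝ) ≤ s from hs).eq_or_lt with rfl | hs
  · rw [ContinuousWithinAt, speedProfile_zero]
    have h1 : Tendsto (fun s : ℝ => 64 * √√s) (𝓝[Ici 0] 0) (𝓝 0) := by
      have : Continuous fun s : ℝ => 64 * √√s := by fun_prop
      simpa using (this.tendsto 0).mono_left nhdsWithin_le_nhds
    refine squeeze_zero' (Eventually.of_forall speedProfile_nonneg) ?_ h1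
    filter_upwards [self_mem_nhdsWithin] with s hs using speedProfile_le_sqrt_sqrt hs
  · exact (hasDerivAt_speedProfile hs).continuousAt.continuousWithinAt

theorem speedProfile_monotoneOn : MonotoneOn speedProfile (Ici 0) := by
  refine monotoneOn_of_deriv_nonneg (convex_Ici 0) continuousOn_speedProfile ?_ ?_
  · intro s hs
    rw [interior_Ici] at hs
    exact (hasDerivAt_speedProfile hs).differentiableAt.differentiableWithinAt
  · intro s hs
    rw [interior_Ici] at hs
    have hs' : 0 < s := hs
    rw [(hasDerivAt_speedProfile hs).deriv]
    have := speedExponent_nonneg hs'.le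
    have := speedProfile_nonneg s
    positivity

theorem hasDerivAt_speedExponent {s : ℝ} (hs : 0 < s) :
    HasDerivAt speedExponent
      (-speedExponent s / (1 + s) - 2 / (logFactor s ^ 2 * s * (1 + s) ^ 2)) s := by
  have hl := (logFactor_pos hs.le).ne'
  have h0 : (1 : ℝ) + s ≠ 0 := by positivity
  have h1 : HasDerivAt (fun s => 2 / logFactor s)
      ((0 * logFactor s - 2 * (-1 / (s * (1 + s)))) / logFactor s ^ 2) s :=
    (hasDerivAt_const s (2 : ℝ)).div (hasDerivAt_logFactor hs) hl
  have h2 := (h1.const_sub (1 / 2)).div ((hasDerivAt_id s).const_add 1) h0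
  convert! h2 using 1
  simp only [speedExponent, id]
  field_simp
  ring

/-- With s = r² this says that the exponent, as a function of the point, has derivative O(1 / r),
like a function homogeneous of degree 0. -/
theorem abs_mul_deriv_speedExponent_le {s : ℝ} (hs : 0 < s) :
    s * |-speedExponent s / (1 + s) - 2 / (logFactor s ^ 2 * s * (1 + s) ^ 2)| ≤ 1 := by
  have hl := eight_le_logFactor hs.le
  have he := speedExponent_nonneg hs.le
  have he' := speedExponent_le hs.le
  have h1 : -speedExponent s / (1 + s) - 2 / (logFactor s ^ 2 * s * (1 + s) ^ 2) =
      -(speedExponent s / (1 + s) + 2 / (logFactor s ^ 2 * s * (1 + s) ^ 2)) := by ring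
  rw [h1, abs_neg, abs_of_nonneg (by positivity), mul_add]
  have h2 : s * (speedExponent s / (1 + s)) ≤ 1 / 2 := by
    rw [mul_div_assoc', div_le_iff₀ (by positivity)]
    nlinarith
  have h3 : s * (2 / (logFactor s ^ 2 * s * (1 + s) ^ 2)) ≤ 1 / 2 := by
    have : s * (2 / (logFactor s ^ 2 * s * (1 + s) ^ 2)) =
        2 / (logFactor s ^ 2 * (1 + s) ^ 2) := by field_simp
    rw [this, div_le_div_iff₀ (by positivity) (by norm_num)]
    have h4 : 1 ≤ (1 + s) ^ 2 := by nlinarith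
    have h5 : 64 ≤ logFactor s ^ 2 := by nlinarith
    nlinarith
  linarith

/-! ### The oscillating profile g -/

/-- The oscillating profile `u sin u² / (1 + u²)`. -/
noncomputable def wiggle (u : ℝ) : ℝ := u * Real.sin (u ^ 2) / (1 + u ^ 2)

/-- The derivative of `wiggle`. -/
noncomputable def wiggleDeriv (u : ℝ) : ℝ :=
  Real.sin (u ^ 2) * ((1 - u ^ 2) / (1 + u ^ 2) ^ 2) +
    Real.cos (u ^ 2) * (2 * u ^ 2 / (1 + u ^ 2))

/-- The second derivative of `wiggle`. -/
noncomputable def wiggleDeriv₂ (u : ℝ) : ℝ :=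
  Real.cos (u ^ 2) * (2 * u) * ((1 - u ^ 2) / (1 + u ^ 2) ^ 2) +
    Real.sin (u ^ 2) * ((2 * u ^ 3 - 6 * u) / (1 + u ^ 2) ^ 3) +
    (-Real.sin (u ^ 2) * (2 * u) * (2 * u ^ 2 / (1 + u ^ 2)) +
      Real.cos (u ^ 2) * (4 * u / (1 + u ^ 2) ^ 2))

theorem hasDerivAt_wiggle (u : ℝ) : HasDerivAt wiggle (wiggleDeriv u) u := by
  have h0 : (1 : ℝ) + u ^ 2 ≠ 0 := by positivity
  have h1 : HasDerivAt (fun u : ℝ => u ^ 2) (2 * u) u := by simpa using hasDerivAt_pow 2 u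
  have h2 := ((hasDerivAt_id u).mul h1.sin).div (h1.const_add 1) h0
  convert! h2 using 1
  simp only [wiggleDeriv, Pi.mul_apply, id]
  field_simp
  ring

theorem hasDerivAt_wiggleDeriv (u : ℝ) : HasDerivAt wiggleDeriv (wiggleDeriv₂ u) u := by
  have h0 : (1 : ℝ) + u ^ 2 ≠ 0 := by positivity
  have h1 : HasDerivAt (fun u : ℝ => u ^ 2) (2 * u) u := by simpa using hasDerivAt_pow 2 u
  have h2 : HasDerivAt (fun u : ℝ => (1 - u ^ 2) / (1 + u ^ 2) ^ 2)
      ((2 * u ^ 3 - 6 * u) / (1 + u ^ 2) ^ 3) u := by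
    have := (h1.const_sub 1).div ((h1.const_add 1).pow 2) (pow_ne_zero 2 h0)
    convert! this using 1
    field_simp
    norm_num
    ring
  have h3 : HasDerivAt (fun u : ℝ => 2 * u ^ 2 / (1 + u ^ 2)) (4 * u / (1 + u ^ 2) ^ 2) u := by
    have := (h1.const_mul 2).div (h1.const_add 1) h0
    convert! this using 1
    field_simp
    ring
  exact (h1.sin.mul h2).add (h1.cos.mul h3)

theorem abs_wiggle_le (u : ℝ) : |wiggle u| ≤ 1 / 2 := by
  rw [wiggle, abs_div, abs_mul, abs_of_pos (by positivity : 0 < 1 + u ^ 2),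
    div_le_iff₀ (by positivity)]
  have h1 := Real.abs_sin_le_one (u ^ 2)
  have h2 : |u| * |Real.sin (u ^ 2)| ≤ |u| * 1 := by gcongr
  nlinarith [sq_abs u, sq_nonneg (|u| - 1)]

theorem abs_wiggleDeriv_le (u : ℝ) : |wiggleDeriv u| ≤ 3 := by
  have h1 : |(1 - u ^ 2) / (1 + u ^ 2) ^ 2| ≤ 1 := by
    rw [abs_div, abs_of_pos (by positivity : 0 < (1 + u ^ 2) ^ 2), div_le_one (by positivity),
      abs_le]
    constructor <;> nlinarith [sq_nonneg u, sq_nonneg (u ^ 2)]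
  have h2 : |2 * u ^ 2 / (1 + u ^ 2)| ≤ 2 := by
    rw [abs_of_nonneg (by positivity), div_le_iff₀ (by positivity)]; nlinarith
  calc |wiggleDeriv u| ≤ |Real.sin (u ^ 2)| * |(1 - u ^ 2) / (1 + u ^ 2) ^ 2| +
        |Real.cos (u ^ 2)| * |2 * u ^ 2 / (1 + u ^ 2)| := by
        rw [wiggleDeriv, ← abs_mul, ← abs_mul]; exact abs_add_le _ _
    _ ≤ 1 * 1 + 1 * 2 := by
        gcongr
        · exact Real.abs_sin_le_one _
        · exact Real.abs_cos_le_one _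
    _ = 3 := by norm_num

/-- The amplitude of g is of order 1 / u and the frequency of sin u² is 2u, so each derivative costs
a factor u. Thus g' is bounded without decaying, and g'' costs one power of u, that is, one
logarithm. -/
theorem abs_wiggleDeriv₂_le (u : ℝ) : |wiggleDeriv₂ u| ≤ 18 * (1 + |u|) := by
  have hs := Real.abs_sin_le_one (u ^ 2)
  have hc := Real.abs_cos_le_one (u ^ 2)
  have hq : 1 ≤ 1 + u ^ 2 := by nlinarith
  have h1 : |(1 - u ^ 2) / (1 + u ^ 2) ^ 2| ≤ 1 := by
    rw [abs_div, abs_of_pos (by positivity : 0 < (1 + u ^ 2) ^ 2), div_le_one (by positivity),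
      abs_le]
    constructor <;> nlinarith [sq_nonneg u, sq_nonneg (u ^ 2)]
  have h2 : |2 * u ^ 2 / (1 + u ^ 2)| ≤ 2 := by
    rw [abs_of_nonneg (by positivity), div_le_iff₀ (by positivity)]; nlinarith
  have h3 : |(2 * u ^ 3 - 6 * u) / (1 + u ^ 2) ^ 3| ≤ 6 * |u| := by
    rw [abs_div, abs_of_pos (by positivity : 0 < (1 + u ^ 2) ^ 3), div_le_iff₀ (by positivity)]
    have h4 : |2 * u ^ 3 - 6 * u| ≤ 6 * |u| * (1 + u ^ 2) := by
      have : 2 * u ^ 3 - 6 * u = u * (2 * u ^ 2 - 6) := by ring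
      rw [this, abs_mul]
      have h5 : |2 * u ^ 2 - 6| ≤ 6 * (1 + u ^ 2) := by
        rw [abs_le]; constructor <;> nlinarith
      nlinarith [abs_nonneg u]
    have h6 : 1 + u ^ 2 ≤ (1 + u ^ 2) ^ 3 := le_self_pow₀ hq (by norm_num)
    exact h4.trans (by gcongr)
  have h4 : |4 * u / (1 + u ^ 2) ^ 2| ≤ 4 * |u| := by
    rw [abs_div, abs_mul, abs_of_pos (by positivity : 0 < (1 + u ^ 2) ^ 2),
      abs_of_pos (by norm_num : (0 : ℝ) < 4)]
    exact div_le_self (by positivity) (one_le_pow₀ hq)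
  have h5 : |2 * u| = 2 * |u| := by rw [abs_mul]; norm_num
  calc |wiggleDeriv₂ u| ≤ |Real.cos (u ^ 2)| * |2 * u| * |(1 - u ^ 2) / (1 + u ^ 2) ^ 2| +
        |Real.sin (u ^ 2)| * |(2 * u ^ 3 - 6 * u) / (1 + u ^ 2) ^ 3| +
        (|Real.sin (u ^ 2)| * |2 * u| * |2 * u ^ 2 / (1 + u ^ 2)| +
          |Real.cos (u ^ 2)| * |4 * u / (1 + u ^ 2) ^ 2|) := by
        rw [wiggleDeriv₂]
        refine (abs_add_le _ _).trans (add_le_add ((abs_add_le _ _).trans ?_)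
          ((abs_add_le _ _).trans ?_))
        · simp only [abs_mul, le_refl]
        · simp only [abs_mul, abs_neg, le_refl]
    _ ≤ 1 * (2 * |u|) * 1 + 1 * (6 * |u|) + (1 * (2 * |u|) * 2 + 1 * (4 * |u|)) := by
        rw [h5]; gcongr
    _ ≤ 18 * (1 + |u|) := by linarith [abs_nonneg u]

/-! ### Calculus of partial derivatives -/

/-- `F` is differentiable at `z` with partial derivatives `a` and `b`. -/
def HasPartials (F : ℝ × ℝ → ℝ) (a b : ℝ) (z : ℝ × ℝ) : Prop :=
  HasFDerivAt F (a • ContinuousLinearMap.fst ℝ ℝ ℝ + b • ContinuousLinearMap.snd ℝ ℝ ℝ) z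

namespace HasPartials

variable {F G : ℝ × ℝ → ℝ} {a b a' b' : ℝ} {z : ℝ × ℝ}

theorem fst (z : ℝ × ℝ) : HasPartials (fun z => z.1) 1 0 z := by
  simpa [HasPartials] using (hasFDerivAt_fst (𝕜 := ℝ) (p := z))

theorem snd (z : ℝ × ℝ) : HasPartials (fun z => z.2) 0 1 z := by
  simpa [HasPartials] using (hasFDerivAt_snd (𝕜 := ℝ) (p := z))

theorem const (c : ℝ) (z : ℝ × ℝ) : HasPartials (fun _ => c) 0 0 z := by
  simpa [HasPartials] using hasFDerivAt_const c z

theorem congr_partials (h : HasPartials F a b z) (ha : a = a') (hb : b = b') :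
    HasPartials F a' b' z := by rwa [← ha, ← hb]

theorem add (hF : HasPartials F a b z) (hG : HasPartials G a' b' z) :
    HasPartials (fun z => F z + G z) (a + a') (b + b') z := by
  have := HasFDerivAt.add hF hG
  unfold HasPartials
  convert! this using 1
  ext <;> simp

theorem mul (hF : HasPartials F a b z) (hG : HasPartials G a' b' z) :
    HasPartials (fun z => F z * G z) (a * G z + F z * a') (b * G z + F z * b') z := by
  have := HasFDerivAt.mul hF hG
  unfold HasPartials
  convert! this using 1
  ext <;> simp <;> ring

theorem comp {φ : ℝ → ℝ} {φ' : ℝ} (hφ : HasDerivAt φ φ' (F z)) (hF : HasPartials F a b z) :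
    HasPartials (fun z => φ (F z)) (φ' * a) (φ' * b) z := by
  have := hφ.comp_hasFDerivAt z hF
  unfold HasPartials
  convert! this using 1
  ext <;> simp

theorem inv (hF : HasPartials F a b z) (h0 : F z ≠ 0) :
    HasPartials (fun z => (F z)⁻¹) (-(F z ^ 2)⁻¹ * a) (-(F z ^ 2)⁻¹ * b) z :=
  comp (hasDerivAt_inv h0) hF

theorem continuousAt (hF : HasPartials F a b z) : ContinuousAt F z :=
  HasFDerivAt.continuousAt hF

theorem differentiableAt (hF : HasPartials F a b z) : DifferentiableAt ℝ F z :=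
  HasFDerivAt.differentiableAt hF

theorem norm_fderiv_le (hF : HasPartials F a b z) : ‖fderiv ℝ F z‖ ≤ |a| + |b| := by
  rw [HasFDerivAt.fderiv hF]
  refine (norm_add_le _ _).trans (add_le_add ?_ ?_)
  · rw [norm_smul]
    exact mul_le_of_le_one_right (norm_nonneg _) (ContinuousLinearMap.norm_fst_le ..)
  · rw [norm_smul]
    exact mul_le_of_le_one_right (norm_nonneg _) (ContinuousLinearMap.norm_snd_le ..)

/-- A product with the second coordinate has vanishing derivative on the axis if the other factor
tends to zero. -/
theorem snd_mul {R : ℝ × ℝ → ℝ} {x : ℝ} (hR : Tendsto R (𝓝 (x, 0)) (𝓝 0)) :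
    HasPartials (fun z => z.2 * R z) 0 0 (x, 0) := by
  unfold HasPartials
  rw [hasFDerivAt_iff_isLittleO]
  simp only [zero_smul, add_zero, zero_apply, sub_zero, zero_mul]
  have h1 : (fun z : ℝ × ℝ => z.2) =O[𝓝 (x, 0)] fun z => z - (x, 0) := by
    refine Asymptotics.isBigO_of_le _ fun z => ?_
    have := norm_snd_le (z - (x, 0))
    simpa using this
  have h2 : R =o[𝓝 (x, 0)] fun _ => (1 : ℝ) := (Asymptotics.isLittleO_one_iff ℝ).2 hR
  simpa using (h1.norm_right.mul_isLittleO h2)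

end HasPartials

/-! ### The perturbed stream function and its gradient -/

/-- The square of the Euclidean distance to the origin. -/
def radiusSq (x y : ℝ) : ℝ := x ^ 2 + y ^ 2

/-- The ratio `y² / (x² + y²)`. -/
noncomputable def heightRatio (x y : ℝ) : ℝ := y ^ 2 / radiusSq x y

/-- The logarithm of the unperturbed stream function `y M(x² + y²)`. -/
noncomputable def logBase (x y : ℝ) : ℝ := Real.log (y * speedProfile (radiusSq x y))

/-- The stream function `y M (1 + q g(log (y M)) / 20)`. -/
noncomputable def saddleStream (x y : ℝ) : ℝ :=
  y * speedProfile (radiusSq x y) * (1 + 1 / 20 * (heightRatio x y * wiggle (logBase x y)))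

/-- The derivative of `saddleStream` in `y`. -/
noncomputable def saddleFst (x y : ℝ) : ℝ :=
  speedProfile (radiusSq x y) * (1 + 2 * heightRatio x y * speedExponent (radiusSq x y) +
    1 / 20 * ((3 + 2 * heightRatio x y * speedExponent (radiusSq x y) - 2 * heightRatio x y) *
      (heightRatio x y * wiggle (logBase x y)) +
      (1 + 2 * heightRatio x y * speedExponent (radiusSq x y)) *
        (heightRatio x y * wiggleDeriv (logBase x y))))

/-- The negative of the derivative of `saddleStream` in `x`. -/
noncomputable def saddleSnd (x y : ℝ) : ℝ :=
  speedProfile (radiusSq x y) * (-(x * y / radiusSq x y) *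
    (2 * speedExponent (radiusSq x y) +
    1 / 20 * ((2 * speedExponent (radiusSq x y) - 2) * (heightRatio x y * wiggle (logBase x y)) +
      2 * speedExponent (radiusSq x y) * (heightRatio x y * wiggleDeriv (logBase x y)))))

theorem radiusSq_nonneg (x y : ℝ) : 0 ≤ radiusSq x y := by unfold radiusSq; positivity

theorem radiusSq_pos_of_right {y : ℝ} (x : ℝ) (hy : y ≠ 0) : 0 < radiusSq x y := by
  unfold radiusSq; positivity

theorem radiusSq_pos_of_left {x : ℝ} (hx : x ≠ 0) (y : ℝ) : 0 < radiusSq x y := by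
  unfold radiusSq; positivity

theorem heightRatio_nonneg (x y : ℝ) : 0 ≤ heightRatio x y :=
  div_nonneg (sq_nonneg y) (radiusSq_nonneg x y)

theorem heightRatio_le_one (x y : ℝ) : heightRatio x y ≤ 1 :=
  div_le_one_of_le₀ (by unfold radiusSq; nlinarith) (radiusSq_nonneg x y)

theorem abs_mul_div_radiusSq_le (x y : ℝ) : |x * y / radiusSq x y| ≤ 1 := by
  rw [abs_div, abs_of_nonneg (radiusSq_nonneg x y)]
  refine div_le_one_of_le₀ ?_ (radiusSq_nonneg x y)
  rw [abs_mul, radiusSq]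
  nlinarith [sq_nonneg (|x| - |y|), sq_abs x, sq_abs y, abs_nonneg x, abs_nonneg y]

theorem hasPartials_radiusSq (x y : ℝ) :
    HasPartials (fun z => radiusSq z.1 z.2) (2 * x) (2 * y) (x, y) := by
  have h := ((HasPartials.fst (x, y)).mul (HasPartials.fst (x, y))).add
    ((HasPartials.snd (x, y)).mul (HasPartials.snd (x, y)))
  have h2 : (fun z : ℝ × ℝ => radiusSq z.1 z.2) = fun z => z.1 * z.1 + z.2 * z.2 := by
    funext z; simp only [radiusSq]; ring
  rw [h2]
  exact h.congr_partials (by ring) (by ring)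

theorem hasPartials_speedProfile {x y : ℝ} (hs : 0 < radiusSq x y) :
    HasPartials (fun z => speedProfile (radiusSq z.1 z.2))
      (speedExponent (radiusSq x y) * speedProfile (radiusSq x y) / radiusSq x y * (2 * x))
      (speedExponent (radiusSq x y) * speedProfile (radiusSq x y) / radiusSq x y * (2 * y))
      (x, y) :=
  HasPartials.comp (F := fun z => radiusSq z.1 z.2) (hasDerivAt_speedProfile hs)
    (hasPartials_radiusSq x y)

theorem hasPartials_inv_radiusSq {x y : ℝ} (hs : 0 < radiusSq x y) :
    HasPartials (fun z => (radiusSq z.1 z.2)⁻¹) (-(radiusSq x y ^ 2)⁻¹ * (2 * x))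
      (-(radiusSq x y ^ 2)⁻¹ * (2 * y)) (x, y) :=
  (hasPartials_radiusSq x y).inv hs.ne'

theorem hasPartials_heightRatio {x y : ℝ} (hs : 0 < radiusSq x y) :
    HasPartials (fun z => heightRatio z.1 z.2)
      (-2 * x * y ^ 2 / radiusSq x y ^ 2)
      (2 * y / radiusSq x y - 2 * y ^ 3 / radiusSq x y ^ 2) (x, y) := by
  have h := ((HasPartials.snd (x, y)).mul (HasPartials.snd (x, y))).mul
    (hasPartials_inv_radiusSq hs)
  have h2 : (fun z : ℝ × ℝ => heightRatio z.1 z.2) =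
      fun z => z.2 * z.2 * (radiusSq z.1 z.2)⁻¹ := by
    funext z; simp only [heightRatio]; ring
  rw [h2]
  refine h.congr_partials ?_ ?_ <;> field_simp <;> ring

/-- `Real.log` is even with derivative 1 / x on both sides of 0, so y < 0 is covered as well. -/
theorem hasPartials_logBase {x y : ℝ} (hy : y ≠ 0) :
    HasPartials (fun z => logBase z.1 z.2)
      (speedExponent (radiusSq x y) / radiusSq x y * (2 * x))
      (1 / y + speedExponent (radiusSq x y) / radiusSq x y * (2 * y)) (x, y) := by
  have hs := radiusSq_pos_of_right x hy
  have hM := (speedProfile_pos hs).ne'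
  have h1 := (HasPartials.snd (x, y)).mul (hasPartials_speedProfile hs)
  have h2 := HasPartials.comp
    (F := fun z => z.2 * speedProfile (radiusSq z.1 z.2)) (z := (x, y))
    (Real.hasDerivAt_log (mul_ne_zero hy hM)) h1
  refine h2.congr_partials ?_ ?_ <;> simp only <;> field_simp
  ring

theorem hasPartials_saddleStream {x y : ℝ} (hy : y ≠ 0) :
    HasPartials (fun z => saddleStream z.1 z.2) (-saddleSnd x y) (saddleFst x y) (x, y) := by
  have hs := radiusSq_pos_of_right x hy
  have h1 := (HasPartials.snd (x, y)).mul (hasPartials_speedProfile hs)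
  have h2 := HasPartials.comp (F := fun z => logBase z.1 z.2) (z := (x, y))
    (hasDerivAt_wiggle _) (hasPartials_logBase hy)
  have h3 := (HasPartials.const (1 / 20) (x, y)).mul ((hasPartials_heightRatio hs).mul h2)
  have h4 := h1.mul ((HasPartials.const 1 (x, y)).add h3)
  refine HasPartials.congr_partials h4 ?_ ?_
  · simp only [saddleSnd, heightRatio]
    generalize speedProfile (radiusSq x y) = M
    generalize speedExponent (radiusSq x y) = e
    generalize wiggle (logBase x y) = g
    generalize wiggleDeriv (logBase x y) = g'
    generalize radiusSq x y = s at hs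
    field_simp
    ring
  · simp only [saddleFst, heightRatio]
    generalize speedProfile (radiusSq x y) = M
    generalize speedExponent (radiusSq x y) = e
    generalize wiggle (logBase x y) = g
    generalize wiggleDeriv (logBase x y) = g'
    generalize radiusSq x y = s at hs
    field_simp
    ring

theorem continuous_radiusSq : Continuous fun z : ℝ × ℝ => radiusSq z.1 z.2 := by
  unfold radiusSq; fun_prop

theorem continuous_speedProfile_radiusSq :
    Continuous fun z : ℝ × ℝ => speedProfile (radiusSq z.1 z.2) :=
  continuousOn_speedProfile.comp_continuous continuous_radiusSq fun _ => radiusSq_nonneg _ _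

/-- M is at most 64 times the fourth root of r², q is at most its own fourth root, and r² q = y².
The bound is uniform in x, which makes H differentiable along the whole axis, the origin included.
-/
theorem speedProfile_mul_heightRatio_le (x y : ℝ) :
    speedProfile (radiusSq x y) * heightRatio x y ≤ 64 * √|y| := by
  have hq0 := heightRatio_nonneg x y
  have hq1 := heightRatio_le_one x y
  have hs := radiusSq_nonneg x y
  have h1 : heightRatio x y ≤ √√(heightRatio x y) := by
    have h2 : heightRatio x y ≤ √(heightRatio x y) :=
      Real.le_sqrt_of_sq_le (by nlinarith)
    exact h2.trans (Real.sqrt_le_sqrt h2)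
  have h3 : √√(radiusSq x y) * √√(heightRatio x y) ≤ √|y| := by
    rw [← Real.sqrt_mul (Real.sqrt_nonneg _), ← Real.sqrt_mul hs]
    refine Real.sqrt_le_sqrt ?_
    rw [← Real.sqrt_sq_eq_abs]
    refine Real.sqrt_le_sqrt ?_
    rcases hs.eq_or_lt with h0 | h0
    · rw [← h0, zero_mul]; positivity
    · rw [heightRatio, mul_div_cancel₀ _ h0.ne']
  calc speedProfile (radiusSq x y) * heightRatio x y
      ≤ (64 * √√(radiusSq x y)) * √√(heightRatio x y) := by
        gcongr
        exact speedProfile_le_sqrt_sqrt hs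
    _ = 64 * (√√(radiusSq x y) * √√(heightRatio x y)) := by ring
    _ ≤ 64 * √|y| := by gcongr

/-- Near the point, H = y M(x²) + y R with x fixed and R → 0. -/
theorem hasPartials_saddleStream_axis (x : ℝ) :
    HasPartials (fun z => saddleStream z.1 z.2) (-saddleSnd x 0) (saddleFst x 0) (x, 0) := by
  have hR : Tendsto (fun z : ℝ × ℝ =>
      (speedProfile (radiusSq z.1 z.2) - speedProfile (radiusSq x 0)) +
      1 / 20 * (speedProfile (radiusSq z.1 z.2) * heightRatio z.1 z.2 * wiggle (logBase z.1 z.2)))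
      (𝓝 (x, 0)) (𝓝 0) := by
    have h1 : Tendsto (fun z : ℝ × ℝ => speedProfile (radiusSq z.1 z.2) -
        speedProfile (radiusSq x 0)) (𝓝 (x, 0)) (𝓝 0) := by
      simpa using (continuous_speedProfile_radiusSq.tendsto (x, 0)).sub_const
        (speedProfile (radiusSq x 0))
    have h2 : Tendsto (fun z : ℝ × ℝ => 64 * √|z.2|) (𝓝 (x, 0)) (𝓝 0) := by
      have : Continuous fun z : ℝ × ℝ => 64 * √|z.2| := by fun_prop
      simpa using this.tendsto (x, 0)
    have h3 : Tendsto (fun z : ℝ × ℝ => speedProfile (radiusSq z.1 z.2) *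
        heightRatio z.1 z.2 * wiggle (logBase z.1 z.2)) (𝓝 (x, 0)) (𝓝 0) := by
      refine squeeze_zero_norm (fun z => ?_) h2
      have h0 := mul_nonneg (speedProfile_nonneg (radiusSq z.1 z.2)) (heightRatio_nonneg z.1 z.2)
      rw [norm_mul, Real.norm_eq_abs, Real.norm_eq_abs, abs_of_nonneg h0]
      have h4 := abs_wiggle_le (logBase z.1 z.2)
      have h5 := speedProfile_mul_heightRatio_le z.1 z.2
      nlinarith [abs_nonneg (wiggle (logBase z.1 z.2))]
    simpa only [mul_zero, add_zero] using h1.add (h3.const_mul (1 / 20))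
  have h1 := ((HasPartials.snd (x, 0)).mul
    (HasPartials.const (speedProfile (radiusSq x 0)) (x, 0))).add (HasPartials.snd_mul hR)
  have h2 : (fun z : ℝ × ℝ => saddleStream z.1 z.2) = fun z : ℝ × ℝ =>
      z.2 * speedProfile (radiusSq x 0) + z.2 *
      ((speedProfile (radiusSq z.1 z.2) - speedProfile (radiusSq x 0)) +
      1 / 20 * (speedProfile (radiusSq z.1 z.2) * heightRatio z.1 z.2 *
        wiggle (logBase z.1 z.2))) := by
    funext z; simp only [saddleStream]; ring
  rw [h2]
  refine h1.congr_partials ?_ ?_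
  · simp [saddleSnd]
  · simp [saddleFst, heightRatio]

/-- The perturbation contributes at most (4 · 1/2 + 2 · 3) / 20 of M q. The factor 1/20 in H is
there to keep this share below 1/2, so that b₁ ≥ M / 2 in `half_le_saddleFst`. -/
theorem abs_saddleFst_sub_le (x y : ℝ) :
    |saddleFst x y - speedProfile (radiusSq x y) *
      (1 + 2 * heightRatio x y * speedExponent (radiusSq x y))| ≤
      speedProfile (radiusSq x y) * (9 / 20 * heightRatio x y) := by
  have hq0 := heightRatio_nonneg x y
  have hq1 := heightRatio_le_one x y
  have he0 := speedExponent_nonneg (radiusSq_nonneg x y)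
  have he1 := speedExponent_le (radiusSq_nonneg x y)
  have hM := speedProfile_nonneg (radiusSq x y)
  have hg := abs_wiggle_le (logBase x y)
  have hg' := abs_wiggleDeriv_le (logBase x y)
  simp only [saddleFst]
  generalize speedProfile (radiusSq x y) = M at *
  generalize speedExponent (radiusSq x y) = e at *
  generalize wiggle (logBase x y) = g at *
  generalize wiggleDeriv (logBase x y) = g' at *
  generalize heightRatio x y = q at *
  have hqe : 0 ≤ 2 * q * e := by positivity
  have hqe' : 2 * q * e ≤ 1 := by nlinarith
  have h1 : |(3 + 2 * q * e - 2 * q) * (q * g)| ≤ 4 * (q * (1 / 2)) := by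
    rw [abs_mul, abs_mul, abs_of_nonneg hq0]
    have : |3 + 2 * q * e - 2 * q| ≤ 4 := by rw [abs_le]; constructor <;> linarith
    gcongr
  have h2 : |(1 + 2 * q * e) * (q * g')| ≤ 2 * (q * 3) := by
    rw [abs_mul, abs_mul, abs_of_nonneg hq0]
    have : |1 + 2 * q * e| ≤ 2 := by rw [abs_le]; constructor <;> linarith
    gcongr
  have h3 : |1 / 20 * ((3 + 2 * q * e - 2 * q) * (q * g) + (1 + 2 * q * e) * (q * g'))| ≤
      9 / 20 * q := by
    rw [abs_mul, abs_of_pos (by norm_num : (0 : ℝ) < 1 / 20)]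
    have := abs_add_le ((3 + 2 * q * e - 2 * q) * (q * g)) ((1 + 2 * q * e) * (q * g'))
    linarith
  calc _ = |M * (1 / 20 * ((3 + 2 * q * e - 2 * q) * (q * g) + (1 + 2 * q * e) * (q * g')))| := by
        congr 1; ring
    _ ≤ M * (9 / 20 * q) := by
        rw [abs_mul, abs_of_nonneg hM]; gcongr

theorem half_le_saddleFst (x y : ℝ) : speedProfile (radiusSq x y) / 2 ≤ saddleFst x y := by
  have h := (abs_le.1 (abs_saddleFst_sub_le x y)).1
  have hq0 := heightRatio_nonneg x y
  have hq1 := heightRatio_le_one x y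
  have he0 := speedExponent_nonneg (radiusSq_nonneg x y)
  have hM := speedProfile_nonneg (radiusSq x y)
  have h1 : 0 ≤ speedProfile (radiusSq x y) * (2 * heightRatio x y * speedExponent (radiusSq x y)) :=
    by positivity
  nlinarith

theorem abs_saddleFst_le (x y : ℝ) : |saddleFst x y| ≤ 3 * speedProfile (radiusSq x y) := by
  have h := (abs_le.1 (abs_saddleFst_sub_le x y)).2
  have h' := half_le_saddleFst x y
  have hq0 := heightRatio_nonneg x y
  have hq1 := heightRatio_le_one x y
  have he0 := speedExponent_nonneg (radiusSq_nonneg x y)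
  have he1 := speedExponent_le (radiusSq_nonneg x y)
  have hM := speedProfile_nonneg (radiusSq x y)
  have h1 : 2 * heightRatio x y * speedExponent (radiusSq x y) ≤ 1 := by nlinarith
  rw [abs_of_nonneg (by linarith)]
  nlinarith

theorem abs_saddleSnd_add_le (x y : ℝ) :
    |saddleSnd x y + speedProfile (radiusSq x y) *
      (x * y / radiusSq x y * (2 * speedExponent (radiusSq x y)))| ≤
      speedProfile (radiusSq x y) * heightRatio x y := by
  have hq0 := heightRatio_nonneg x y
  have he0 := speedExponent_nonneg (radiusSq_nonneg x y)
  have he1 := speedExponent_le (radiusSq_nonneg x y)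
  have hM := speedProfile_nonneg (radiusSq x y)
  have hg := abs_wiggle_le (logBase x y)
  have hg' := abs_wiggleDeriv_le (logBase x y)
  have hp := abs_mul_div_radiusSq_le x y
  simp only [saddleSnd]
  generalize speedProfile (radiusSq x y) = M at *
  generalize speedExponent (radiusSq x y) = e at *
  generalize wiggle (logBase x y) = g at *
  generalize wiggleDeriv (logBase x y) = g' at *
  generalize heightRatio x y = q at *
  generalize x * y / radiusSq x y = p at *
  have h1 : |(2 * e - 2) * (q * g)| ≤ 2 * (q * (1 / 2)) := by
    rw [abs_mul, abs_mul, abs_of_nonneg hq0]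
    have : |2 * e - 2| ≤ 2 := by rw [abs_le]; constructor <;> linarith
    gcongr
  have h2 : |2 * e * (q * g')| ≤ 1 * (q * 3) := by
    rw [abs_mul, abs_mul q, abs_of_nonneg hq0]
    have : |2 * e| ≤ 1 := by rw [abs_le]; constructor <;> linarith
    gcongr
  have h3 : |1 / 20 * ((2 * e - 2) * (q * g) + 2 * e * (q * g'))| ≤ q := by
    rw [abs_mul, abs_of_pos (by norm_num : (0 : ℝ) < 1 / 20)]
    have := abs_add_le ((2 * e - 2) * (q * g)) (2 * e * (q * g'))
    linarith
  calc _ = |M * (-p * (1 / 20 * ((2 * e - 2) * (q * g) + 2 * e * (q * g'))))| := by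
        congr 1; ring
    _ ≤ M * (1 * q) := by
        rw [abs_mul, abs_mul, abs_neg, abs_of_nonneg hM]; gcongr
    _ = M * q := by ring

theorem abs_saddleSnd_le (x y : ℝ) : |saddleSnd x y| ≤ 3 * speedProfile (radiusSq x y) := by
  have h := abs_saddleSnd_add_le x y
  have hq1 := heightRatio_le_one x y
  have he0 := speedExponent_nonneg (radiusSq_nonneg x y)
  have he1 := speedExponent_le (radiusSq_nonneg x y)
  have hM := speedProfile_nonneg (radiusSq x y)
  have hp := abs_mul_div_radiusSq_le x y
  have h1 : |speedProfile (radiusSq x y) *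
      (x * y / radiusSq x y * (2 * speedExponent (radiusSq x y)))| ≤
      speedProfile (radiusSq x y) * (1 * 1) := by
    rw [abs_mul, abs_mul, abs_of_nonneg hM]
    have : |2 * speedExponent (radiusSq x y)| ≤ 1 := by rw [abs_le]; constructor <;> linarith
    gcongr
  have h2 := abs_le.1 h
  have h3 := abs_le.1 h1
  rw [abs_le]
  constructor <;> nlinarith

/-! ### Tame functions and the size of the gradient -/

/-- Functions which, off the axis, are bounded and have partial derivatives bounded by
`(1 + |log (y M)|) / |z|`, up to constants. -/
def IsTame (F : ℝ × ℝ → ℝ) : Prop :=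
  ∃ C : ℝ, 0 ≤ C ∧ ∀ x y : ℝ, y ≠ 0 → |F (x, y)| ≤ C ∧ ∃ a b : ℝ, HasPartials F a b (x, y) ∧
    √(radiusSq x y) * |a| ≤ C * (1 + |logBase x y|) ∧
    √(radiusSq x y) * |b| ≤ C * (1 + |logBase x y|)

namespace IsTame

variable {F G : ℝ × ℝ → ℝ}

theorem const (c : ℝ) : IsTame fun _ => c :=
  ⟨|c|, abs_nonneg c, fun x y _ => ⟨le_rfl, 0, 0, HasPartials.const c _, by
    simp only [abs_zero, mul_zero]; positivity, by simp only [abs_zero, mul_zero]; positivity⟩⟩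

theorem add (hF : IsTame F) (hG : IsTame G) : IsTame fun z => F z + G z := by
  obtain ⟨C, hC, hF⟩ := hF
  obtain ⟨D, hD, hG⟩ := hG
  refine ⟨C + D, by positivity, fun x y hy => ?_⟩
  obtain ⟨h1, a, b, h2, h3, h4⟩ := hF x y hy
  obtain ⟨h1', a', b', h2', h3', h4'⟩ := hG x y hy
  refine ⟨(abs_add_le _ _).trans (add_le_add h1 h1'), a + a', b + b', h2.add h2', ?_, ?_⟩
  · calc √(radiusSq x y) * |a + a'| ≤ √(radiusSq x y) * (|a| + |a'|) := by
          gcongr; exact abs_add_le _ _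
      _ ≤ _ := by linarith
  · calc √(radiusSq x y) * |b + b'| ≤ √(radiusSq x y) * (|b| + |b'|) := by
          gcongr; exact abs_add_le _ _
      _ ≤ _ := by linarith

theorem abs_mul_aux {r a G F a' C D K : ℝ} (hr : 0 ≤ r) (hC : 0 ≤ C)
    (h1 : |F| ≤ C) (h2 : |G| ≤ D) (h3 : r * |a| ≤ C * K) (h4 : r * |a'| ≤ D * K) :
    r * |a * G + F * a'| ≤ 2 * C * D * K := by
  calc r * |a * G + F * a'| ≤ r * (|a| * |G| + |F| * |a'|) := by
        gcongr
        rw [← abs_mul, ← abs_mul]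
        exact abs_add_le _ _
    _ = (r * |a|) * |G| + |F| * (r * |a'|) := by ring
    _ ≤ (C * K) * D + C * (D * K) := by
        have h5 : 0 ≤ C * K := le_trans (by positivity) h3
        gcongr
    _ = 2 * C * D * K := by ring

theorem mul (hF : IsTame F) (hG : IsTame G) : IsTame fun z => F z * G z := by
  obtain ⟨C, hC, hF⟩ := hF
  obtain ⟨D, hD, hG⟩ := hG
  refine ⟨2 * C * D, by positivity, fun x y hy => ?_⟩
  obtain ⟨h1, a, b, h2, h3, h4⟩ := hF x y hy
  obtain ⟨h1', a', b', h2', h3', h4'⟩ := hG x y hy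
  refine ⟨?_, _, _, h2.mul h2', ?_, ?_⟩
  · rw [abs_mul]
    have : |F (x, y)| * |G (x, y)| ≤ C * D := by gcongr
    nlinarith [mul_nonneg hC hD]
  · exact abs_mul_aux (Real.sqrt_nonneg _) hC h1 h1' h3 h3'
  · exact abs_mul_aux (Real.sqrt_nonneg _) hC h1 h1' h4 h4'

theorem congr (hF : IsTame F) (h : ∀ z, F z = G z) : IsTame G := by
  have : F = G := funext h
  rwa [← this]

end IsTame

/-- Polar representation of a point with radial and angular parts separated. -/
theorem exists_polar (x : ℝ) {y : ℝ} (hy : y ≠ 0) : ∃ r α β : ℝ, 0 < r ∧ x = r * α ∧ y = r * β ∧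
    radiusSq x y = r ^ 2 ∧ √(radiusSq x y) = r ∧ |α| ≤ 1 ∧ |β| ≤ 1 ∧ β ≠ 0 := by
  have hs := radiusSq_pos_of_right x hy
  have hr := Real.sqrt_pos.2 hs
  have hx : |x| ≤ √(radiusSq x y) := by
    rw [← Real.sqrt_sq_eq_abs]; exact Real.sqrt_le_sqrt (by unfold radiusSq; nlinarith)
  have hy' : |y| ≤ √(radiusSq x y) := by
    rw [← Real.sqrt_sq_eq_abs]; exact Real.sqrt_le_sqrt (by unfold radiusSq; nlinarith)
  refine ⟨√(radiusSq x y), x / √(radiusSq x y), y / √(radiusSq x y), hr,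
    (mul_div_cancel₀ x hr.ne').symm, (mul_div_cancel₀ y hr.ne').symm, (Real.sq_sqrt hs.le).symm,
    rfl, ?_, ?_, div_ne_zero hy hr.ne'⟩
  · rw [abs_div, abs_of_pos hr]; exact div_le_one_of_le₀ hx hr.le
  · rw [abs_div, abs_of_pos hr]; exact div_le_one_of_le₀ hy' hr.le

theorem mul_abs_le_of_eq {r a P C : ℝ} (hr : 0 < r) (ha : a = P / r) (hP : |P| ≤ C) :
    r * |a| ≤ C := by
  rw [ha, abs_div, abs_of_pos hr, mul_div_cancel₀ _ hr.ne']; exact hP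

/-- The y-derivative of log(y M) contains 1 / y, which is not O(1 / r); the factor q turns it into y
/ r². For this reason g and g' enter the velocity only multiplied by q. -/
theorem isTame_heightRatio_mul {φ φ' : ℝ → ℝ} {C : ℝ} (hC : 0 ≤ C)
    (hφ : ∀ u, HasDerivAt φ (φ' u) u) (h1 : ∀ u, |φ u| ≤ C) (h2 : ∀ u, |φ' u| ≤ C * (1 + |u|)) :
    IsTame fun z => heightRatio z.1 z.2 * φ (logBase z.1 z.2) := by
  refine ⟨6 * C, by positivity, fun x y hy => ?_⟩
  have hs := radiusSq_pos_of_right x hy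
  have hq0 := heightRatio_nonneg x y
  have hq1 := heightRatio_le_one x y
  have he0 := speedExponent_nonneg (radiusSq_nonneg x y)
  have he1 := speedExponent_le (radiusSq_nonneg x y)
  have hu := h1 (logBase x y)
  have hu' := h2 (logBase x y)
  obtain ⟨r, α, β, hr, hx, hy', hrs, hsq, hα, hβ, hβ0⟩ := exists_polar x hy
  have hK1 : 1 ≤ 1 + |logBase x y| := by have := abs_nonneg (logBase x y); linarith
  refine ⟨?_, _, _, (hasPartials_heightRatio hs).mul (HasPartials.comp
    (F := fun z => logBase z.1 z.2) (z := (x, y)) (hφ _) (hasPartials_logBase hy)), ?_, ?_⟩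
  · rw [abs_mul, abs_of_nonneg hq0]
    have := abs_nonneg (φ (logBase x y))
    show heightRatio x y * |φ (logBase x y)| ≤ 6 * C
    nlinarith
  -- In polar form x = r α, y = r β, each partial derivative becomes P / r with P bounded in terms
  -- of |α|, |β| ≤ 1.
  all_goals
    simp only [heightRatio]
    generalize φ (logBase x y) = g at *
    generalize φ' (logBase x y) = g' at *
    generalize speedExponent (radiusSq x y) = e at *
    generalize 1 + |logBase x y| = K at *
    rw [hsq, hrs]
    subst hx hy'
    have hC' : C ≤ C * K := by nlinarith
    have hβ2 : |β ^ 2| ≤ 1 := by rw [abs_pow]; exact pow_le_one₀ (abs_nonneg β) hβ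
    have he2 : |2 * e| ≤ 1 := by rw [abs_of_nonneg (by positivity)]; linarith
  · refine mul_abs_le_of_eq (P := (-2 * (α * β ^ 2)) * g + (α * β ^ 2) * (2 * e) * g') hr
      (by field_simp) ?_
    have h3 : |α * β ^ 2| ≤ 1 := by
      rw [abs_mul]; exact mul_le_one₀ hα (abs_nonneg _) hβ2
    calc _ ≤ |(-2 * (α * β ^ 2)) * g| + |(α * β ^ 2) * (2 * e) * g'| := abs_add_le _ _
      _ = 2 * |α * β ^ 2| * |g| + |α * β ^ 2| * |2 * e| * |g'| := by
          simp only [abs_mul, abs_neg]; norm_num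
      _ ≤ 2 * 1 * C + 1 * 1 * (C * K) := by gcongr
      _ ≤ 6 * C * K := by nlinarith
  · refine mul_abs_le_of_eq (P := 2 * (β * (1 - β ^ 2)) * g + β * (1 + 2 * e * β ^ 2) * g') hr
      (by field_simp) ?_
    have h3 : |β * (1 - β ^ 2)| ≤ 1 := by
      rw [abs_mul]
      refine mul_le_one₀ hβ (abs_nonneg _) ?_
      rw [abs_le] at hβ2 ⊢
      constructor <;> nlinarith [sq_nonneg β]
    have h4 : |β * (1 + 2 * e * β ^ 2)| ≤ 1 * 2 := by
      rw [abs_mul]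
      gcongr
      rw [abs_of_nonneg (by positivity)]
      rw [abs_le] at hβ2
      nlinarith
    calc _ ≤ |2 * (β * (1 - β ^ 2)) * g| + |β * (1 + 2 * e * β ^ 2) * g'| := abs_add_le _ _
      _ = 2 * |β * (1 - β ^ 2)| * |g| + |β * (1 + 2 * e * β ^ 2)| * |g'| := by
          rw [abs_mul, abs_mul 2, abs_mul _ g']; norm_num
      _ ≤ 2 * 1 * C + (1 * 2) * (C * K) := by gcongr
      _ ≤ 6 * C * K := by nlinarith

theorem isTame_heightRatio : IsTame fun z => heightRatio z.1 z.2 :=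
  (isTame_heightRatio_mul (φ := fun _ => 1) (φ' := fun _ => 0) zero_le_one
    (fun u => hasDerivAt_const u 1) (fun u => by simp) (fun u => by
      simp only [abs_zero]; positivity)).congr fun z => mul_one _

theorem isTame_heightRatio_mul_wiggle :
    IsTame fun z => heightRatio z.1 z.2 * wiggle (logBase z.1 z.2) :=
  isTame_heightRatio_mul (C := 3) (by norm_num) hasDerivAt_wiggle
    (fun u => (abs_wiggle_le u).trans (by norm_num))
    (fun u => (abs_wiggleDeriv_le u).trans (by linarith [abs_nonneg u]))

theorem isTame_heightRatio_mul_wiggleDeriv :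
    IsTame fun z => heightRatio z.1 z.2 * wiggleDeriv (logBase z.1 z.2) :=
  isTame_heightRatio_mul (C := 18) (by norm_num) hasDerivAt_wiggleDeriv
    (fun u => (abs_wiggleDeriv_le u).trans (by norm_num)) abs_wiggleDeriv₂_le

theorem isTame_mul_div_radiusSq : IsTame fun z => z.1 * z.2 / radiusSq z.1 z.2 := by
  refine ⟨3, by norm_num, fun x y hy => ?_⟩
  have hs := radiusSq_pos_of_right x hy
  obtain ⟨r, α, β, hr, hx, hy', hrs, hsq, hα, hβ, hβ0⟩ := exists_polar x hy
  have hK1 : 1 ≤ 1 + |logBase x y| := by have := abs_nonneg (logBase x y); linarith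
  have h1 := ((HasPartials.fst (x, y)).mul (HasPartials.snd (x, y))).mul
    (hasPartials_inv_radiusSq hs)
  refine ⟨(abs_mul_div_radiusSq_le x y).trans (by norm_num), _, _, h1, ?_, ?_⟩
  all_goals
    simp only
    generalize 1 + |logBase x y| = K at *
    rw [hsq, hrs]
    subst hx hy'
    have hα2 : |α ^ 2| ≤ 1 := by rw [abs_pow]; exact pow_le_one₀ (abs_nonneg α) hα
    have hβ2 : |β ^ 2| ≤ 1 := by rw [abs_pow]; exact pow_le_one₀ (abs_nonneg β) hβ
  · refine mul_abs_le_of_eq (P := β - 2 * (α ^ 2 * β)) hr (by field_simp; ring) ?_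
    calc _ ≤ |β| + |2 * (α ^ 2 * β)| := abs_sub _ _
      _ = |β| + 2 * (|α ^ 2| * |β|) := by rw [abs_mul 2, abs_mul]; norm_num
      _ ≤ 1 + 2 * (1 * 1) := by gcongr
      _ ≤ 3 * K := by linarith
  · refine mul_abs_le_of_eq (P := α - 2 * (β ^ 2 * α)) hr (by field_simp; ring) ?_
    calc _ ≤ |α| + |2 * (β ^ 2 * α)| := abs_sub _ _
      _ = |α| + 2 * (|β ^ 2| * |α|) := by rw [abs_mul 2, abs_mul]; norm_num
      _ ≤ 1 + 2 * (1 * 1) := by gcongr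
      _ ≤ 3 * K := by linarith

theorem isTame_speedExponent : IsTame fun z => speedExponent (radiusSq z.1 z.2) := by
  refine ⟨2, by norm_num, fun x y hy => ?_⟩
  have hs := radiusSq_pos_of_right x hy
  have he0 := speedExponent_nonneg (radiusSq_nonneg x y)
  have he1 := speedExponent_le (radiusSq_nonneg x y)
  have hd := abs_mul_deriv_speedExponent_le hs
  obtain ⟨r, α, β, hr, hx, hy', hrs, hsq, hα, hβ, hβ0⟩ := exists_polar x hy
  have hK1 : 1 ≤ 1 + |logBase x y| := by have := abs_nonneg (logBase x y); linarith
  refine ⟨?_, _, _, HasPartials.comp (F := fun z => radiusSq z.1 z.2) (z := (x, y))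
    (hasDerivAt_speedExponent hs) (hasPartials_radiusSq x y), ?_, ?_⟩
  · rw [abs_of_nonneg he0]; linarith
  all_goals
    simp only
    generalize (-speedExponent (radiusSq x y) / (1 + radiusSq x y) - 2 /
      (logFactor (radiusSq x y) ^ 2 * radiusSq x y * (1 + radiusSq x y) ^ 2)) = d at *
    generalize 1 + |logBase x y| = K at *
    rw [hrs] at hd
    rw [hsq]
    have hd' : |r ^ 2 * d| ≤ 1 := by rwa [abs_mul, abs_of_pos (by positivity)]
    subst hx hy'
  · refine mul_abs_le_of_eq (P := (r ^ 2 * d) * (2 * α)) hr (by field_simp) ?_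
    rw [abs_mul, abs_mul 2]
    norm_num
    nlinarith [abs_nonneg (r ^ 2 * d), abs_nonneg α]
  · refine mul_abs_le_of_eq (P := (r ^ 2 * d) * (2 * β)) hr (by field_simp) ?_
    rw [abs_mul, abs_mul 2]
    norm_num
    nlinarith [abs_nonneg (r ^ 2 * d), abs_nonneg β]

/-- The second factor is a polynomial in tame functions. M is split off because its decay at the
origin compensates the factor 1 / r lost in a derivative. -/
theorem exists_isTame_saddleFst : ∃ P : ℝ × ℝ → ℝ, IsTame P ∧
    ∀ z : ℝ × ℝ, saddleFst z.1 z.2 = speedProfile (radiusSq z.1 z.2) * P z := by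
  have hq := isTame_heightRatio
  have he := isTame_speedExponent
  have hg := isTame_heightRatio_mul_wiggle
  have hg' := isTame_heightRatio_mul_wiggleDeriv
  have hqe := ((IsTame.const 2).mul hq).mul he
  refine ⟨_, ((IsTame.const 1).add hqe).add ((IsTame.const (1 / 20)).mul
    (((((IsTame.const 3).add hqe).add ((IsTame.const (-2)).mul hq)).mul hg).add
      (((IsTame.const 1).add hqe).mul hg'))), fun z => ?_⟩
  simp only [saddleFst]
  ring

theorem exists_isTame_saddleSnd : ∃ P : ℝ × ℝ → ℝ, IsTame P ∧
    ∀ z : ℝ × ℝ, saddleSnd z.1 z.2 = speedProfile (radiusSq z.1 z.2) * P z := by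
  have he := (IsTame.const 2).mul isTame_speedExponent
  have hg := isTame_heightRatio_mul_wiggle
  have hg' := isTame_heightRatio_mul_wiggleDeriv
  refine ⟨_, ((IsTame.const (-1)).mul isTame_mul_div_radiusSq).mul (he.add
    ((IsTame.const (1 / 20)).mul (((he.add (IsTame.const (-2))).mul hg).add (he.mul hg')))),
    fun z => ?_⟩
  simp only [saddleSnd]
  ring

/-- The derivative of a speed profile times a tame function. -/
theorem IsTame.exists_partials_le {F P : ℝ × ℝ → ℝ} (hP : IsTame P)
    (hF : ∀ z, F z = speedProfile (radiusSq z.1 z.2) * P z) :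
    ∃ C : ℝ, 0 ≤ C ∧ ∀ x y : ℝ, y ≠ 0 → ∃ a b : ℝ, HasPartials F a b (x, y) ∧
      |a| + |b| ≤ C * (logFactor (radiusSq x y) ^ 2 * (1 + |logBase x y|)) := by
  obtain ⟨C, hC, hP⟩ := hP
  have hF' : F = fun z => speedProfile (radiusSq z.1 z.2) * P z := funext hF
  refine ⟨4 * C, by positivity, fun x y hy => ?_⟩
  have hs := radiusSq_pos_of_right x hy
  obtain ⟨h1, a, b, h2, h3, h4⟩ := hP x y hy
  have he0 := speedExponent_nonneg (radiusSq_nonneg x y)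
  have he1 := speedExponent_le (radiusSq_nonneg x y)
  obtain ⟨r, α, β, hr, hx, hy', hrs, hsq, hα, hβ, hβ0⟩ := exists_polar x hy
  have hM0 := speedProfile_nonneg (radiusSq x y)
  have hMle : speedProfile (radiusSq x y) ≤ r * logFactor (radiusSq x y) ^ 2 := by
    rw [speedProfile]
    gcongr
    rw [← hsq]
    exact Real.sqrt_le_sqrt (div_le_self hs.le (by linarith))
  have hK1 : 1 ≤ 1 + |logBase x y| := by have := abs_nonneg (logBase x y); linarith
  rw [hsq] at h3 h4
  rw [hF']
  -- Both terms of the product rule are M / r times a quantity O(1 + |log(y M)|), since the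
  -- derivative of M is of order M / r; and M / r is at most `logFactor` squared.
  have hmain : ∀ (a α : ℝ), r * |a| ≤ C * (1 + |logBase x y|) → |α| ≤ 1 →
      |speedExponent (radiusSq x y) * speedProfile (radiusSq x y) / radiusSq x y * (2 * (r * α)) *
        P (x, y) + speedProfile (radiusSq x y) * a| ≤
      2 * C * (logFactor (radiusSq x y) ^ 2 * (1 + |logBase x y|)) := by
    intro a α ha hα
    have h5 : speedExponent (radiusSq x y) * speedProfile (radiusSq x y) / radiusSq x y *
        (2 * (r * α)) * P (x, y) + speedProfile (radiusSq x y) * a =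
        (speedProfile (radiusSq x y) / r) * ((2 * speedExponent (radiusSq x y)) * α * P (x, y) +
          r * a) := by
      rw [hrs]; field_simp
    have h6 : |speedProfile (radiusSq x y) / r| ≤ logFactor (radiusSq x y) ^ 2 := by
      rw [abs_of_nonneg (by positivity), div_le_iff₀ hr]; linarith
    have h7 : |2 * speedExponent (radiusSq x y)| ≤ 1 := by
      rw [abs_of_nonneg (by positivity)]; linarith
    rw [h5, abs_mul]
    calc _ ≤ logFactor (radiusSq x y) ^ 2 *
          (|2 * speedExponent (radiusSq x y)| * |α| * |P (x, y)| + r * |a|) := by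
          gcongr
          refine (abs_add_le _ _).trans ?_
          rw [abs_mul, abs_mul _ α, abs_mul r, abs_of_pos hr]
      _ ≤ logFactor (radiusSq x y) ^ 2 * (1 * 1 * C + C * (1 + |logBase x y|)) := by
          gcongr
      _ ≤ logFactor (radiusSq x y) ^ 2 * (2 * C * (1 + |logBase x y|)) := by
          gcongr; nlinarith
      _ = _ := by ring
  refine ⟨_, _, (hasPartials_speedProfile hs).mul h2, ?_⟩
  have h8 := hmain a α h3 hα
  have h9 := hmain b β h4 hβ
  rw [← hx] at h8
  rw [← hy'] at h9
  linarith

/-! ### Differentiability off the origin and continuity -/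

theorem HasPartials.of_abs_le_sq {D : ℝ × ℝ → ℝ} {C x : ℝ}
    (h : ∀ᶠ z : ℝ × ℝ in 𝓝 (x, 0), |D z| ≤ C * z.2 ^ 2) : HasPartials D 0 0 (x, 0) := by
  have hR : Tendsto (fun z : ℝ × ℝ => D z / z.2) (𝓝 (x, 0)) (𝓝 0) := by
    have h1 : Tendsto (fun z : ℝ × ℝ => C * |z.2|) (𝓝 (x, 0)) (𝓝 0) := by
      have : Continuous fun z : ℝ × ℝ => C * |z.2| := by fun_prop
      simpa using this.tendsto (x, 0)
    refine squeeze_zero_norm' ?_ h1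
    filter_upwards [h] with z hz
    rw [Real.norm_eq_abs, abs_div]
    rcases eq_or_ne z.2 0 with h0 | h0
    · simp [h0]
    · rw [div_le_iff₀ (abs_pos.2 h0), mul_assoc, abs_mul_abs_self]
      linarith
  refine HasFDerivAt.congr_of_eventuallyEq (HasPartials.snd_mul hR) ?_
  filter_upwards [h] with z hz
  rcases eq_or_ne z.2 0 with h0 | h0
  · rw [h0] at hz ⊢
    have : |D z| ≤ 0 := by simpa using hz
    simpa using this
  · field_simp

/-- Away from the origin the denominator of q is bounded below. The oscillating part of the field is
therefore O(y²), and its oscillations do not spoil differentiability on the axis. -/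
theorem eventually_speedProfile_mul_heightRatio_le {x : ℝ} (hx : x ≠ 0) :
    ∃ C : ℝ, 0 ≤ C ∧ ∀ᶠ z : ℝ × ℝ in 𝓝 (x, 0),
      speedProfile (radiusSq z.1 z.2) * heightRatio z.1 z.2 ≤ C * z.2 ^ 2 := by
  have hs := radiusSq_pos_of_left hx 0
  refine ⟨64 / (radiusSq x 0 / 2), by positivity, ?_⟩
  have h1 : ∀ᶠ z : ℝ × ℝ in 𝓝 (x, 0), radiusSq x 0 / 2 < radiusSq z.1 z.2 :=
    (continuous_radiusSq.tendsto (x, 0)).eventually_const_lt (half_lt_self hs)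
  filter_upwards [h1] with z hz
  have h2 : 0 < radiusSq z.1 z.2 := by linarith
  have h3 := speedProfile_le_const h2.le
  rw [heightRatio]
  calc speedProfile (radiusSq z.1 z.2) * (z.2 ^ 2 / radiusSq z.1 z.2)
      ≤ 64 * (z.2 ^ 2 / (radiusSq x 0 / 2)) := by gcongr
    _ = 64 / (radiusSq x 0 / 2) * z.2 ^ 2 := by ring

theorem differentiableAt_saddleFst_axis {x : ℝ} (hx : x ≠ 0) :
    DifferentiableAt ℝ (fun z : ℝ × ℝ => saddleFst z.1 z.2) (x, 0) := by
  have hs := radiusSq_pos_of_left hx 0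
  obtain ⟨C, hC, h⟩ := eventually_speedProfile_mul_heightRatio_le hx
  have h1 : HasPartials (fun z => saddleFst z.1 z.2 - speedProfile (radiusSq z.1 z.2)) 0 0
      (x, 0) := by
    refine HasPartials.of_abs_le_sq (C := 2 * C) ?_
    filter_upwards [h] with z hz
    have h2 := abs_le.1 (abs_saddleFst_sub_le z.1 z.2)
    have he0 := speedExponent_nonneg (radiusSq_nonneg z.1 z.2)
    have he1 := speedExponent_le (radiusSq_nonneg z.1 z.2)
    have h0 := mul_nonneg (speedProfile_nonneg (radiusSq z.1 z.2)) (heightRatio_nonneg z.1 z.2)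
    rw [abs_le]
    constructor <;> nlinarith [mul_nonneg h0 he0, mul_nonneg h0 (sub_nonneg.2 he1)]
  have h3 := (hasPartials_speedProfile hs).differentiableAt.add h1.differentiableAt
  refine h3.congr_of_eventuallyEq (Eventually.of_forall fun z => ?_)
  simp

theorem differentiableAt_saddleSnd_axis {x : ℝ} (hx : x ≠ 0) :
    DifferentiableAt ℝ (fun z : ℝ × ℝ => saddleSnd z.1 z.2) (x, 0) := by
  have hs := radiusSq_pos_of_left hx 0
  obtain ⟨C, hC, h⟩ := eventually_speedProfile_mul_heightRatio_le hx
  have h1 : HasPartials (fun z => saddleSnd z.1 z.2 + speedProfile (radiusSq z.1 z.2) *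
      (z.1 * z.2 / radiusSq z.1 z.2 * (2 * speedExponent (radiusSq z.1 z.2)))) 0 0 (x, 0) := by
    refine HasPartials.of_abs_le_sq (C := C) ?_
    filter_upwards [h] with z hz
    exact (abs_saddleSnd_add_le z.1 z.2).trans hz
  have h2 := (hasPartials_speedProfile hs).mul
    ((((HasPartials.fst (x, 0)).mul (HasPartials.snd (x, 0))).mul
      (hasPartials_inv_radiusSq hs)).mul ((HasPartials.const 2 (x, 0)).mul
        (HasPartials.comp (F := fun z => radiusSq z.1 z.2) (z := (x, 0))
          (hasDerivAt_speedExponent hs) (hasPartials_radiusSq x 0))))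
  have h3 := h1.differentiableAt.sub h2.differentiableAt
  refine h3.congr_of_eventuallyEq (Eventually.of_forall fun z => ?_)
  simp only [Pi.sub_apply, div_eq_mul_inv]
  ring

theorem differentiableAt_saddleFst {z : ℝ × ℝ} (hz : z ≠ 0) :
    DifferentiableAt ℝ (fun z : ℝ × ℝ => saddleFst z.1 z.2) z := by
  obtain ⟨x, y⟩ := z
  rcases eq_or_ne y 0 with rfl | hy
  · exact differentiableAt_saddleFst_axis fun hx => hz (by rw [hx]; rfl)
  · obtain ⟨P, hP, hF⟩ := exists_isTame_saddleFst
    obtain ⟨C, -, h⟩ := hP.exists_partials_le (F := fun z => saddleFst z.1 z.2) hF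
    obtain ⟨a, b, h1, -⟩ := h x y hy
    exact h1.differentiableAt

theorem differentiableAt_saddleSnd {z : ℝ × ℝ} (hz : z ≠ 0) :
    DifferentiableAt ℝ (fun z : ℝ × ℝ => saddleSnd z.1 z.2) z := by
  obtain ⟨x, y⟩ := z
  rcases eq_or_ne y 0 with rfl | hy
  · exact differentiableAt_saddleSnd_axis fun hx => hz (by rw [hx]; rfl)
  · obtain ⟨P, hP, hF⟩ := exists_isTame_saddleSnd
    obtain ⟨C, -, h⟩ := hP.exists_partials_le (F := fun z => saddleSnd z.1 z.2) hF
    obtain ⟨a, b, h1, -⟩ := h x y hy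
    exact h1.differentiableAt

theorem continuous_of_abs_le_speedProfile {F : ℝ × ℝ → ℝ}
    (hF : ∀ z, |F z| ≤ 3 * speedProfile (radiusSq z.1 z.2))
    (hd : ∀ z, z ≠ 0 → DifferentiableAt ℝ F z) : Continuous F := by
  rw [continuous_iff_continuousAt]
  intro z
  rcases eq_or_ne z 0 with rfl | hz
  · have h0 : F 0 = 0 := by
      have := hF 0
      simpa [radiusSq, speedProfile_zero] using this
    rw [ContinuousAt, h0]
    have h1 := (continuous_speedProfile_radiusSq.const_mul 3).tendsto 0
    simp only [Prod.fst_zero, Prod.snd_zero, radiusSq, ne_eq, OfNat.ofNat_ne_zero,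
      not_false_eq_true, zero_pow, add_zero, speedProfile_zero, mul_zero] at h1
    exact squeeze_zero_norm hF h1
  · exact (hd z hz).continuousAt

theorem continuous_saddleFst : Continuous fun z : ℝ × ℝ => saddleFst z.1 z.2 :=
  continuous_of_abs_le_speedProfile (fun z => abs_saddleFst_le z.1 z.2)
    fun _ hz => differentiableAt_saddleFst hz

theorem continuous_saddleSnd : Continuous fun z : ℝ × ℝ => saddleSnd z.1 z.2 :=
  continuous_of_abs_le_speedProfile (fun z => abs_saddleSnd_le z.1 z.2)
    fun _ hz => differentiableAt_saddleSnd hz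

/-! ### Level-set structure of the perturbed stream function -/

theorem saddleStream_neg (x y : ℝ) : saddleStream x (-y) = -saddleStream x y := by
  simp only [saddleStream, heightRatio, logBase, radiusSq, neg_mul, Real.log_neg_eq_log, even_two,
    Even.neg_pow]

theorem half_mul_le_saddleStream (x : ℝ) {y : ℝ} (hy : 0 ≤ y) :
    y * speedProfile (radiusSq x y) / 2 ≤ saddleStream x y := by
  have hq0 := heightRatio_nonneg x y
  have hq1 := heightRatio_le_one x y
  have hM := mul_nonneg hy (speedProfile_nonneg (radiusSq x y))
  have hg := abs_le.1 (abs_wiggle_le (logBase x y))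
  have h1 : -(1 / 2) ≤ heightRatio x y * wiggle (logBase x y) := by nlinarith
  rw [saddleStream]
  nlinarith

theorem saddleStream_surjective (x : ℝ) : Function.Surjective (saddleStream x) := by
  have hc : Continuous (saddleStream x) := by
    have : Continuous fun z : ℝ × ℝ => saddleStream z.1 z.2 := by
      rw [continuous_iff_continuousAt]
      rintro ⟨x, y⟩
      rcases eq_or_ne y 0 with rfl | hy
      · exact (hasPartials_saddleStream_axis x).continuousAt
      · exact (hasPartials_saddleStream hy).continuousAt
    exact this.comp (by fun_prop : Continuous fun y : ℝ => (x, y))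
  have htop : Tendsto (saddleStream x) atTop atTop := by
    have h0 : 0 < speedProfile 1 / 2 := by have := speedProfile_pos one_pos; positivity
    refine tendsto_atTop_mono' atTop ?_ (tendsto_id.atTop_mul_const h0)
    filter_upwards [eventually_ge_atTop 1] with y hy
    have h1 := half_mul_le_saddleStream x (by linarith : 0 ≤ y)
    have h2 : speedProfile 1 ≤ speedProfile (radiusSq x y) :=
      speedProfile_monotoneOn (by simp) (radiusSq_nonneg x y) (by unfold radiusSq; nlinarith)
    simp only [id]
    nlinarith
  refine hc.surjective htop ?_
  have h1 := (tendsto_neg_atTop_atBot.comp htop).comp tendsto_neg_atBot_atTop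
  refine h1.congr fun y => ?_
  simp [saddleStream_neg]

theorem isGraphStreamFunction_saddle :
    IsGraphStreamFunction saddleStream saddleFst saddleSnd 192 where
  hasFDerivAt := fun x y => by
    have h : HasPartials (fun z => saddleStream z.1 z.2) (-saddleSnd x y) (saddleFst x y) (x, y) := by
      rcases eq_or_ne y 0 with rfl | hy
      · exact hasPartials_saddleStream_axis x
      · exact hasPartials_saddleStream hy
    unfold HasPartials at h
    convert! h using 1
    ext <;> simp
  cont_fst := continuous_saddleFst
  cont_snd := continuous_saddleSnd
  abs_fst_le := fun x y => (abs_saddleFst_le x y).trans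
    (by linarith [speedProfile_le_const (radiusSq_nonneg x y)])
  abs_snd_le := fun x y => (abs_saddleSnd_le x y).trans
    (by linarith [speedProfile_le_const (radiusSq_nonneg x y)])
  pos := fun x y hy => lt_of_lt_of_le
    (half_pos (speedProfile_pos (radiusSq_pos_of_right x hy))) (half_le_saddleFst x y)
  map_zero := fun x => by simp [saddleStream]
  surjective := saddleStream_surjective

/-! ### Weak derivatives and divergence -/

/-- The linear identification of the Euclidean plane with `ℝ × ℝ`. -/
noncomputable def planeCLE : Euc 2 ≃L[ℝ] ℝ × ℝ :=
  (EuclideanSpace.equiv (Fin 2) ℝ).trans (ContinuousLinearEquiv.finTwoArrow ℝ ℝ)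

theorem integral_plane {E : Type*} [NormedAddCommGroup E] [NormedSpace ℝ E] (F : ℝ × ℝ → E) :
    ∫ z : Euc 2, F (z 0, z 1) = ∫ z, F z :=
  measurePreserving_planeEquiv.integral_comp' F

/-- The divergence theorem on a box allows a countable set of points without differentiability, here
the origin; the boundary terms vanish on a box containing the support. -/
theorem integral_fderiv_prod_eq_zero {E : Type*} [NormedAddCommGroup E] [NormedSpace ℝ E]
    [CompleteSpace E] {g : ℝ × ℝ → E} (hc : Continuous g) (hs : HasCompactSupport g)
    (hd : ∀ z, z ≠ 0 → DifferentiableAt ℝ g z) (v : ℝ × ℝ)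
    (hi : Integrable fun z => fderiv ℝ g z v) : ∫ z, fderiv ℝ g z v = 0 := by
  obtain ⟨R, hR⟩ := hs.isCompact.isBounded.subset_ball (0 : ℝ × ℝ)
  have hg0 : ∀ z : ℝ × ℝ, z ∉ Metric.ball (0 : ℝ × ℝ) R → g z = 0 := fun z hz =>
    image_eq_zero_of_notMem_tsupport fun h => hz (hR h)
  have hg1 : ∀ z : ℝ × ℝ, z ∉ Metric.ball (0 : ℝ × ℝ) R → fderiv ℝ g z = 0 := fun z hz =>
    image_eq_zero_of_notMem_tsupport fun h => hz (hR (tsupport_fderiv_subset ℝ h))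
  set S := |R| with hS
  have hball : Metric.ball (0 : ℝ × ℝ) R ⊆ Icc (-S, -S) (S, S) := by
    intro z hz
    rw [mem_ball_zero_iff, Prod.norm_def, max_lt_iff, Real.norm_eq_abs, Real.norm_eq_abs,
      abs_lt, abs_lt] at hz
    have := le_abs_self R
    exact ⟨⟨by show -S ≤ z.1; linarith [hz.1.1], by show -S ≤ z.2; linarith [hz.2.1]⟩,
      ⟨by show z.1 ≤ S; linarith [hz.1.2], by show z.2 ≤ S; linarith [hz.2.2]⟩⟩
  have hout : ∀ z : ℝ × ℝ, S ≤ ‖z‖ → g z = 0 := fun z hz => hg0 z (by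
    rw [mem_ball_zero_iff, not_lt]; exact (le_abs_self R).trans hz)
  have hS0 : 0 ≤ S := abs_nonneg R
  have hfv : ∀ z, (v.1 • fderiv ℝ g z) (1, 0) + (v.2 • fderiv ℝ g z) (0, 1) =
      fderiv ℝ g z v := by
    intro z
    have : v = v.1 • ((1 : ℝ), (0 : ℝ)) + v.2 • ((0 : ℝ), (1 : ℝ)) := by ext <;> simp
    conv_rhs => rw [this, map_add, map_smul, map_smul]
    simp
  have key := integral_divergence_prod_Icc_of_hasFDerivAt_off_countable_of_le
    (fun z => v.1 • g z) (fun z => v.2 • g z)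
    (fun z => v.1 • fderiv ℝ g z) (fun z => v.2 • fderiv ℝ g z) (-S, -S) (S, S)
    ⟨by show -S ≤ S; linarith, by show -S ≤ S; linarith⟩ {0} (countable_singleton _)
    (hc.const_smul _).continuousOn (hc.const_smul _).continuousOn
    (fun z hz => (hd z (by simpa using hz.2)).hasFDerivAt.const_smul _)
    (fun z hz => (hd z (by simpa using hz.2)).hasFDerivAt.const_smul _)
    (by simp_rw [hfv]; exact hi.integrableOn)
  simp_rw [hfv] at key
  rw [setIntegral_eq_integral_of_forall_compl_eq_zero] at key
  · rw [key]
    have e1 : ∀ x : ℝ, g (x, S) = 0 := fun x => hout _ (by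
      have := norm_snd_le (x, S); simp only [Real.norm_eq_abs, abs_of_nonneg hS0] at this
      exact this)
    have e2 : ∀ x : ℝ, g (x, -S) = 0 := fun x => hout _ (by
      have := norm_snd_le (x, -S)
      simp only [Real.norm_eq_abs, abs_neg, abs_of_nonneg hS0] at this
      exact this)
    have e3 : ∀ y : ℝ, g (S, y) = 0 := fun y => hout _ (by
      have := norm_fst_le (S, y); simp only [Real.norm_eq_abs, abs_of_nonneg hS0] at this
      exact this)
    have e4 : ∀ y : ℝ, g (-S, y) = 0 := fun y => hout _ (by
      have := norm_fst_le (-S, y)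
      simp only [Real.norm_eq_abs, abs_neg, abs_of_nonneg hS0] at this
      exact this)
    simp [e1, e2, e3, e4]
  · intro z hz
    rw [hg1 z fun h => hz (hball h)]
    simp

/-- The integral of a directional derivative of a compactly supported function vanishes, even if
the function is only continuous at one point. -/
theorem integral_fderiv_plane_eq_zero {E : Type*} [NormedAddCommGroup E] [NormedSpace ℝ E]
    [CompleteSpace E] {ψ : Euc 2 → E} (hc : Continuous ψ) (hs : HasCompactSupport ψ)
    (hd : ∀ z, z ≠ 0 → DifferentiableAt ℝ ψ z) (v : Euc 2)
    (hi : Integrable fun z => fderiv ℝ ψ z v) : ∫ z, fderiv ℝ ψ z v = 0 := by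
  have hfd : ∀ z, fderiv ℝ ψ z v =
      fderiv ℝ (ψ ∘ planeCLE.symm) (planeEquiv z) (planeCLE v) := by
    intro z
    rw [ContinuousLinearEquiv.comp_right_fderiv]
    show _ = fderiv ℝ ψ (planeCLE.symm (planeCLE z)) (planeCLE.symm (planeCLE v))
    simp
  have h1 := integral_fderiv_prod_eq_zero (g := ψ ∘ planeCLE.symm)
    (hc.comp planeCLE.symm.continuous) (hs.comp_homeomorph planeCLE.symm.toHomeomorph)
    (fun z hz => (hd _ (by simpa using hz)).comp z planeCLE.symm.differentiableAt) (planeCLE v)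
    (by
      simp_rw [hfd] at hi
      exact (measurePreserving_planeEquiv.integrable_comp_emb
        planeEquiv.measurableEmbedding).1 hi)
  simp_rw [hfd]
  rw [← h1]
  exact measurePreserving_planeEquiv.integral_comp'
    (fun p => fderiv ℝ (ψ ∘ planeCLE.symm) p (planeCLE v))

/-- A continuous field that is differentiable off the origin, with locally integrable derivative,
is weakly differentiable. -/
theorem isWeakDeriv_fderiv {f : Euc 2 → Euc 2} (hc : Continuous f)
    (hd : ∀ z, z ≠ 0 → DifferentiableAt ℝ f z) (hi : LocallyIntegrable (fderiv ℝ f)) :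
    IsWeakDeriv f (fderiv ℝ f) := by
  refine ⟨hc.locallyIntegrable, hi, fun φ hφ hφs v => ?_⟩
  have hφd : Differentiable ℝ φ := hφ.differentiable (by simp)
  have hφ' : Continuous fun z => fderiv ℝ φ z v :=
    (hφ.continuous_fderiv (by simp)).clm_apply continuous_const
  have hiv : LocallyIntegrable fun z => fderiv ℝ f z v := by
    intro z
    obtain ⟨U, hU, hU'⟩ := hi z
    exact ⟨U, hU, hU'.apply_continuousLinearMap v⟩
  have i1 : Integrable fun z => fderiv ℝ φ z v • f z :=
    (hφ'.smul hc).integrable_of_hasCompactSupport ((hφs.fderiv_apply ℝ v).smul_right)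
  have i2 : Integrable fun z => φ z • fderiv ℝ f z v :=
    hiv.integrable_smul_left_of_hasCompactSupport hφ.continuous hφs
  have hpt : ∀ z, z ≠ 0 → fderiv ℝ (fun z => φ z • f z) z v =
      fderiv ℝ φ z v • f z + φ z • fderiv ℝ f z v := by
    intro z hz
    rw [fderiv_fun_smul (hφd z) (hd z hz)]
    simp [add_comm]
  have hae : (fun z => fderiv ℝ (fun z => φ z • f z) z v) =ᵐ[volume]
      fun z => fderiv ℝ φ z v • f z + φ z • fderiv ℝ f z v := by
    have : ∀ᵐ z : Euc 2, z ≠ 0 := by simp [ae_iff]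
    filter_upwards [this] with z hz using hpt z hz
  have h0 := integral_fderiv_plane_eq_zero (ψ := fun z => φ z • f z) (hφ.continuous.smul hc)
    hφs.smul_right (fun z hz => (hφd z).smul (hd z hz)) v ((i1.add i2).congr hae.symm)
  rw [integral_congr_ae hae, integral_add i1 i2] at h0
  exact eq_neg_of_add_eq_zero_left h0

namespace IsGraphStreamFunction

variable {H b₁ b₂ : ℝ → ℝ → ℝ} {B : ℝ}

theorem hasFDerivAt_plane (h : IsGraphStreamFunction H b₁ b₂ B) (z : Euc 2) :
    HasFDerivAt (fun z : Euc 2 => H (z 0) (z 1))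
      (b₁ (z 0) (z 1) • EuclideanSpace.proj (𝕜 := ℝ) (ι := Fin 2) 1 -
        b₂ (z 0) (z 1) • EuclideanSpace.proj (𝕜 := ℝ) (ι := Fin 2) 0) z := by
  have h1 := (h.hasFDerivAt (z 0) (z 1)).comp z planeCLE.hasFDerivAt
  exact h1

theorem contDiff_plane (h : IsGraphStreamFunction H b₁ b₂ B) :
    ContDiff ℝ 1 fun z : Euc 2 => H (z 0) (z 1) := by
  rw [contDiff_one_iff_fderiv]
  refine ⟨fun z => (h.hasFDerivAt_plane z).differentiableAt, ?_⟩
  have h1 : fderiv ℝ (fun z : Euc 2 => H (z 0) (z 1)) = fun z =>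
      b₁ (z 0) (z 1) • EuclideanSpace.proj (𝕜 := ℝ) (ι := Fin 2) 1 -
        b₂ (z 0) (z 1) • EuclideanSpace.proj (𝕜 := ℝ) (ι := Fin 2) 0 :=
    funext fun z => (h.hasFDerivAt_plane z).fderiv
  rw [h1]
  have hz : Continuous fun z : Euc 2 => (z 0, z 1) := by fun_prop
  exact ((h.cont_fst.comp hz).smul continuous_const).sub
    ((h.cont_snd.comp hz).smul continuous_const)

theorem isDivFree_planeField (h : IsGraphStreamFunction H b₁ b₂ B) :
    IsDivFree (planeField b₁ b₂) := by
  refine ⟨h.continuous_planeField.locallyIntegrable, fun φ hφ hφs => ?_⟩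
  set e₀ : Euc 2 := EuclideanSpace.single 0 1
  set e₁ : Euc 2 := EuclideanSpace.single 1 1
  set Hp : Euc 2 → ℝ := fun z => H (z 0) (z 1) with hHp
  have hHd : Differentiable ℝ Hp := fun z => (h.hasFDerivAt_plane z).differentiableAt
  have hHc : Continuous Hp := hHd.continuous
  have hH0 : ∀ z, fderiv ℝ Hp z e₀ = -b₂ (z 0) (z 1) := fun z => by
    rw [(h.hasFDerivAt_plane z).fderiv]; simp [e₀]
  have hH1 : ∀ z, fderiv ℝ Hp z e₁ = b₁ (z 0) (z 1) := fun z => by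
    rw [(h.hasFDerivAt_plane z).fderiv]; simp [e₁]
  have hHf : ∀ v, Continuous fun z => fderiv ℝ Hp z v := fun v =>
    (h.contDiff_plane.continuous_fderiv (by simp)).clm_apply continuous_const
  have hφf : ∀ v, ContDiff ℝ 1 fun z => fderiv ℝ φ z v := fun v =>
    ((hφ.fderiv_right (m := 1) (by norm_cast)).clm_apply contDiff_const)
  have hsupp : ∀ v, HasCompactSupport fun z => fderiv ℝ φ z v := fun v => hφs.fderiv_apply ℝ v
  -- H is only C¹, so its derivatives are moved onto φ; what remains is H against the commutator of
  -- second derivatives of φ, which is 0.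
  have hparts : ∀ v w : Euc 2, ∫ z, fderiv ℝ φ z v * fderiv ℝ Hp z w =
      -∫ z, fderiv ℝ (fun z => fderiv ℝ φ z v) z w * Hp z := by
    intro v w
    refine integral_mul_fderiv_eq_neg_fderiv_mul_of_integrable ?_ ?_ ?_
      (fun z _ => ((hφf v).differentiable (by simp)) z) (fun z _ => hHd z)
    · exact ((((hφf v).continuous_fderiv (by simp)).clm_apply continuous_const).mul
        hHc).integrable_of_hasCompactSupport ((hsupp v).fderiv_apply ℝ w).mul_right
    · exact ((hφf v).continuous.mul (hHf w)).integrable_of_hasCompactSupport (hsupp v).mul_right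
    · exact ((hφf v).continuous.mul hHc).integrable_of_hasCompactSupport (hsupp v).mul_right
  have hsymm : ∀ z, fderiv ℝ (fun z => fderiv ℝ φ z e₀) z e₁ =
      fderiv ℝ (fun z => fderiv ℝ φ z e₁) z e₀ := by
    intro z
    have h2 : DifferentiableAt ℝ (fderiv ℝ φ) z :=
      ((hφ.fderiv_right (m := 1) (by norm_cast)).differentiable (by simp)) z
    have h3 : ∀ v w : Euc 2, fderiv ℝ (fun z => fderiv ℝ φ z v) z w =
        fderiv ℝ (fderiv ℝ φ) z w v := by
      intro v w
      rw [fderiv_clm_apply h2 (differentiableAt_const v)]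
      simp
    rw [h3, h3]
    have h4 : IsSymmSndFDerivAt ℝ φ z :=
      hφ.contDiffAt.isSymmSndFDerivAt (by
        rw [minSmoothness_of_isRCLikeNormedField]; exact WithTop.coe_le_coe.2 (le_top : (2 : ℕ∞) ≤ ⊤))
    exact h4 e₁ e₀
  have hi : ∀ v w : Euc 2, Integrable fun z => fderiv ℝ φ z v * fderiv ℝ Hp z w := fun v w =>
    ((hφf v).continuous.mul (hHf w)).integrable_of_hasCompactSupport (hsupp v).mul_right
  have hpt : ∀ z, fderiv ℝ φ z (planeField b₁ b₂ z) =
      fderiv ℝ φ z e₀ * fderiv ℝ Hp z e₁ - fderiv ℝ φ z e₁ * fderiv ℝ Hp z e₀ := by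
    intro z
    have h5 : planeField b₁ b₂ z = b₁ (z 0) (z 1) • e₀ + b₂ (z 0) (z 1) • e₁ := by
      ext i
      fin_cases i <;> simp [planeField, e₀, e₁]
    rw [h5, map_add, map_smul, map_smul, hH0, hH1]
    simp only [smul_eq_mul]
    ring
  simp_rw [hpt]
  rw [integral_sub (hi _ _) (hi _ _), hparts, hparts]
  simp_rw [hsymm]
  simp

end IsGraphStreamFunction

/-! ### Local integrability of powers of the gradient -/

theorem log_one_add_inv_radiusSq_le (x : ℝ) {y : ℝ} (hy : y ≠ 0) :
    Real.log (1 + (radiusSq x y)⁻¹) ≤ 1 + 2 * |Real.log y| := by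
  have hs := radiusSq_pos_of_right x hy
  have hy2 : 0 < y ^ 2 := by positivity
  have h1 : (radiusSq x y)⁻¹ ≤ (y ^ 2)⁻¹ := inv_anti₀ hy2 (by unfold radiusSq; nlinarith)
  have h2 : Real.log (1 + (radiusSq x y)⁻¹) ≤ Real.log (1 + (y ^ 2)⁻¹) := by
    have := inv_pos.2 hs
    gcongr
  have hl2 : Real.log 2 ≤ 1 := by
    have := Real.log_le_sub_one_of_pos (by norm_num : (0 : ℝ) < 2); linarith
  rcases le_total 1 (y ^ 2) with h | h
  · have h3 : (y ^ 2)⁻¹ ≤ 1 := inv_le_one_of_one_le₀ h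
    have h4 : Real.log (1 + (y ^ 2)⁻¹) ≤ Real.log 2 := by
      have := inv_pos.2 hy2
      refine Real.log_le_log (by positivity) (by linarith)
    have := abs_nonneg (Real.log y)
    linarith
  · have h3 : 1 ≤ (y ^ 2)⁻¹ := (one_le_inv₀ hy2).2 h
    have h4 : Real.log (1 + (y ^ 2)⁻¹) ≤ Real.log (2 * (y ^ 2)⁻¹) :=
      Real.log_le_log (by positivity) (by linarith)
    rw [Real.log_mul (by norm_num) (by positivity), Real.log_inv, Real.log_pow] at h4
    have := neg_abs_le (Real.log y)
    push_cast at h4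
    linarith

theorem logFactor_radiusSq_le (x : ℝ) {y : ℝ} (hy : y ≠ 0) :
    logFactor (radiusSq x y) ≤ 9 * (1 + |Real.log y|) := by
  have := log_one_add_inv_radiusSq_le x hy
  have := abs_nonneg (Real.log y)
  rw [logFactor]
  linarith

/-- M lies between √(s / (1 + s)) and 64, where s = r², so |log M| is controlled by log(1 + 1 / s),
hence by |log |y||. -/
theorem one_add_abs_logBase_le (x : ℝ) {y : ℝ} (hy : y ≠ 0) :
    1 + |logBase x y| ≤ 66 * (1 + |Real.log y|) := by
  have hs := radiusSq_pos_of_right x hy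
  have hM := speedProfile_pos hs
  have h1 := log_one_add_inv_radiusSq_le x hy
  have h2 : Real.log (speedProfile (radiusSq x y)) ≤ 63 := by
    have := Real.log_le_sub_one_of_pos hM
    have := speedProfile_le_const hs.le
    linarith
  have hw : 0 < radiusSq x y / (1 + radiusSq x y) := by positivity
  have h3 : -(1 / 2) * Real.log (1 + (radiusSq x y)⁻¹) ≤
      Real.log (speedProfile (radiusSq x y)) := by
    have h4 : √(radiusSq x y / (1 + radiusSq x y)) ≤ speedProfile (radiusSq x y) := by
      have := eight_le_logFactor hs.le
      have : 1 ≤ logFactor (radiusSq x y) ^ 2 := by nlinarith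
      exact le_mul_of_one_le_right (Real.sqrt_nonneg _) this
    have h5 := Real.log_le_log (Real.sqrt_pos.2 hw) h4
    rw [Real.log_sqrt hw.le] at h5
    have h6 : radiusSq x y / (1 + radiusSq x y) = (1 + (radiusSq x y)⁻¹)⁻¹ := by
      field_simp; ring
    rw [h6, Real.log_inv] at h5
    linarith
  have h7 : |Real.log (speedProfile (radiusSq x y))| ≤ 64 + |Real.log y| := by
    have := abs_nonneg (Real.log y)
    rw [abs_le]; constructor <;> linarith
  rw [logBase, Real.log_mul hy hM.ne']
  have := abs_add_le (Real.log y) (Real.log (speedProfile (radiusSq x y)))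
  have := abs_nonneg (Real.log y)
  linarith

theorem exists_norm_fderiv_plane_le {F P : ℝ × ℝ → ℝ} (hP : IsTame P)
    (hF : ∀ z, F z = speedProfile (radiusSq z.1 z.2) * P z) :
    ∃ C : ℝ, 0 ≤ C ∧ ∀ z : Euc 2, z 1 ≠ 0 →
      ‖fderiv ℝ (fun z : Euc 2 => F (z 0, z 1)) z‖ ≤ C * (1 + |Real.log (z 1)|) ^ 3 := by
  obtain ⟨C, hC, h⟩ := hP.exists_partials_le hF
  refine ⟨C * (81 * 66) * ‖(planeCLE : Euc 2 →L[ℝ] ℝ × ℝ)‖, by positivity, fun z hz => ?_⟩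
  obtain ⟨a, b, h1, h2⟩ := h (z 0) (z 1) hz
  have h3 : fderiv ℝ (fun z : Euc 2 => F (z 0, z 1)) z =
      (fderiv ℝ F (z 0, z 1)).comp (planeCLE : Euc 2 →L[ℝ] ℝ × ℝ) :=
    (HasFDerivAt.comp z (h1.differentiableAt.hasFDerivAt) planeCLE.hasFDerivAt).fderiv
  have h4 := h1.norm_fderiv_le
  have h5 := logFactor_radiusSq_le (z 0) hz
  have h6 := one_add_abs_logBase_le (z 0) hz
  have h7 := logFactor_pos (radiusSq_nonneg (z 0) (z 1))
  rw [h3]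
  calc _ ≤ ‖fderiv ℝ F (z 0, z 1)‖ * ‖(planeCLE : Euc 2 →L[ℝ] ℝ × ℝ)‖ :=
        ContinuousLinearMap.opNorm_comp_le _ _
    _ ≤ (C * ((9 * (1 + |Real.log (z 1)|)) ^ 2 * (66 * (1 + |Real.log (z 1)|)))) *
        ‖(planeCLE : Euc 2 →L[ℝ] ℝ × ℝ)‖ := by
        gcongr
        refine h4.trans (h2.trans ?_)
        gcongr
    _ = _ := by ring

theorem planeField_eq (b₁ b₂ : ℝ → ℝ → ℝ) (z : Euc 2) : planeField b₁ b₂ z =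
    b₁ (z 0) (z 1) • EuclideanSpace.single 0 (1 : ℝ) +
      b₂ (z 0) (z 1) • EuclideanSpace.single 1 (1 : ℝ) := by
  ext i
  fin_cases i <;> simp [planeField]

theorem differentiableAt_planeField_saddle {z : Euc 2} (hz : z ≠ 0) :
    DifferentiableAt ℝ (planeField saddleFst saddleSnd) z := by
  have hz' : planeCLE z ≠ 0 := by simpa using hz
  have h1 : DifferentiableAt ℝ (fun z : Euc 2 => saddleFst (z 0) (z 1)) z :=
    (differentiableAt_saddleFst hz').comp z planeCLE.differentiableAt
  have h2 : DifferentiableAt ℝ (fun z : Euc 2 => saddleSnd (z 0) (z 1)) z :=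
    (differentiableAt_saddleSnd hz').comp z planeCLE.differentiableAt
  rw [funext (planeField_eq saddleFst saddleSnd)]
  exact (h1.smul_const _).add (h2.smul_const _)

theorem exists_norm_fderiv_planeField_saddle_le : ∃ C : ℝ, 0 ≤ C ∧ ∀ z : Euc 2, z 1 ≠ 0 →
    ‖fderiv ℝ (planeField saddleFst saddleSnd) z‖ ≤ C * (1 + |Real.log (z 1)|) ^ 3 := by
  obtain ⟨P, hP, hF⟩ := exists_isTame_saddleFst
  obtain ⟨Q, hQ, hG⟩ := exists_isTame_saddleSnd
  obtain ⟨C, hC, h⟩ := exists_norm_fderiv_plane_le (F := fun z => saddleFst z.1 z.2) hP hF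
  obtain ⟨D, hD, h'⟩ := exists_norm_fderiv_plane_le (F := fun z => saddleSnd z.1 z.2) hQ hG
  refine ⟨C + D, by positivity, fun z hz => ?_⟩
  have hz' : planeCLE z ≠ 0 := fun h0 => hz (congrArg Prod.snd h0)
  have h1 : DifferentiableAt ℝ (fun z : Euc 2 => saddleFst (z 0) (z 1)) z :=
    (differentiableAt_saddleFst hz').comp z planeCLE.differentiableAt
  have h2 : DifferentiableAt ℝ (fun z : Euc 2 => saddleSnd (z 0) (z 1)) z :=
    (differentiableAt_saddleSnd hz').comp z planeCLE.differentiableAt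
  have h3 := ((h1.hasFDerivAt.smul_const (EuclideanSpace.single 0 (1 : ℝ) : Euc 2)).add
    (h2.hasFDerivAt.smul_const (EuclideanSpace.single 1 (1 : ℝ) : Euc 2))).fderiv
  rw [funext (planeField_eq saddleFst saddleSnd)]
  refine (congrArg norm h3).le.trans ((norm_add_le _ _).trans ?_)
  rw [ContinuousLinearMap.norm_smulRight_apply, ContinuousLinearMap.norm_smulRight_apply,
    PiLp.norm_single, PiLp.norm_single]
  simp only [norm_one, mul_one]
  have := h z hz
  have := h' z hz
  rw [add_mul]
  exact add_le_add (h z hz) (h' z hz)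

theorem one_add_abs_log_le {ε R y : ℝ} (hε : 0 < ε) (hR : 1 ≤ R) (hy : y ≠ 0) (hyR : |y| ≤ R) :
    1 + |Real.log y| ≤ (1 + 1 / ε) * (R ^ ε) ^ 2 * 2 * |y| ^ (-ε) := by
  have hy0 : 0 < |y| := abs_pos.2 hy
  set s := |y| ^ ε with hs
  have hs0 : 0 < s := Real.rpow_pos_of_pos hy0 ε
  have hsR : s ≤ R ^ ε := Real.rpow_le_rpow hy0.le hyR hε.le
  have hR1 : 1 ≤ R ^ ε := Real.one_le_rpow hR hε.le
  have h1 : |Real.log y| ≤ (s + s⁻¹) / ε := by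
    have h2 : Real.log s = ε * Real.log y := by
      rw [hs, Real.log_rpow hy0, Real.log_abs]
    have h3 : |Real.log s| ≤ s + s⁻¹ := by
      have h4 := Real.log_le_sub_one_of_pos hs0
      have h5 := Real.log_le_sub_one_of_pos (inv_pos.2 hs0)
      rw [Real.log_inv] at h5
      have := inv_pos.2 hs0
      rw [abs_le]; constructor <;> linarith
    rw [le_div_iff₀ hε, ← abs_of_pos hε, ← abs_mul, mul_comm, ← h2]
    exact h3
  have h6 : s + s⁻¹ ≤ (R ^ ε) ^ 2 * 2 * s⁻¹ := by
    have h7 : s = s ^ 2 * s⁻¹ := by field_simp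
    have h8 : s ^ 2 * s⁻¹ ≤ (R ^ ε) ^ 2 * s⁻¹ := by gcongr
    have h9 : 1 * s⁻¹ ≤ (R ^ ε) ^ 2 * s⁻¹ := by
      gcongr; nlinarith
    linarith
  have h10 : 1 ≤ s + s⁻¹ := by
    rcases le_total 1 s with h | h
    · have := inv_pos.2 hs0; linarith
    · have := (one_le_inv₀ hs0).2 h; linarith
  rw [Real.rpow_neg hy0.le, ← hs]
  calc 1 + |Real.log y| ≤ (s + s⁻¹) + (s + s⁻¹) / ε := add_le_add h10 h1
    _ = (1 + 1 / ε) * (s + s⁻¹) := by ring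
    _ ≤ (1 + 1 / ε) * ((R ^ ε) ^ 2 * 2 * s⁻¹) := by gcongr
    _ = _ := by ring

theorem memLp_one_add_abs_log_pow {p : ℝ≥0∞} (hp1 : 1 ≤ p) (hp : p < ⊤) {R : ℝ} (hR : 1 ≤ R) :
    MemLp (fun y : ℝ => (1 + |Real.log y|) ^ 3) p (volume.restrict (Icc (-R) R)) := by
  set r := p.toReal with hr
  have hr0 : 0 < r := ENNReal.toReal_pos (by positivity) hp.ne
  -- With r = p, this makes the p-th power of |y|^(-3ε) equal to |y|^(-1/2), which is integrable at
  -- 0.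
  set ε := 1 / (6 * r) with hε
  have hε0 : 0 < ε := by positivity
  have hmeas : Measurable fun y : ℝ => |y| ^ (-(3 * ε)) := by fun_prop
  have hg : MemLp (fun y : ℝ => |y| ^ (-(3 * ε))) p (volume.restrict (Icc (-R) R)) := by
    rw [← integrable_norm_rpow_iff hmeas.aestronglyMeasurable (by positivity) hp.ne]
    have h1 : (fun y : ℝ => ‖|y| ^ (-(3 * ε))‖ ^ p.toReal) = fun y => |y| ^ (-(1 / 2 : ℝ)) := by
      funext y
      rw [Real.norm_of_nonneg (Real.rpow_nonneg (abs_nonneg y) _),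
        ← Real.rpow_mul (abs_nonneg y), ← hr, hε]
      congr 1
      field_simp
      norm_num
    rw [h1]
    have h2 : ∀ a b : ℝ, IntervalIntegrable (fun y : ℝ => y ^ (-(1 / 2 : ℝ))) volume a b :=
      fun a b => intervalIntegral.intervalIntegrable_rpow' (by norm_num)
    have h3 : IntervalIntegrable (fun y : ℝ => |y| ^ (-(1 / 2 : ℝ))) volume 0 R := by
      refine (h2 0 R).congr fun y hy => ?_
      rw [uIoc_of_le (by linarith)] at hy
      simp only [abs_of_pos hy.1]
    have h4 : IntervalIntegrable (fun y : ℝ => |y| ^ (-(1 / 2 : ℝ))) volume (-R) 0 := by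
      have := (IntervalIntegrable.iff_comp_neg (f := fun y : ℝ => |y| ^ (-(1 / 2 : ℝ)))).1 h3
      simpa only [abs_neg, neg_zero] using this.symm
    have h5 := h4.trans h3
    rw [intervalIntegrable_iff_integrableOn_Icc_of_le (by linarith)] at h5
    exact h5
  refine hg.of_le_mul (c := ((1 + 1 / ε) * (R ^ ε) ^ 2 * 2) ^ 3) ?_ ?_
  · exact (by fun_prop : Measurable fun y : ℝ => (1 + |Real.log y|) ^ 3).aestronglyMeasurable
  · have h0 : ∀ᵐ y ∂volume.restrict (Icc (-R) R), y ≠ (0 : ℝ) :=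
      ae_restrict_of_ae (by simp [ae_iff])
    filter_upwards [h0, ae_restrict_mem measurableSet_Icc] with y hy hyR
    have h1 := one_add_abs_log_le hε0 hR hy (abs_le.2 hyR)
    have hy0 : 0 < |y| := abs_pos.2 hy
    have h2 : |y| ^ (-(3 * ε)) = (|y| ^ (-ε)) ^ 3 := by
      rw [← Real.rpow_natCast, ← Real.rpow_mul hy0.le]
      congr 1
      push_cast
      ring
    rw [Real.norm_of_nonneg (by positivity), Real.norm_of_nonneg (by positivity), h2, ← mul_pow]
    gcongr

theorem memLpLoc_one_add_abs_log_pow {p : ℝ≥0∞} (hp1 : 1 ≤ p) (hp : p < ⊤) :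
    MemLpLoc (fun z : Euc 2 => (1 + |Real.log (z 1)|) ^ 3) p := by
  intro K hK
  obtain ⟨R, hR⟩ := hK.isBounded.subset_closedBall (0 : Euc 2)
  set S := max R 1
  have hS : 1 ≤ S := le_max_right _ _
  have h1 := (memLp_one_add_abs_log_pow hp1 hp hS).comp_snd (volume.restrict (Icc (-S) S))
  rw [Measure.prod_restrict, ← Measure.volume_eq_prod] at h1
  have h2 := (measurePreserving_planeEquiv.restrict_preimage_emb planeEquiv.measurableEmbedding
    (Icc (-S) S ×ˢ Icc (-S) S))
  have h3 := h1.comp_measurePreserving h2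
  refine MemLp.mono_measure (Measure.restrict_mono ?_ le_rfl) h3
  intro z hz
  have h4 : ‖z‖ ≤ R := by simpa using hR hz
  have h5 : ∀ i, z i ∈ Icc (-S) S := fun i =>
    abs_le.1 ((PiLp.norm_apply_le z i).trans (h4.trans (le_max_left _ _)))
  exact ⟨h5 0, h5 1⟩

theorem memLpLoc_fderiv_planeField_saddle {p : ℝ≥0∞} (hp1 : 1 ≤ p) (hp : p < ⊤) :
    MemLpLoc (fderiv ℝ (planeField saddleFst saddleSnd)) p := by
  intro K hK
  obtain ⟨C, hC, h⟩ := exists_norm_fderiv_planeField_saddle_le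
  refine (memLpLoc_one_add_abs_log_pow hp1 hp K hK).of_le_mul (c := C)
    (measurable_fderiv ℝ _).aestronglyMeasurable ?_
  filter_upwards [ae_restrict_of_ae ae_plane_snd_ne_zero] with z hz
  rw [Real.norm_of_nonneg (by positivity)]
  exact h z hz

theorem memW1pLoc_planeField_saddle {p : ℝ≥0∞} (hp1 : 1 ≤ p) (hp : p < ⊤) :
    MemW1pLoc (planeField saddleFst saddleSnd) p := by
  have hc := isGraphStreamFunction_saddle.continuous_planeField
  refine ⟨fun K hK => ?_, _, isWeakDeriv_fderiv hc (fun z hz =>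
    differentiableAt_planeField_saddle hz) ?_, memLpLoc_fderiv_planeField_saddle hp1 hp⟩
  · have : IsFiniteMeasure (volume.restrict K) := ⟨by simpa using hK.measure_lt_top⟩
    exact MemLp.of_bound hc.aestronglyMeasurable (2 * 192) (Eventually.of_forall
      isGraphStreamFunction_saddle.norm_planeField_le)
  · rw [locallyIntegrable_iff]
    intro K hK
    exact memLp_one_iff_integrable.1
      (memLpLoc_fderiv_planeField_saddle le_rfl ENNReal.one_lt_top K hK)

/-! ### Monotonicity of the unperturbed speed in y -/

/-- The horizontal speed `M (1 + 2 q e)` of the unperturbed stream function `y M(x² + y²)`. -/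
noncomputable def baseSpeed (x y : ℝ) : ℝ :=
  speedProfile (radiusSq x y) * (1 + 2 * heightRatio x y * speedExponent (radiusSq x y))

theorem baseSpeed_le (x y : ℝ) : baseSpeed x y ≤ 2 * speedProfile (radiusSq x y) := by
  have hq0 := heightRatio_nonneg x y
  have hq1 := heightRatio_le_one x y
  have he0 := speedExponent_nonneg (radiusSq_nonneg x y)
  have he1 := speedExponent_le (radiusSq_nonneg x y)
  have hM := speedProfile_nonneg (radiusSq x y)
  have h1 : 2 * heightRatio x y * speedExponent (radiusSq x y) ≤ 1 := by nlinarith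
  rw [baseSpeed]
  nlinarith

theorem baseSpeed_pos (x : ℝ) {y : ℝ} (hy : y ≠ 0) : 0 < baseSpeed x y := by
  have hq0 := heightRatio_nonneg x y
  have he0 := speedExponent_nonneg (radiusSq_nonneg x y)
  have hM := speedProfile_pos (radiusSq_pos_of_right x hy)
  unfold baseSpeed
  positivity

theorem HasPartials.hasDerivAt_right {F : ℝ × ℝ → ℝ} {a b x y : ℝ}
    (h : HasPartials F a b (x, y)) : HasDerivAt (fun r => F (x, r)) b y := by
  have h1 : HasDerivAt (fun r : ℝ => (x, r)) ((0 : ℝ), (1 : ℝ)) y :=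
    (hasDerivAt_const y x).prodMk (hasDerivAt_id y)
  have h2 := HasFDerivAt.comp_hasDerivAt y h h1
  have h3 : (a • ContinuousLinearMap.fst ℝ ℝ ℝ + b • ContinuousLinearMap.snd ℝ ℝ ℝ)
      ((0 : ℝ), (1 : ℝ)) = b := by simp
  rw [h3] at h2
  exact h2

/-- This is ∂_y `baseSpeed` divided by 2 y M / s. Up to the nonnegative term 2 q e² it is at least e
(3 - q (9/4 + 2 w)) with w = s / (1 + s). If s ≤ 3/5 then w ≤ 3/8 and q ≤ 1 suffices; if s ≥ 3/5
then y² ≤ 9/25 forces q ≤ 3/5. -/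
theorem bracket_nonneg {s y e l q : ℝ} (hs : 0 < s) (hy : y ^ 2 ≤ 9 / 25) (hl : 8 ≤ l)
    (he : e = (1 / 2 - 2 / l) / (1 + s)) (hq : q = y ^ 2 / s) (hq1 : q ≤ 1) :
    0 ≤ e * (1 + 2 * q * e) + 2 * (1 - q) * e +
      2 * q * (s * (-e / (1 + s) - 2 / (l ^ 2 * s * (1 + s) ^ 2))) := by
  have hq0 : 0 ≤ q := by rw [hq]; positivity
  have h2l : 2 / l ≤ 1 / 4 := by rw [div_le_div_iff₀ (by linarith) (by norm_num)]; linarith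
  have he4 : 1 / 4 / (1 + s) ≤ e := by rw [he]; gcongr; linarith
  have he0 : 0 ≤ e := le_trans (by positivity) he4
  have h1 : s * (-e / (1 + s) - 2 / (l ^ 2 * s * (1 + s) ^ 2)) =
      -(e * (s / (1 + s))) - 2 / (l ^ 2 * (1 + s) ^ 2) := by field_simp
  have h2 : 2 / (l ^ 2 * (1 + s) ^ 2) ≤ e / 8 := by
    have h3 : 2 / (l ^ 2 * (1 + s) ^ 2) ≤ 1 / 32 / (1 + s) := by
      rw [div_div, div_le_div_iff₀ (by positivity) (by positivity)]
      have : 64 ≤ l ^ 2 := by nlinarith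
      have h4 : 64 * (1 + s) ≤ l ^ 2 * (1 + s) ^ 2 := by
        have : (1 + s) ≤ (1 + s) ^ 2 := by nlinarith
        gcongr
      linarith
    have : 1 / 32 / (1 + s) = 1 / 4 / (1 + s) / 8 := by ring
    linarith
  set w := s / (1 + s) with hw
  have hw1 : w ≤ 1 := by rw [hw, div_le_one (by positivity)]; linarith
  have hw0 : 0 ≤ w := by positivity
  have hqw : q * (9 / 4 + 2 * w) ≤ 3 := by
    rcases le_total s (3 / 5) with h | h
    · have : w ≤ 3 / 8 := by rw [hw, div_le_div_iff₀ (by positivity) (by norm_num)]; linarith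
      nlinarith
    · have : q ≤ 3 / 5 := by
        rw [hq, div_le_iff₀ hs]; nlinarith
      nlinarith
  rw [h1]
  have h5 : q * (2 / (l ^ 2 * (1 + s) ^ 2)) ≤ q * (e / 8) := by gcongr
  have h6 : 0 ≤ q * e ^ 2 := by positivity
  nlinarith [mul_nonneg he0 (sub_nonneg.2 hqw)]

theorem monotoneOn_baseSpeed (x : ℝ) : MonotoneOn (baseSpeed x) (Ioc 0 (3 / 5)) := by
  have hder : ∀ y ∈ Ioc (0 : ℝ) (3 / 5), ∃ d, 0 ≤ d ∧ HasDerivAt (baseSpeed x) d y := by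
    intro y hy
    have hy0 : y ≠ 0 := hy.1.ne'
    have hs := radiusSq_pos_of_right x hy0
    have h1 := (hasPartials_speedProfile hs).mul ((HasPartials.const 1 (x, y)).add
      (((HasPartials.const 2 (x, y)).mul (hasPartials_heightRatio hs)).mul
        (HasPartials.comp (F := fun z => radiusSq z.1 z.2) (z := (x, y))
          (hasDerivAt_speedExponent hs) (hasPartials_radiusSq x y))))
    refine ⟨_, ?_, h1.hasDerivAt_right⟩
    have hb := bracket_nonneg (e := speedExponent (radiusSq x y))
      (q := heightRatio x y) hs (by nlinarith [hy.1, hy.2] : y ^ 2 ≤ 9 / 25)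
      (eight_le_logFactor hs.le) rfl rfl (heightRatio_le_one x y)
    have hM := speedProfile_nonneg (radiusSq x y)
    have h2 : 0 ≤ 2 * y * speedProfile (radiusSq x y) / radiusSq x y := by
      have := hy.1; positivity
    have h3 := mul_nonneg h2 hb
    refine h3.trans_eq ?_
    have hq : y ^ 2 = heightRatio x y * radiusSq x y := by
      rw [heightRatio, div_mul_cancel₀ _ hs.ne']
    have hy3 : 2 * y ^ 3 / radiusSq x y ^ 2 = 2 * y * heightRatio x y / radiusSq x y := by
      have : y ^ 3 = y * (heightRatio x y * radiusSq x y) := by rw [← hq]; ring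
      rw [this]; field_simp
    simp only
    rw [hy3]
    generalize (-speedExponent (radiusSq x y) / (1 + radiusSq x y) - 2 /
      (logFactor (radiusSq x y) ^ 2 * radiusSq x y * (1 + radiusSq x y) ^ 2)) = d
    field_simp
    ring
  refine monotoneOn_of_deriv_nonneg (convex_Ioc 0 (3 / 5)) ?_ ?_ ?_
  · intro y hy
    obtain ⟨d, -, h⟩ := hder y hy
    exact h.continuousAt.continuousWithinAt
  · intro y hy
    obtain ⟨d, -, h⟩ := hder y (interior_subset hy)
    exact h.differentiableAt.differentiableWithinAt
  · intro y hy
    obtain ⟨d, hd, h⟩ := hder y (interior_subset hy)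
    rw [h.deriv]; exact hd

/-! ### Crests and the speeds along them -/

/-- The levels `exp (-√(n π))`, on which the perturbation of the stream function vanishes. -/
noncomputable def crest (n : ℕ) : ℝ := Real.exp (-√(n * Real.pi))

theorem crest_pos (n : ℕ) : 0 < crest n := Real.exp_pos _

theorem crest_strictAnti : StrictAnti crest := by
  intro m n h
  unfold crest
  have : (m : ℝ) * Real.pi < n * Real.pi := by
    have := Real.pi_pos
    gcongr
  have h2 := Real.sqrt_lt_sqrt (by positivity) this
  exact Real.exp_lt_exp.2 (by linarith)

theorem tendsto_crest : Tendsto crest atTop (𝓝 0) := by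
  have h1 : Tendsto (fun n : ℕ => √((n : ℝ) * Real.pi)) atTop atTop :=
    Real.tendsto_sqrt_atTop.comp (tendsto_natCast_atTop_atTop.atTop_mul_const Real.pi_pos)
  exact Real.tendsto_exp_neg_atTop_nhds_zero.comp h1

theorem log_crest_sq (n : ℕ) : Real.log (crest n) ^ 2 = n * Real.pi := by
  rw [crest, Real.log_exp, neg_sq, Real.sq_sqrt (by have := Real.pi_pos; positivity)]

theorem wiggle_log_crest (n : ℕ) : wiggle (Real.log (crest n)) = 0 := by
  rw [wiggle, log_crest_sq, Real.sin_nat_mul_pi]; simp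

theorem wiggleDeriv_log_crest (n : ℕ) : wiggleDeriv (Real.log (crest n)) =
    (-1) ^ n * (2 * (n * Real.pi) / (1 + n * Real.pi)) := by
  rw [wiggleDeriv, log_crest_sq, Real.sin_nat_mul_pi, Real.cos_nat_mul_pi]; simp

/-- The abbreviation for the height of the level sets of `saddleStream`. -/
noncomputable abbrev saddleHeight (x c : ℝ) : ℝ := streamHeight saddleStream x c

/-- The abbreviation for the speed along the level sets of `saddleStream`. -/
noncomputable abbrev saddleSpeed (c x : ℝ) : ℝ := streamSpeed saddleStream saddleFst c x

/-- The abbreviation for the clock along the level sets of `saddleStream`. -/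
noncomputable abbrev saddleClock (c x : ℝ) : ℝ := streamClock saddleStream saddleFst c x

theorem saddleHeight_pos (x : ℝ) {c : ℝ} (hc : 0 < c) : 0 < saddleHeight x c := by
  have h := isGraphStreamFunction_saddle
  refine (h.strictMono x).lt_iff_lt.1 ?_
  rw [h.stream_height, h.map_zero]
  exact hc

/-- Since g vanishes at log c_n, the curve y M = c_n is also the level set H = c_n. The intermediate
value theorem yields a point of the former, and heights are unique. -/
theorem saddleHeight_crest (x : ℝ) (n : ℕ) :
    saddleHeight x (crest n) * speedProfile (radiusSq x (saddleHeight x (crest n))) =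
      crest n := by
  have h := isGraphStreamFunction_saddle
  have hcont : Continuous fun y => y * speedProfile (radiusSq x y) :=
    continuous_id.mul (continuous_speedProfile_radiusSq.comp
      (by fun_prop : Continuous fun y : ℝ => (x, y)))
  have hM1 := speedProfile_pos one_pos
  -- Y ≥ 1 gives M(x² + Y²) ≥ M(1), and then Y M exceeds the crest value.
  set Y := 1 + crest n / speedProfile 1 with hY
  have hY1 : 1 ≤ Y := by have := crest_pos n; rw [hY]; have : 0 < crest n / speedProfile 1 := by positivity
                         linarith
  have h1 : crest n ≤ Y * speedProfile (radiusSq x Y) := by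
    have h2 : speedProfile 1 ≤ speedProfile (radiusSq x Y) :=
      speedProfile_monotoneOn (by simp) (radiusSq_nonneg x Y) (by unfold radiusSq; nlinarith)
    calc crest n ≤ Y * speedProfile 1 := by rw [hY, add_mul, div_mul_cancel₀ _ hM1.ne']; linarith
      _ ≤ _ := by gcongr
  obtain ⟨y, -, hy⟩ := intermediate_value_Icc (by linarith : (0 : ℝ) ≤ Y) hcont.continuousOn
    (show crest n ∈ Icc _ _ from ⟨by simpa using (crest_pos n).le, h1⟩)
  have h3 : saddleStream x y = crest n := by
    simp only at hy
    rw [saddleStream, logBase, hy, wiggle_log_crest]; ring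
  have h4 : saddleHeight x (crest n) = y := by
    rw [← h3]; exact h.height_stream x y
  rw [h4]; exact hy

/-- On a crest g drops out and only g' survives, with the sign (-1)^n of cos(nπ). -/
theorem saddleSpeed_crest (x : ℝ) (n : ℕ) : saddleSpeed (crest n) x =
    baseSpeed x (saddleHeight x (crest n)) * (1 + 1 / 20 * (heightRatio x (saddleHeight x (crest n)) *
      ((-1) ^ n * (2 * (n * Real.pi) / (1 + n * Real.pi))))) := by
  have h1 : logBase x (saddleHeight x (crest n)) = Real.log (crest n) := by
    rw [logBase, saddleHeight_crest]
  show saddleFst x (saddleHeight x (crest n)) = _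
  rw [saddleFst, h1, wiggle_log_crest, wiggleDeriv_log_crest, baseSpeed]
  ring

/-- Keeps the curve in the range y ≤ 3/5 of `monotoneOn_baseSpeed`. -/
theorem saddleHeight_crest_le {n : ℕ} (hn : crest n ≤ 3 / 5 * speedProfile (9 / 25)) (x : ℝ) :
    saddleHeight x (crest n) ≤ 3 / 5 := by
  by_contra! hlt
  have h1 := saddleHeight_crest x n
  have hM := speedProfile_pos (by norm_num : (0 : ℝ) < 9 / 25)
  have h2 : speedProfile (9 / 25) ≤ speedProfile (radiusSq x (saddleHeight x (crest n))) :=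
    speedProfile_monotoneOn (by simp; norm_num) (radiusSq_nonneg _ _) (by unfold radiusSq; nlinarith)
  nlinarith

theorem one_le_crest_coeff {n : ℕ} (hn : 1 ≤ n) :
    1 ≤ 2 * ((n : ℝ) * Real.pi) / (1 + n * Real.pi) := by
  have h1 : (1 : ℝ) ≤ n := by exact_mod_cast hn
  have h2 := Real.pi_gt_three
  have h3 : 3 ≤ (n : ℝ) * Real.pi := by nlinarith
  rw [le_div_iff₀ (by linarith)]; linarith

theorem crest_coeff_le (n : ℕ) : 2 * ((n : ℝ) * Real.pi) / (1 + n * Real.pi) ≤ 2 := by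
  have := Real.pi_pos
  rw [div_le_iff₀ (by positivity)]; linarith

theorem crest_coeff_nonneg (n : ℕ) : 0 ≤ 2 * ((n : ℝ) * Real.pi) / (1 + n * Real.pi) := by
  have := Real.pi_pos
  positivity

/-- At even crests the flow is faster than the unperturbed one. -/
theorem baseSpeed_le_saddleSpeed_even (x : ℝ) (j : ℕ) :
    baseSpeed x (saddleHeight x (crest (2 * j))) ≤ saddleSpeed (crest (2 * j)) x := by
  have hb := baseSpeed_pos x (saddleHeight_pos x (crest_pos (2 * j))).ne'
  have hq := heightRatio_nonneg x (saddleHeight x (crest (2 * j)))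
  have ha := crest_coeff_nonneg (2 * j)
  rw [saddleSpeed_crest, (even_two_mul j).neg_one_pow, one_mul]
  refine le_mul_of_one_le_right hb.le ?_
  have := mul_nonneg hq ha
  linarith

theorem saddleSpeed_odd (x : ℝ) (j : ℕ) : saddleSpeed (crest (2 * j + 1)) x =
    baseSpeed x (saddleHeight x (crest (2 * j + 1))) *
      (1 - 1 / 20 * (heightRatio x (saddleHeight x (crest (2 * j + 1))) *
        (2 * ((2 * j + 1 : ℕ) * Real.pi) / (1 + (2 * j + 1 : ℕ) * Real.pi)))) := by
  rw [saddleSpeed_crest, (odd_two_mul_add_one j).neg_one_pow]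
  ring

theorem saddleHeight_crest_succ_le (x : ℝ) (n : ℕ) :
    saddleHeight x (crest (n + 1)) ≤ saddleHeight x (crest n) := by
  have h := isGraphStreamFunction_saddle
  refine (h.strictMono x).le_iff_le.1 ?_
  rw [h.stream_height, h.stream_height]
  exact (crest_strictAnti (Nat.lt_succ_self n)).le

/-- The odd crest runs below the even one, hence with smaller unperturbed speed. This comparison
holds for every x, so the delay collected near the origin is not lost elsewhere. -/
theorem baseSpeed_odd_le_even {j : ℕ} (hj : crest (2 * j) ≤ 3 / 5 * speedProfile (9 / 25)) (x : ℝ) :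
    baseSpeed x (saddleHeight x (crest (2 * j + 1))) ≤ saddleSpeed (crest (2 * j)) x := by
  have h1 := saddleHeight_crest_le hj x
  have h2 := saddleHeight_crest_succ_le x (2 * j)
  refine le_trans ?_ (baseSpeed_le_saddleSpeed_even x j)
  exact monotoneOn_baseSpeed x ⟨saddleHeight_pos x (crest_pos _), h2.trans h1⟩
    ⟨saddleHeight_pos x (crest_pos _), h1⟩ h2

/-- The excess of the slowness at an odd crest over that at the preceding even crest. -/
theorem le_one_div_saddleSpeed_sub {j : ℕ}
    (hj : crest (2 * j) ≤ 3 / 5 * speedProfile (9 / 25)) (x : ℝ) :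
    1 / 40 * heightRatio x (saddleHeight x (crest (2 * j + 1))) *
      (saddleHeight x (crest (2 * j + 1)) / crest (2 * j + 1)) ≤
    1 / saddleSpeed (crest (2 * j + 1)) x - 1 / saddleSpeed (crest (2 * j)) x := by
  have hY := saddleHeight_pos x (crest_pos (2 * j + 1))
  have hb := baseSpeed_pos x hY.ne'
  have hq0 := heightRatio_nonneg x (saddleHeight x (crest (2 * j + 1)))
  have hq1 := heightRatio_le_one x (saddleHeight x (crest (2 * j + 1)))
  have ha1 := one_le_crest_coeff (n := 2 * j + 1) (by omega)
  have ha2 := crest_coeff_le (2 * j + 1)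
  have hle := baseSpeed_le x (saddleHeight x (crest (2 * j + 1)))
  have hyM := saddleHeight_crest x (2 * j + 1)
  have hc := crest_pos (2 * j + 1)
  have h1 : 1 / saddleSpeed (crest (2 * j)) x ≤
      1 / baseSpeed x (saddleHeight x (crest (2 * j + 1))) :=
    one_div_le_one_div_of_le hb (baseSpeed_odd_le_even hj x)
  rw [saddleSpeed_odd]
  generalize 2 * (((2 * j + 1 : ℕ) : ℝ) * Real.pi) / (1 + ((2 * j + 1 : ℕ) : ℝ) * Real.pi) = a at *
  set Y := saddleHeight x (crest (2 * j + 1))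
  set q := heightRatio x Y
  set β := baseSpeed x Y
  have hM : speedProfile (radiusSq x Y) = crest (2 * j + 1) / Y := by
    rw [← hyM]; field_simp
  rw [hM] at hle
  set t := 1 / 20 * (q * a) with ht
  have htq : 1 / 20 * q ≤ t := by rw [ht]; nlinarith
  have ht1 : t < 1 := by rw [ht]; nlinarith
  have ht0 : 0 ≤ t := by rw [ht]; positivity
  have h2 : (1 + t) / β ≤ 1 / (β * (1 - t)) := by
    rw [div_le_div_iff₀ hb (mul_pos hb (by linarith))]
    nlinarith [mul_nonneg hb.le (sq_nonneg t)]
  -- The unperturbed speed is at most 2 M, and Y M equals the crest value.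
  have h3 : 1 / 2 * (Y / crest (2 * j + 1)) ≤ 1 / β := by
    have h4 : 1 / (2 * (crest (2 * j + 1) / Y)) ≤ 1 / β := one_div_le_one_div_of_le hb hle
    have h5 : 1 / (2 * (crest (2 * j + 1) / Y)) = 1 / 2 * (Y / crest (2 * j + 1)) := by
      field_simp
    linarith
  have h6 : (1 + t) / β = 1 / β + t * (1 / β) := by ring
  have h7 : 1 / 20 * q * (1 / 2 * (Y / crest (2 * j + 1))) ≤ t * (1 / β) := by gcongr
  linarith

/-! ### Travel times through the core and the resulting delay -/

/-- The half width of the interval over which the gain of time is estimated. -/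
noncomputable def crestWidth (n : ℕ) : ℝ := √(crest n / (1024 * (n * Real.pi)))

theorem crestWidth_sq {n : ℕ} : crestWidth n ^ 2 = crest n / (1024 * (n * Real.pi)) :=
  Real.sq_sqrt (by have := crest_pos n; have := Real.pi_pos; positivity)

/-- Put v = √(nπ) = -log c_n and let ρ be the width. Then `logFactor` (2ρ²) ≤ 18 v, so ρ M(2ρ²) ≤ 2
ρ² (18 v)² = 648 v² ρ². The constant 1024 in `crestWidth` is a power of two above 648. -/
theorem crestWidth_mul_speedProfile_le {n : ℕ} (hn : 1 ≤ n) :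
    crestWidth n * speedProfile (2 * crestWidth n ^ 2) ≤ crest n := by
  have hn' : (1 : ℝ) ≤ n := by exact_mod_cast hn
  have hpi := Real.pi_gt_three
  have hnp : 3 ≤ (n : ℝ) * Real.pi := by nlinarith
  have hc := crest_pos n
  set v := √((n : ℝ) * Real.pi) with hv
  have hv2 : v ^ 2 = n * Real.pi := Real.sq_sqrt (by linarith)
  have hv1 : 1 ≤ v := by rw [hv]; exact Real.one_le_sqrt.2 (by linarith)
  have hcv : crest n = Real.exp (-v) := rfl
  have hρ2 : crestWidth n ^ 2 = crest n / (1024 * v ^ 2) := by rw [crestWidth_sq, hv2]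
  have hρ0 : 0 ≤ crestWidth n := Real.sqrt_nonneg _
  set ρ := crestWidth n
  have hs : 0 < 2 * ρ ^ 2 := by rw [hρ2]; positivity
  have hl : logFactor (2 * ρ ^ 2) ≤ 18 * v := by
    have h1 : 1 + (2 * ρ ^ 2)⁻¹ ≤ 1024 * v ^ 2 * Real.exp v := by
      rw [hρ2, hcv, Real.exp_neg]
      have h2 : (2 * ((Real.exp v)⁻¹ / (1024 * v ^ 2)))⁻¹ = 512 * v ^ 2 * Real.exp v := by
        field_simp; norm_num
      rw [h2]
      have h3 : 1 ≤ Real.exp v := Real.one_le_exp (by linarith)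
      have h4 : 1 ≤ v ^ 2 := by nlinarith
      nlinarith
    have h2 : Real.log (1 + (2 * ρ ^ 2)⁻¹) ≤ Real.log (1024 * v ^ 2 * Real.exp v) :=
      Real.log_le_log (by positivity) h1
    rw [Real.log_mul (by positivity) (by positivity), Real.log_mul (by norm_num) (by positivity),
      Real.log_exp, Real.log_pow] at h2
    have h3 : Real.log 1024 ≤ 7 := by
      have : (1024 : ℝ) = 2 ^ 10 := by norm_num
      rw [this, Real.log_pow]
      have := Real.log_two_lt_d9
      push_cast
      linarith
    have h4 := Real.log_le_sub_one_of_pos (by linarith : 0 < v)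
    rw [logFactor]
    push_cast at h2
    linarith
  have hl0 := logFactor_pos hs.le
  have hM : speedProfile (2 * ρ ^ 2) ≤ (2 * ρ) * (18 * v) ^ 2 := by
    rw [speedProfile]
    gcongr
    rw [Real.sqrt_le_left (by positivity)]
    calc 2 * ρ ^ 2 / (1 + 2 * ρ ^ 2) ≤ 2 * ρ ^ 2 := div_le_self hs.le (by linarith)
      _ ≤ (2 * ρ) ^ 2 := by nlinarith
  calc ρ * speedProfile (2 * ρ ^ 2) ≤ ρ * ((2 * ρ) * (18 * v) ^ 2) := by gcongr
    _ = 648 * v ^ 2 * ρ ^ 2 := by ring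
    _ = 648 / 1024 * crest n := by rw [hρ2]; field_simp
    _ ≤ crest n := by linarith

/-- A height Y < ρ over |x| ≤ ρ would give Y M(x² + Y²) < ρ M(2ρ²) ≤ c_n. The bound yields q ≥ 1/2
on the core. -/
theorem crestWidth_le_saddleHeight {n : ℕ} (hn : 1 ≤ n) {x : ℝ} (hx : |x| ≤ crestWidth n) :
    crestWidth n ≤ saddleHeight x (crest n) := by
  by_contra! hlt
  have h1 := saddleHeight_crest x n
  have hY := saddleHeight_pos x (crest_pos n)
  have h2 := crestWidth_mul_speedProfile_le hn
  set Y := saddleHeight x (crest n)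
  set ρ := crestWidth n
  have h3 : speedProfile (radiusSq x Y) ≤ speedProfile (2 * ρ ^ 2) := by
    refine speedProfile_monotoneOn (radiusSq_nonneg _ _) (by simp; positivity) ?_
    have h4 : x ^ 2 ≤ ρ ^ 2 := by rw [← sq_abs x]; gcongr
    unfold radiusSq
    nlinarith
  have h5 := speedProfile_pos (radiusSq_pos_of_right x hY.ne')
  nlinarith

theorem speedProfile_sq_div_two_le_saddleSpeed (c x : ℝ) :
    speedProfile (x ^ 2) / 2 ≤ saddleSpeed c x := by
  have h1 := half_le_saddleFst x (saddleHeight x c)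
  have h2 : speedProfile (x ^ 2) ≤ speedProfile (radiusSq x (saddleHeight x c)) :=
    speedProfile_monotoneOn (by simp; positivity) (radiusSq_nonneg _ _)
      (by unfold radiusSq; nlinarith [sq_nonneg (saddleHeight x c)])
  show _ ≤ saddleFst x (saddleHeight x c)
  linarith

/-- The slowness is at most 2 / M(x²), hence for 0 < x ≤ 1 at most the derivative of -4 /
`logFactor` (x²) with the sign reversed, 8 / (x (1 + x²) `logFactor`²). The bound is uniform in c
and tends to 0 with a: this is the convergence of the integral of 1 / (r log² r). -/
theorem saddleClock_le {c : ℝ} (hc : c ≠ 0) {a : ℝ} (ha : 0 < a) (ha1 : a ≤ 1) :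
    saddleClock c a ≤ 4 / logFactor (a ^ 2) := by
  have h := isGraphStreamFunction_saddle
  have hd : ∀ x, 0 < x → HasDerivAt (fun x => 4 / logFactor (x ^ 2) - saddleClock c x)
      (8 / (x * (1 + x ^ 2) * logFactor (x ^ 2) ^ 2) - 1 / saddleSpeed c x) x := by
    intro x hx
    have hx2 : 0 < x ^ 2 := by positivity
    have h1 : HasDerivAt (fun x : ℝ => x ^ 2) (2 * x) x := by simpa using hasDerivAt_pow 2 x
    have h2 : HasDerivAt (fun x : ℝ => logFactor (x ^ 2)) (-1 / (x ^ 2 * (1 + x ^ 2)) * (2 * x)) x :=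
      HasDerivAt.comp (h₂ := logFactor) (h := fun x : ℝ => x ^ 2) x (hasDerivAt_logFactor hx2) h1
    have hl := (logFactor_pos hx2.le).ne'
    have h3 := ((hasDerivAt_const x (4 : ℝ)).div h2 hl).sub (h.hasDerivAt_clock hc x)
    convert! h3 using 1
    congr 1
    field_simp
    norm_num
  have hnn : ∀ x, 0 < x → x ≤ 1 →
      0 ≤ 8 / (x * (1 + x ^ 2) * logFactor (x ^ 2) ^ 2) - 1 / saddleSpeed c x := by
    intro x hx hx1
    have hx2 : 0 < x ^ 2 := by positivity
    have hl := logFactor_pos hx2.le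
    have hx3 : x ^ 2 ≤ 1 := by nlinarith
    have h1 := speedProfile_sq_div_two_le_saddleSpeed c x
    have hsp := h.speed_pos hc x
    have h2 : x / 2 ≤ √(x ^ 2 / (1 + x ^ 2)) := by
      refine Real.le_sqrt_of_sq_le ?_
      rw [div_pow, div_le_div_iff₀ (by norm_num) (by positivity)]
      nlinarith [mul_nonneg hx2.le (sub_nonneg.2 hx3)]
    have h3 : x * logFactor (x ^ 2) ^ 2 / 4 ≤ saddleSpeed c x := by
      refine le_trans ?_ h1
      rw [speedProfile]
      nlinarith [sq_nonneg (logFactor (x ^ 2))]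
    have h4 : 1 / saddleSpeed c x ≤ 1 / (x * logFactor (x ^ 2) ^ 2 / 4) :=
      one_div_le_one_div_of_le (by positivity) h3
    have h5 : 1 / (x * logFactor (x ^ 2) ^ 2 / 4) ≤
        8 / (x * (1 + x ^ 2) * logFactor (x ^ 2) ^ 2) := by
      rw [div_le_div_iff₀ (by positivity) (by positivity)]
      have h6 : 0 < x * logFactor (x ^ 2) ^ 2 := by positivity
      nlinarith [mul_nonneg h6.le (sub_nonneg.2 hx3)]
    linarith
  have hmono : MonotoneOn (fun x => 4 / logFactor (x ^ 2) - saddleClock c x) (Ioc 0 1) := by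
    refine monotoneOn_of_deriv_nonneg (convex_Ioc 0 1)
      (fun x hx => (hd x hx.1).continuousAt.continuousWithinAt)
      (fun x hx => (hd x (interior_subset hx).1).differentiableAt.differentiableWithinAt)
      fun x hx => ?_
    have hx' := interior_subset hx
    rw [(hd x hx'.1).deriv]
    exact hnn x hx'.1 hx'.2
  have hcont : Tendsto (saddleClock c) (𝓝[>] 0) (𝓝 0) := by
    have := (h.hasDerivAt_clock hc 0).continuousAt.tendsto
    rw [IsGraphStreamFunction.clock_zero] at this
    exact this.mono_left nhdsWithin_le_nhds
  -- The comparison of derivatives holds for x > 0 only, so it is used on [δ, a] and δ tends to 0.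
  have hlim : Tendsto (fun δ => saddleClock c a - saddleClock c δ) (𝓝[>] 0)
      (𝓝 (saddleClock c a - 0)) := tendsto_const_nhds.sub hcont
  rw [sub_zero] at hlim
  refine le_of_tendsto hlim ?_
  filter_upwards [Ioo_mem_nhdsGT ha] with δ hδ
  have h1 := hmono ⟨hδ.1, hδ.2.le.trans ha1⟩ ⟨ha, ha1⟩ hδ.2.le
  have h2 := logFactor_pos (sq_nonneg δ)
  have h3 : 0 ≤ 4 / logFactor (δ ^ 2) := by positivity
  simp only at h1
  linarith

theorem saddleStream_neg_left (x y : ℝ) : saddleStream (-x) y = saddleStream x y := by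
  simp only [saddleStream, heightRatio, logBase, radiusSq, even_two, Even.neg_pow]

theorem saddleSpeed_neg (c x : ℝ) : saddleSpeed c (-x) = saddleSpeed c x := by
  have h1 : saddleStream (-x) = saddleStream x := funext (saddleStream_neg_left x)
  simp only [saddleSpeed, streamSpeed, streamHeight, h1]
  simp only [saddleFst, heightRatio, logBase, radiusSq, even_two, Even.neg_pow]

theorem saddleClock_neg (c x : ℝ) : saddleClock c (-x) = -saddleClock c x := by
  by_cases hc : c = 0
  · simp [saddleClock, streamClock, hc]
  · simp only [saddleClock, streamClock, hc, if_false]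
    have h1 := intervalIntegral.integral_comp_neg (a := 0) (b := x)
      (fun r => 1 / saddleSpeed c r)
    simp only [saddleSpeed_neg, neg_zero] at h1
    rw [intervalIntegral.integral_symm]
    exact congrArg Neg.neg h1.symm

/-- The gain of time between an even crest and the next odd crest on intervals around `0`. -/
theorem gain_le_saddleClock_sub {j : ℕ} (hj : crest (2 * j) ≤ 3 / 5 * speedProfile (9 / 25))
    {x x' : ℝ} (hx : x ≤ -crestWidth (2 * j + 1)) (hx' : crestWidth (2 * j + 1) ≤ x') :
    1 / (40960 * ((2 * j + 1 : ℕ) * Real.pi)) ≤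
      (saddleClock (crest (2 * j + 1)) x' - saddleClock (crest (2 * j + 1)) x) -
      (saddleClock (crest (2 * j)) x' - saddleClock (crest (2 * j)) x) := by
  have h := isGraphStreamFunction_saddle
  have hc := crest_pos (2 * j + 1)
  have hc' := crest_pos (2 * j)
  have hρ0 : 0 ≤ crestWidth (2 * j + 1) := Real.sqrt_nonneg _
  have hi : ∀ a b, IntervalIntegrable (fun r => 1 / saddleSpeed (crest (2 * j + 1)) r) volume a b :=
    fun a b => (h.continuous_one_div_speed hc.ne').intervalIntegrable a b
  have hi' : ∀ a b, IntervalIntegrable (fun r => 1 / saddleSpeed (crest (2 * j)) r) volume a b :=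
    fun a b => (h.continuous_one_div_speed hc'.ne').intervalIntegrable a b
  rw [h.clock_sub hc.ne', h.clock_sub hc'.ne', ← intervalIntegral.integral_sub (hi _ _) (hi' _ _)]
  -- The excess of slowness is nonnegative everywhere, so the integral may be restricted to the core
  -- |r| ≤ ρ.
  have hnn : ∀ r, 0 ≤ 1 / saddleSpeed (crest (2 * j + 1)) r - 1 / saddleSpeed (crest (2 * j)) r := by
    intro r
    refine le_trans ?_ (le_one_div_saddleSpeed_sub hj r)
    have := heightRatio_nonneg r (saddleHeight r (crest (2 * j + 1)))
    have := saddleHeight_pos r hc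
    positivity
  have h1 : ∫ r in (-crestWidth (2 * j + 1))..(crestWidth (2 * j + 1)),
      (1 / saddleSpeed (crest (2 * j + 1)) r - 1 / saddleSpeed (crest (2 * j)) r) ≤
      ∫ r in x..x', (1 / saddleSpeed (crest (2 * j + 1)) r - 1 / saddleSpeed (crest (2 * j)) r) :=
    intervalIntegral.integral_mono_interval hx (by linarith) hx'
      (Eventually.of_forall fun r => hnn r) ((hi _ _).sub (hi' _ _))
  refine le_trans ?_ h1
  -- On the core |r| ≤ ρ ≤ Y, so q ≥ 1/2 and the excess is at least ρ / (80 c). Over the length 2ρ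
  -- this gives ρ² / (40 c) = 1 / (40960 n π), with n = 2j + 1.
  have h2 : ∀ r ∈ Icc (-crestWidth (2 * j + 1)) (crestWidth (2 * j + 1)),
      1 / 80 * (crestWidth (2 * j + 1) / crest (2 * j + 1)) ≤
      1 / saddleSpeed (crest (2 * j + 1)) r - 1 / saddleSpeed (crest (2 * j)) r := by
    intro r hr
    refine le_trans ?_ (le_one_div_saddleSpeed_sub hj r)
    have hY := crestWidth_le_saddleHeight (n := 2 * j + 1) (by omega) (abs_le.2 hr)
    have hY0 := saddleHeight_pos r hc
    have hq : 1 / 2 ≤ heightRatio r (saddleHeight r (crest (2 * j + 1))) := by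
      have h3 : r ^ 2 ≤ saddleHeight r (crest (2 * j + 1)) ^ 2 := by
        rw [← sq_abs r]; gcongr; exact (abs_le.2 hr).trans hY
      rw [heightRatio, div_le_div_iff₀ (by norm_num) (radiusSq_pos_of_right r hY0.ne'), radiusSq]
      linarith
    have h4 : crestWidth (2 * j + 1) / crest (2 * j + 1) ≤
        saddleHeight r (crest (2 * j + 1)) / crest (2 * j + 1) := by gcongr
    have h5 : 1 / 40 * (1 / 2) * (crestWidth (2 * j + 1) / crest (2 * j + 1)) ≤
      1 / 40 * heightRatio r (saddleHeight r (crest (2 * j + 1))) *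
      (saddleHeight r (crest (2 * j + 1)) / crest (2 * j + 1)) := by gcongr
    linarith
  have h6 := intervalIntegral.integral_mono_on (by linarith : -crestWidth (2 * j + 1) ≤
    crestWidth (2 * j + 1)) (by simp) ((hi _ _).sub (hi' _ _)) h2
  refine le_trans (le_of_eq ?_) h6
  rw [intervalIntegral.integral_const, smul_eq_mul]
  have h7 : (crestWidth (2 * j + 1) - -crestWidth (2 * j + 1)) *
      (1 / 80 * (crestWidth (2 * j + 1) / crest (2 * j + 1))) =
      1 / 40 * (crestWidth (2 * j + 1) ^ 2 / crest (2 * j + 1)) := by ring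
  rw [h7, crestWidth_sq]
  field_simp
  norm_num

theorem crestWidth_sq_le {n : ℕ} (hn : 1 ≤ n) : crestWidth n ^ 2 ≤ crest n := by
  have hn' : (1 : ℝ) ≤ n := by exact_mod_cast hn
  have hpi := Real.pi_gt_three
  rw [crestWidth_sq]
  exact div_le_self (crest_pos n).le (by nlinarith)

/-- After time `t`, points starting over `[-a, -a / 2]` on an even crest are ahead of points
starting at the same abscissa on the next odd crest. -/
theorem exists_gain_saddleAbscissa {t : ℝ} (ht : 0 < t) : ∃ a v : ℝ, 0 < a ∧ 0 < v ∧ ∃ N : ℕ,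
    ∀ j, N ≤ j → ∀ x ∈ Icc (-a) (-(a / 2)),
      v / (2 * j + 1 : ℕ) ≤
        streamAbscissa saddleStream saddleFst (crest (2 * j)) (saddleClock (crest (2 * j)) x + t) -
        streamAbscissa saddleStream saddleFst (crest (2 * j + 1))
          (saddleClock (crest (2 * j + 1)) x + t) := by
  have h := isGraphStreamFunction_saddle
  -- Then log(1 / a²) = 8 / t, so the passage from -a to a takes at most 8 / `logFactor` (a²) < t.
  set a := Real.exp (-(4 / t)) with ha
  have ha0 : 0 < a := Real.exp_pos _
  have ha1 : a ≤ 1 := Real.exp_le_one_iff.2 (by have : 0 < 4 / t := by positivity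
                                                linarith)
  have hla : 8 / t < logFactor (a ^ 2) := by
    have h1 : 8 / t ≤ Real.log (1 + (a ^ 2)⁻¹) := by
      have h2 : Real.log ((a ^ 2)⁻¹) ≤ Real.log (1 + (a ^ 2)⁻¹) :=
        Real.log_le_log (by positivity) (by linarith)
      rw [Real.log_inv, Real.log_pow, ha, Real.log_exp] at h2
      push_cast at h2
      have : -(2 * -(4 / t)) = 8 / t := by ring
      linarith
    rw [logFactor]; linarith
  have hMa : 0 < speedProfile (a ^ 2) := speedProfile_pos (by positivity)
  have hM9 : 0 < 3 / 5 * speedProfile (9 / 25) := by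
    have := speedProfile_pos (by norm_num : (0 : ℝ) < 9 / 25); positivity
  have hpi := Real.pi_pos
  have hev : ∀ᶠ n in atTop, crest n ≤ 3 / 5 * speedProfile (9 / 25) ∧ crest n ≤ (a / 2) ^ 2 :=
    (tendsto_crest.eventually_le_const hM9).and (tendsto_crest.eventually_le_const (by positivity))
  obtain ⟨N, hN⟩ := eventually_atTop.1 hev
  refine ⟨a, speedProfile (a ^ 2) / 2 * (1 / (40960 * Real.pi)), ha0, by positivity, N,
    fun j hj x hx => ?_⟩
  have hc := crest_pos (2 * j + 1)
  have hc' := crest_pos (2 * j)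
  have hρ : crestWidth (2 * j + 1) ≤ a / 2 := by
    refine abs_le_of_sq_le_sq' ?_ (by positivity) |>.2
    exact (crestWidth_sq_le (by omega)).trans (hN (2 * j + 1) (by omega)).2
  set x₁ := streamAbscissa saddleStream saddleFst (crest (2 * j + 1))
    (saddleClock (crest (2 * j + 1)) x + t) with hx₁
  set x₂ := streamAbscissa saddleStream saddleFst (crest (2 * j))
    (saddleClock (crest (2 * j)) x + t) with hx₂
  have hT₁ : saddleClock (crest (2 * j + 1)) x₁ = saddleClock (crest (2 * j + 1)) x + t :=
    h.clock_abscissa hc.ne' _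
  have hT₂ : saddleClock (crest (2 * j)) x₂ = saddleClock (crest (2 * j)) x + t :=
    h.clock_abscissa hc'.ne' _
  have hax : a ≤ x₁ := by
    refine (h.strictMono_clock hc.ne').le_iff_le.1 ?_
    have h1 := saddleClock_le hc.ne' ha0 ha1
    have h2 := saddleClock_neg (crest (2 * j + 1)) a
    have h3 : saddleClock (crest (2 * j + 1)) (-a) ≤ saddleClock (crest (2 * j + 1)) x :=
      (h.strictMono_clock hc.ne').monotone hx.1
    have h4 : 8 / logFactor (a ^ 2) < t := by
      rw [div_lt_iff₀ ht] at hla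
      rw [div_lt_iff₀ (logFactor_pos (sq_nonneg a))]
      linarith
    have h5 : 8 / logFactor (a ^ 2) = 4 / logFactor (a ^ 2) + 4 / logFactor (a ^ 2) := by ring
    show saddleClock _ a ≤ saddleClock _ x₁
    linarith
  have hgain := gain_le_saddleClock_sub (hN (2 * j) (by omega)).1 (x := x) (x' := x₁)
    (by linarith [hx.2]) (by linarith)
  set E := 1 / (40960 * (((2 * j + 1 : ℕ) : ℝ) * Real.pi)) with hE
  have hE0 : 0 < E := by positivity
  have hx12 : x₁ ≤ x₂ := by
    refine (h.strictMono_clock hc'.ne').le_iff_le.1 ?_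
    show saddleClock _ x₁ ≤ saddleClock _ x₂
    linarith
  -- On the even crest, abscissa x₁ is reached with at least time E to spare. Beyond a the speed is
  -- at least M(a²) / 2, which converts the spare time into distance.
  have h6 : E ≤ saddleClock (crest (2 * j)) x₂ - saddleClock (crest (2 * j)) x₁ := by linarith
  rw [h.clock_sub hc'.ne'] at h6
  have h7 : ∫ r in x₁..x₂, 1 / saddleSpeed (crest (2 * j)) r ≤
      ∫ _r in x₁..x₂, 2 / speedProfile (a ^ 2) := by
    refine intervalIntegral.integral_mono_on hx12
      ((h.continuous_one_div_speed hc'.ne').intervalIntegrable _ _) (by simp) fun r hr => ?_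
    have h8 := speedProfile_sq_div_two_le_saddleSpeed (crest (2 * j)) r
    have h9 : speedProfile (a ^ 2) ≤ speedProfile (r ^ 2) := by
      refine speedProfile_monotoneOn (by simp; positivity) (by simp; positivity) ?_
      have : a ≤ r := hax.trans hr.1
      gcongr
    have h10 : 1 / saddleSpeed (crest (2 * j)) r ≤ 1 / (speedProfile (a ^ 2) / 2) :=
      one_div_le_one_div_of_le (by positivity) (by linarith)
    refine h10.trans (le_of_eq ?_)
    field_simp
  rw [intervalIntegral.integral_const, smul_eq_mul] at h7
  have h11 : E ≤ (x₂ - x₁) * (2 / speedProfile (a ^ 2)) := h6.trans h7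
  have h12 : speedProfile (a ^ 2) / 2 * E ≤ x₂ - x₁ := by
    rw [mul_div_assoc', le_div_iff₀ hMa] at h11
    linarith
  refine le_trans (le_of_eq ?_) h12
  rw [hE]
  field_simp

/-! ### Smooth steps and variation in one variable -/

/-- A smooth step from `0` to `1` on `[p, p + δ]`. -/
noncomputable def smoothStep (p δ c : ℝ) : ℝ := Real.smoothTransition ((c - p) / δ)

theorem contDiff_smoothStep (p δ : ℝ) {n : ℕ∞} : ContDiff ℝ n (smoothStep p δ) := by
  unfold smoothStep
  exact Real.smoothTransition.contDiff.comp (by fun_prop)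

theorem differentiable_smoothStep (p δ : ℝ) : Differentiable ℝ (smoothStep p δ) :=
  (contDiff_smoothStep p δ (n := 1)).differentiable (by norm_num)

theorem continuous_deriv_smoothStep (p δ : ℝ) : Continuous (deriv (smoothStep p δ)) :=
  (contDiff_smoothStep p δ (n := 1)).continuous_deriv (by norm_num)

theorem smoothStep_nonneg (p δ c : ℝ) : 0 ≤ smoothStep p δ c := Real.smoothTransition.nonneg _

theorem smoothStep_le_one (p δ c : ℝ) : smoothStep p δ c ≤ 1 := Real.smoothTransition.le_one _

theorem smoothStep_of_le {p δ c : ℝ} (hδ : 0 < δ) (hc : c ≤ p) : smoothStep p δ c = 0 :=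
  Real.smoothTransition.zero_of_nonpos (div_nonpos_of_nonpos_of_nonneg (by linarith) hδ.le)

theorem smoothStep_of_ge {p δ c : ℝ} (hδ : 0 < δ) (hc : p + δ ≤ c) : smoothStep p δ c = 1 :=
  Real.smoothTransition.one_of_one_le ((one_le_div hδ).2 (by linarith))

theorem monotone_smoothStep (p : ℝ) {δ : ℝ} (hδ : 0 < δ) : Monotone (smoothStep p δ) :=
  fun c c' h => Real.smoothTransition.monotone (by gcongr)

theorem smoothStep_antitone_left {p p' δ : ℝ} (hδ : 0 < δ) (h : p ≤ p') (c : ℝ) :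
    smoothStep p' δ c ≤ smoothStep p δ c :=
  Real.smoothTransition.monotone (by gcongr)

theorem deriv_smoothStep_nonneg (p : ℝ) {δ : ℝ} (hδ : 0 < δ) (c : ℝ) :
    0 ≤ deriv (smoothStep p δ) c := (monotone_smoothStep p hδ).deriv_nonneg

theorem deriv_smoothStep_eq_zero {p δ c : ℝ} (hδ : 0 < δ) (hc : c ∉ Ioo p (p + δ)) :
    deriv (smoothStep p δ) c = 0 := by
  rw [mem_Ioo, not_and_or, not_lt, not_lt] at hc
  rcases hc with hc | hc
  · refine IsLocalMin.deriv_eq_zero (Eventually.of_forall fun x => ?_)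
    rw [smoothStep_of_le hδ hc]; exact smoothStep_nonneg _ _ _
  · refine IsLocalMax.deriv_eq_zero (Eventually.of_forall fun x => ?_)
    rw [smoothStep_of_ge hδ hc]; exact smoothStep_le_one _ _ _

theorem integrable_deriv_smoothStep_mul {p δ : ℝ} (hδ : 0 < δ) {w : ℝ → ℝ}
    (hw : ContinuousOn w (Icc p (p + δ))) :
    Integrable fun c => deriv (smoothStep p δ) c * w c := by
  have h1 : IntegrableOn (fun c => deriv (smoothStep p δ) c * w c) (Icc p (p + δ)) :=
    ((continuous_deriv_smoothStep p δ).continuousOn.mul hw).integrableOn_Icc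
  refine h1.integrable_of_forall_notMem_eq_zero fun c hc => ?_
  rw [deriv_smoothStep_eq_zero hδ fun h => hc (Ioo_subset_Icc_self h), zero_mul]

theorem integral_deriv_smoothStep_mul {p δ : ℝ} (hδ : 0 < δ) (w : ℝ → ℝ) :
    ∫ c, deriv (smoothStep p δ) c * w c =
      ∫ c in p..(p + δ), deriv (smoothStep p δ) c * w c := by
  rw [intervalIntegral.integral_eq_integral_of_support_subset]
  intro c hc
  by_contra h
  refine hc ?_
  simp only
  rw [deriv_smoothStep_eq_zero hδ fun h' => h (Ioo_subset_Ioc_self h'), zero_mul]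

theorem integral_deriv_smoothStep {p δ : ℝ} (hδ : 0 < δ) :
    ∫ c in p..(p + δ), deriv (smoothStep p δ) c = 1 := by
  rw [intervalIntegral.integral_deriv_eq_sub
    (fun c _ => differentiable_smoothStep p δ c)
    ((continuous_deriv_smoothStep p δ).intervalIntegrable _ _),
    smoothStep_of_ge hδ le_rfl, smoothStep_of_le hδ le_rfl, sub_zero]

/-- The derivative of a step is a nonnegative kernel of mass 1 supported in [p, p + δ], so it is an
approximate identity at p. -/
theorem tendsto_integral_deriv_smoothStep_mul {p : ℝ} {w : ℝ → ℝ} (hp : 0 < p)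
    (hw : ContinuousOn w (Ioi 0)) :
    Tendsto (fun δ => ∫ c, deriv (smoothStep p δ) c * w c) (𝓝[>] 0) (𝓝 (w p)) := by
  rw [Metric.tendsto_nhds]
  intro ε hε
  have hwp : ContinuousAt w p := hw.continuousAt (Ioi_mem_nhds hp)
  obtain ⟨r, hr, hwr⟩ := Metric.continuousAt_iff.1 hwp (ε / 2) (by positivity)
  filter_upwards [Ioo_mem_nhdsGT hr] with δ hδ
  have hwc : ContinuousOn w (Icc p (p + δ)) := hw.mono fun c hc => hp.trans_le hc.1
  have hk := continuous_deriv_smoothStep p δ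
  have hle : p ≤ p + δ := by linarith [hδ.1]
  have hi : IntervalIntegrable (fun c => deriv (smoothStep p δ) c * w c) volume p (p + δ) :=
    (integrable_deriv_smoothStep_mul hδ.1 hwc).intervalIntegrable
  have hcst : ∀ m : ℝ, IntervalIntegrable (fun c => deriv (smoothStep p δ) c * m) volume p (p + δ) :=
    fun m => (hk.mul continuous_const).intervalIntegrable _ _
  have hval : ∀ m : ℝ, ∫ c in p..(p + δ), deriv (smoothStep p δ) c * m = m := fun m => by
    rw [intervalIntegral.integral_mul_const, integral_deriv_smoothStep hδ.1, one_mul]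
  have hb : ∀ c ∈ Icc p (p + δ), |w c - w p| < ε / 2 := fun c hc => by
    have := hwr (x := c) (by rw [Real.dist_eq, abs_lt]; constructor <;> linarith [hc.1, hc.2, hδ.2])
    rwa [Real.dist_eq] at this
  have h1 := intervalIntegral.integral_mono_on hle hi (hcst (w p + ε / 2)) fun c hc =>
    mul_le_mul_of_nonneg_left (by linarith [(abs_lt.1 (hb c hc)).2])
      (deriv_smoothStep_nonneg p hδ.1 c)
  have h2 := intervalIntegral.integral_mono_on hle (hcst (w p - ε / 2)) hi fun c hc =>
    mul_le_mul_of_nonneg_left (by linarith [(abs_lt.1 (hb c hc)).1])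
      (deriv_smoothStep_nonneg p hδ.1 c)
  rw [hval] at h1 h2
  rw [integral_deriv_smoothStep_mul hδ.1, Real.dist_eq, abs_lt]
  constructor <;> linarith

/-- If `w` has variation at most `C` on `(0, 2]`, tested against smooth functions, then its
oscillations along a decreasing sequence sum up to at most `C`. -/
theorem sum_sub_le_of_integral_deriv_mul_le {w : ℝ → ℝ} (hw : ContinuousOn w (Ioi 0)) {C : ℝ}
    (hC : ∀ g : ℝ → ℝ, ContDiff ℝ 1 g → (∃ ε > 0, ∀ c ≤ ε, g c = 0) → (∀ c, 2 ≤ c → g c = 0) →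
      (∀ c, |g c| ≤ 1) → ∫ c, deriv g c * w c ≤ C)
    {p : ℕ → ℝ} (hp : Antitone p) (hp0 : ∀ n, 0 < p n) (hp1 : ∀ n, p n ≤ 1) (m : ℕ) :
    ∑ j ∈ Finset.range m, (w (p (2 * j)) - w (p (2 * j + 1))) ≤ C := by
  have hlim : Tendsto (fun δ => ∑ j ∈ Finset.range m,
      ((∫ c, deriv (smoothStep (p (2 * j)) δ) c * w c) -
        ∫ c, deriv (smoothStep (p (2 * j + 1)) δ) c * w c)) (𝓝[>] 0)
      (𝓝 (∑ j ∈ Finset.range m, (w (p (2 * j)) - w (p (2 * j + 1))))) :=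
    tendsto_finsetSum _ fun j _ => (tendsto_integral_deriv_smoothStep_mul (hp0 _) hw).sub
      (tendsto_integral_deriv_smoothStep_mul (hp0 _) hw)
  refine le_of_tendsto hlim ?_
  filter_upwards [Ioo_mem_nhdsGT one_pos] with δ hδ
  -- The derivative of g is a sum of kernels of alternating sign at the points p n, so its pairing
  -- with w approximates the sum of oscillations. The steps are ordered because p is antitone; the
  -- alternating sum then telescopes and |g| ≤ 1 for every m.
  set g : ℝ → ℝ := fun c => ∑ j ∈ Finset.range m,
    (smoothStep (p (2 * j)) δ c - smoothStep (p (2 * j + 1)) δ c) with hg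
  have hgd : ∀ c, HasDerivAt g (∑ j ∈ Finset.range m,
      (deriv (smoothStep (p (2 * j)) δ) c - deriv (smoothStep (p (2 * j + 1)) δ) c)) c := fun c =>
    HasDerivAt.fun_sum fun j _ => (differentiable_smoothStep _ δ c).hasDerivAt.sub
      (differentiable_smoothStep _ δ c).hasDerivAt
  have hker : ∀ n, Integrable fun c => deriv (smoothStep (p n) δ) c * w c := fun n =>
    integrable_deriv_smoothStep_mul hδ.1 (hw.mono fun c hc => (hp0 n).trans_le hc.1)
  have hle : ∀ n c, smoothStep (p n) δ c ≤ smoothStep (p (n + 1)) δ c := fun n c =>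
    smoothStep_antitone_left hδ.1 (hp n.le_succ) c
  have hsum : ∀ (l : ℕ) (c : ℝ), ∑ j ∈ Finset.range l,
      (smoothStep (p (2 * j + 1)) δ c - smoothStep (p (2 * j)) δ c) ≤
      smoothStep (p (2 * l)) δ c - smoothStep (p 0) δ c := by
    intro l c
    induction l with
    | zero => simp
    | succ l ih =>
      rw [Finset.sum_range_succ]
      have := hle (2 * l + 1) c
      rw [show 2 * (l + 1) = 2 * l + 1 + 1 by ring]
      linarith
  -- The point p (2m) lies at or below the start of every step; p ≤ 1 and δ < 1 make all steps end
  -- before 2.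
  have h1 := hC g (ContDiff.sum fun j _ => (contDiff_smoothStep _ δ).sub (contDiff_smoothStep _ δ))
    ⟨p (2 * m), hp0 _, fun c hc => Finset.sum_eq_zero fun j hj => ?_⟩
    (fun c hc => Finset.sum_eq_zero fun j hj => ?_) (fun c => ?_)
  · refine le_trans (le_of_eq ?_) h1
    have h2 : ∀ c, deriv g c * w c = ∑ j ∈ Finset.range m,
        (deriv (smoothStep (p (2 * j)) δ) c * w c -
          deriv (smoothStep (p (2 * j + 1)) δ) c * w c) := fun c => by
      rw [(hgd c).deriv, Finset.sum_mul]
      exact Finset.sum_congr rfl fun j _ => sub_mul _ _ _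
    simp_rw [h2]
    refine Eq.trans ?_ (integral_finsetSum _ fun j _ => (hker (2 * j)).sub (hker (2 * j + 1))).symm
    exact Finset.sum_congr rfl fun j _ => (integral_sub (hker _) (hker _)).symm
  · have hj' := Finset.mem_range.1 hj
    rw [smoothStep_of_le hδ.1 (hc.trans (hp (by omega))),
      smoothStep_of_le hδ.1 (hc.trans (hp (by omega))), sub_zero]
  · rw [smoothStep_of_ge hδ.1 (by linarith [hp1 (2 * j), hδ.2]),
      smoothStep_of_ge hδ.1 (by linarith [hp1 (2 * j + 1), hδ.2]), sub_self]
  · have h3 := hsum m c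
    have h4 : g c = -∑ j ∈ Finset.range m,
        (smoothStep (p (2 * j + 1)) δ c - smoothStep (p (2 * j)) δ c) := by
      rw [hg, ← Finset.sum_neg_distrib]
      exact Finset.sum_congr rfl fun j _ => by ring
    have h5 : 0 ≤ ∑ j ∈ Finset.range m,
        (smoothStep (p (2 * j + 1)) δ c - smoothStep (p (2 * j)) δ c) :=
      Finset.sum_nonneg fun j _ => sub_nonneg.2 (hle _ c)
    rw [h4, abs_neg, abs_of_nonneg h5]
    linarith [smoothStep_le_one (p (2 * m)) δ c, smoothStep_nonneg (p 0) δ c]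

/-! ### Testing the flow against vertical fields -/

namespace IsGraphStreamFunction

variable {H b₁ b₂ : ℝ → ℝ → ℝ} {B : ℝ}

/-- It is the continuous image of A × Q under (x, c) ↦ (x, height), so cutoffs in x and in H
together give compact support. -/
theorem isCompact_strip (h : IsGraphStreamFunction H b₁ b₂ B) {A Q : Set ℝ} (hA : IsCompact A)
    (hQ : IsCompact Q) : IsCompact {z : ℝ × ℝ | z.1 ∈ A ∧ H z.1 z.2 ∈ Q} := by
  have h1 : {z : ℝ × ℝ | z.1 ∈ A ∧ H z.1 z.2 ∈ Q} =
      (fun z : ℝ × ℝ => (z.1, streamHeight H z.1 z.2)) '' (A ×ˢ Q) := by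
    ext ⟨x, y⟩
    constructor
    · rintro ⟨hx, hy⟩
      exact ⟨(x, H x y), ⟨hx, hy⟩, by simp [h.height_stream]⟩
    · rintro ⟨⟨x', c⟩, ⟨hx, hc⟩, heq⟩
      simp only [Prod.mk.injEq] at heq
      obtain ⟨rfl, rfl⟩ := heq
      exact ⟨hx, by simpa [h.stream_height] using hc⟩
  rw [h1]
  exact (hA.prod hQ).image (continuous_fst.prodMk h.continuous_height)

/-- The change of variables `(x, y) ↦ (x, H x y)`. -/
theorem integral_stream (h : IsGraphStreamFunction H b₁ b₂ B) {F : ℝ × ℝ → ℝ} (hF : Continuous F)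
    (hFs : HasCompactSupport F) :
    ∫ z : ℝ × ℝ, F (z.1, H z.1 z.2) * b₁ z.1 z.2 = ∫ c, ∫ x, F (x, c) := by
  have hc : Continuous fun z : ℝ × ℝ => F (z.1, H z.1 z.2) * b₁ z.1 z.2 :=
    (hF.comp (continuous_fst.prodMk h.continuous_stream)).mul h.cont_fst
  have hs : HasCompactSupport fun z : ℝ × ℝ => F (z.1, H z.1 z.2) * b₁ z.1 z.2 := by
    refine HasCompactSupport.intro (h.isCompact_strip (hFs.image continuous_fst)
      (hFs.image continuous_snd)) fun z hz => ?_
    rw [image_eq_zero_of_notMem_tsupport (f := F) (x := (z.1, H z.1 z.2))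
      fun hm => hz ⟨⟨_, hm, rfl⟩, ⟨_, hm, rfl⟩⟩, zero_mul]
  rw [Measure.volume_eq_prod, integral_prod _ (hc.integrable_of_hasCompactSupport hs)]
  have h1 : ∀ x, ∫ y, F (x, H x y) * b₁ x y = ∫ c, F (x, c) := by
    intro x
    have h2 := integral_image_eq_integral_abs_deriv_smul MeasurableSet.univ
      (fun y _ => (h.hasDerivAt_snd x y).hasDerivWithinAt) (h.strictMono x).injective.injOn
      (fun c => F (x, c))
    rw [image_univ, (h.surjective x).range_eq, setIntegral_univ, setIntegral_univ] at h2
    rw [h2]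
    refine integral_congr_ae (Eventually.of_forall fun y => ?_)
    have hb : 0 ≤ b₁ x y := (h.strictMono x).monotone.deriv_nonneg.trans_eq
      (h.hasDerivAt_snd x y).deriv
    simp only [smul_eq_mul, abs_of_nonneg hb, mul_comm]
  simp only [h1]
  rw [integral_integral_swap]
  exact hF.integrable_of_hasCompactSupport hFs

theorem continuous_shift_abscissa (h : IsGraphStreamFunction H b₁ b₂ B) (t : ℝ) :
    Continuous fun z : {c : ℝ // c ≠ 0} × ℝ =>
      streamAbscissa H b₁ z.1 (streamClock H b₁ z.1 z.2 + t) :=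
  h.continuous_abscissa.comp (continuous_fst.prodMk (h.continuous_clock.add continuous_const))

theorem continuousAt_shift_abscissa (h : IsGraphStreamFunction H b₁ b₂ B) (t : ℝ) {z : ℝ × ℝ}
    (hz : z.2 ≠ 0) : ContinuousAt (fun z : ℝ × ℝ =>
      streamAbscissa H b₁ z.2 (streamClock H b₁ z.2 z.1 + t)) z := by
  have ho : IsOpen {z : ℝ × ℝ | z.2 ≠ 0} := isOpen_ne_fun continuous_snd continuous_const
  refine ContinuousOn.continuousAt (s := {z : ℝ × ℝ | z.2 ≠ 0}) ?_ (ho.mem_nhds hz)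
  rw [continuousOn_iff_continuous_domRestrict]
  exact (h.continuous_shift_abscissa t).comp
    (by fun_prop : Continuous fun z : {z : ℝ × ℝ | z.2 ≠ 0} =>
      ((⟨z.1.2, z.2⟩, z.1.1) : {c : ℝ // c ≠ 0} × ℝ))

theorem continuousOn_weighted_abscissa (h : IsGraphStreamFunction H b₁ b₂ B) (t : ℝ) {ζ : ℝ → ℝ}
    (hζ : Continuous ζ) {A : Set ℝ} (hA : IsCompact A) :
    ContinuousOn (fun c => ∫ x in A, ζ x * streamAbscissa H b₁ c (streamClock H b₁ c x + t))
      (Ioi 0) := by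
  have hlc : LocallyCompactSpace {c : ℝ // c ≠ 0} :=
    (isOpen_ne (x := (0 : ℝ))).locallyCompactSpace
  have h1 : Continuous fun c : {c : ℝ // c ≠ 0} =>
      ∫ x in A, ζ x * streamAbscissa H b₁ c (streamClock H b₁ c x + t) := by
    refine continuous_parametric_integral_of_continuous (X := {c : ℝ // c ≠ 0})
      (f := fun c x => ζ x * streamAbscissa H b₁ c (streamClock H b₁ c x + t)) ?_ hA
    exact (hζ.comp continuous_snd).mul (h.continuous_shift_abscissa t)
  rw [continuousOn_iff_continuous_domRestrict]
  exact h1.comp (by fun_prop : Continuous fun c : Ioi (0 : ℝ) =>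
    (⟨c.1, ne_of_gt c.2⟩ : {c : ℝ // c ≠ 0}))

/-- Testing the first component of the flow against a vertical field that is constant along the
level sets of `H`, up to a cutoff in `x`. -/
theorem integral_flow_mul (h : IsGraphStreamFunction H b₁ b₂ B) (t : ℝ) {ζ k : ℝ → ℝ}
    (hζ : Continuous ζ) {A : Set ℝ} (hA : IsCompact A) (hζA : ∀ x ∉ A, ζ x = 0)
    (hk : Continuous k) {ε : ℝ} (hε : 0 < ε) (hk0 : ∀ c ≤ ε, k c = 0)
    {R : ℝ} (hkR : ∀ c, R ≤ c → k c = 0) :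
    ∫ z : Euc 2, planeFlow H b₁ t z 0 * (ζ (z 0) * (k (H (z 0) (z 1)) * b₁ (z 0) (z 1))) =
      ∫ c, k c * ∫ x in A, ζ x * streamAbscissa H b₁ c (streamClock H b₁ c x + t) := by
  set F : ℝ × ℝ → ℝ := fun z =>
    k z.2 * (ζ z.1 * streamAbscissa H b₁ z.2 (streamClock H b₁ z.2 z.1 + t)) with hF
  -- The shifted abscissa is continuous only off the level 0; k vanishes near that level.
  have hFc : Continuous F := by
    refine continuous_iff_continuousAt.2 fun z => ?_
    rcases lt_or_ge z.2 ε with hz | hz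
    · have : F =ᶠ[𝓝 z] fun _ => 0 := by
        filter_upwards [(isOpen_lt continuous_snd continuous_const).mem_nhds hz] with y hy
        simp only [hF]
        rw [hk0 _ (le_of_lt hy), zero_mul]
      exact this.continuousAt
    · exact (hk.comp continuous_snd).continuousAt.mul ((hζ.comp continuous_fst).continuousAt.mul
        (h.continuousAt_shift_abscissa t (hε.trans_le hz).ne'))
  have hFs : HasCompactSupport F := by
    refine HasCompactSupport.intro (hA.prod (isCompact_Icc (a := ε) (b := R))) fun z hz => ?_
    simp only [hF]
    by_cases h1 : z.1 ∈ A
    · have h2 : z.2 ∉ Icc ε R := fun h2 => hz ⟨h1, h2⟩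
      rw [mem_Icc, not_and_or, not_le, not_le] at h2
      rcases h2 with h2 | h2
      · rw [hk0 _ h2.le, zero_mul]
      · rw [hkR _ h2.le, zero_mul]
    · rw [hζA _ h1, zero_mul, mul_zero]
  have h1 := h.integral_stream hFc hFs
  have h2 := integral_plane fun z : ℝ × ℝ => F (z.1, H z.1 z.2) * b₁ z.1 z.2
  calc _ = ∫ z : Euc 2, F (z 0, H (z 0) (z 1)) * b₁ (z 0) (z 1) := by
        refine integral_congr_ae (Eventually.of_forall fun z => ?_)
        show streamAbscissa H b₁ _ _ * _ = _
        simp only [hF]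
        ring
    _ = ∫ c, ∫ x, F (x, c) := h2.trans h1
    _ = _ := by
        refine integral_congr_ae (Eventually.of_forall fun c => ?_)
        simp only [hF]
        rw [integral_const_mul, setIntegral_eq_integral_of_forall_compl_eq_zero fun x hx => by
          rw [hζA x hx, zero_mul]]

theorem contDiff_vertical (h : IsGraphStreamFunction H b₁ b₂ B) {ζ g : ℝ → ℝ}
    (hζ : ContDiff ℝ 1 ζ) (hg : ContDiff ℝ 1 g) :
    ContDiff ℝ 1 fun z : Euc 2 =>
      (ζ (z 0) * g (H (z 0) (z 1))) • (EuclideanSpace.single 1 1 : Euc 2) := by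
  have h1 : ContDiff ℝ 1 fun z : Euc 2 => z 0 := by fun_prop
  exact ((hζ.comp h1).mul (hg.comp h.contDiff_plane)).smul contDiff_const

/-- The factor b₁ in the divergence is the Jacobian of y ↦ H x y, which turns the pairing with the
flow into a one-dimensional pairing in the level c. -/
theorem classicalDiv_vertical (h : IsGraphStreamFunction H b₁ b₂ B) {ζ g : ℝ → ℝ}
    (hζ : ContDiff ℝ 1 ζ) (hg : ContDiff ℝ 1 g) (z : Euc 2) :
    classicalDiv (fun z : Euc 2 =>
      (ζ (z 0) * g (H (z 0) (z 1))) • (EuclideanSpace.single 1 1 : Euc 2)) z =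
      ζ (z 0) * (deriv g (H (z 0) (z 1)) * b₁ (z 0) (z 1)) := by
  have h0 : HasFDerivAt (fun z : Euc 2 => z 0) (EuclideanSpace.proj (𝕜 := ℝ) (ι := Fin 2) 0) z :=
    (EuclideanSpace.proj (𝕜 := ℝ) (ι := Fin 2) 0 : Euc 2 →L[ℝ] ℝ).hasFDerivAt
  have h1 := (hζ.differentiable (by norm_num) (z 0)).hasDerivAt.comp_hasFDerivAt z h0
  have h2 := (hg.differentiable (by norm_num) (H (z 0) (z 1))).hasDerivAt.comp_hasFDerivAt z
    (h.hasFDerivAt_plane z)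
  have h3 := (h1.mul h2).smul_const (EuclideanSpace.single 1 1 : Euc 2)
  have h4 : fderiv ℝ (fun z : Euc 2 =>
      (ζ (z 0) * g (H (z 0) (z 1))) • (EuclideanSpace.single 1 1 : Euc 2)) z = _ := h3.fderiv
  rw [classicalDiv, Fin.sum_univ_two, h4]
  simp

/-- The variation of the averages of the abscissa of a `BV` flow is finite. -/
theorem exists_integral_deriv_mul_le (h : IsGraphStreamFunction H b₁ b₂ B) {t : ℝ}
    {f : Euc 2 → Euc 2} (hf : MemBVLoc f) (hft : ∀ᵐ z, f z = planeFlow H b₁ t z) {ζ : ℝ → ℝ}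
    (hζ : ContDiff ℝ 1 ζ) (hζ1 : ∀ x, |ζ x| ≤ 1) {A : Set ℝ} (hA : IsCompact A)
    (hζA : ∀ x ∉ A, ζ x = 0) :
    ∃ C, ∀ g : ℝ → ℝ, ContDiff ℝ 1 g → (∃ ε > 0, ∀ c ≤ ε, g c = 0) → (∀ c, 2 ≤ c → g c = 0) →
      (∀ c, |g c| ≤ 1) → ∫ c, deriv g c *
        ∫ x in A, ζ x * streamAbscissa H b₁ c (streamClock H b₁ c x + t) ≤ C := by
  have hK := (h.isCompact_strip hA (isCompact_Icc (a := (0 : ℝ)) (b := 2))).image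
    planeCLE.symm.continuous
  obtain ⟨V, hKV, hVo, hVb⟩ : ∃ V, planeCLE.symm '' {z : ℝ × ℝ | z.1 ∈ A ∧
      H z.1 z.2 ∈ Icc (0 : ℝ) 2} ⊆ V ∧ IsOpen V ∧ Bornology.IsBounded V := by
    obtain ⟨R, hR⟩ := hK.isBounded.subset_ball 0
    exact ⟨_, hR, Metric.isOpen_ball, Metric.isBounded_ball⟩
  obtain ⟨C, hC⟩ := (hf 0).2 V hVo hVb
  refine ⟨C, fun g hg hg0 hg2 hg1 => ?_⟩
  obtain ⟨ε, hε, hg0⟩ := hg0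
  set φ : Euc 2 → Euc 2 := fun z =>
    (ζ (z 0) * g (H (z 0) (z 1))) • (EuclideanSpace.single 1 1 : Euc 2) with hφ
  have hφs : ∀ z, z ∉ planeCLE.symm '' {z : ℝ × ℝ | z.1 ∈ A ∧ H z.1 z.2 ∈ Icc (0 : ℝ) 2} →
      φ z = 0 := by
    intro z hz
    have hz' : ¬ (z 0 ∈ A ∧ H (z 0) (z 1) ∈ Icc (0 : ℝ) 2) := fun hm =>
      hz ⟨planeCLE z, hm, planeCLE.symm_apply_apply z⟩
    simp only [hφ]
    by_cases h1 : z 0 ∈ A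
    · have h2 : H (z 0) (z 1) ∉ Icc (0 : ℝ) 2 := fun h2 => hz' ⟨h1, h2⟩
      rw [mem_Icc, not_and_or, not_le, not_le] at h2
      rcases h2 with h2 | h2
      · rw [hg0 _ (h2.le.trans hε.le), mul_zero, zero_smul]
      · rw [hg2 _ h2.le, mul_zero, zero_smul]
    · rw [hζA _ h1, zero_mul, zero_smul]
  have hmem := hC ⟨φ, h.contDiff_vertical hζ hg, HasCompactSupport.intro hK fun z hz => hφs z hz,
    (closure_minimal (Function.support_subset_iff'.2 hφs) hK.isClosed).trans hKV,
    fun z => ?_, rfl⟩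
  · refine le_trans (le_of_eq ?_) hmem
    -- Passing to ε / 2 here, and to 3 at the other end, leaves a neighbourhood on which g vanishes,
    -- so that its derivative vanishes too.
    have hd0 : ∀ c, c ≤ ε / 2 → deriv g c = 0 := fun c hc => by
      have : g =ᶠ[𝓝 c] fun _ => 0 := by
        filter_upwards [Iio_mem_nhds (show c < ε by linarith)] with y hy using hg0 y (le_of_lt hy)
      rw [this.deriv_eq, deriv_const]
    have hd3 : ∀ c, 3 ≤ c → deriv g c = 0 := fun c hc => by
      have : g =ᶠ[𝓝 c] fun _ => 0 := by
        filter_upwards [Ioi_mem_nhds (show 2 < c by linarith)] with y hy using hg2 y (le_of_lt hy)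
      rw [this.deriv_eq, deriv_const]
    rw [← h.integral_flow_mul t hζ.continuous hA hζA (hg.continuous_deriv (by norm_num))
      (half_pos hε) hd0 hd3]
    refine integral_congr_ae ?_
    filter_upwards [hft] with z hz
    rw [hφ, h.classicalDiv_vertical hζ hg, hz]
  · rw [hφ, norm_smul, PiLp.norm_single, norm_one, mul_one, Real.norm_eq_abs, abs_mul]
    exact mul_le_one₀ (hζ1 _) (abs_nonneg _) (hg1 _)

end IsGraphStreamFunction

/-! ### Failure of bounded variation -/

theorem crest_le_one (n : ℕ) : crest n ≤ 1 :=
  Real.exp_le_one_iff.2 (neg_nonpos.2 (Real.sqrt_nonneg _))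

/-- Between the crests 2j and 2j + 1 the averaged abscissa changes by at least a constant times 1 /
(2j + 1). These changes add up to a divergent harmonic series, while a BV flow would bound their
sum. -/
theorem not_memBVLoc_of_ae_eq_planeFlow_saddle {t : ℝ} (ht : 0 < t) {f : Euc 2 → Euc 2}
    (hft : ∀ᵐ z, f z = planeFlow saddleStream saddleFst t z) : ¬ MemBVLoc f := by
  intro hf
  have h := isGraphStreamFunction_saddle
  obtain ⟨a, v, ha, hv, N, hgain⟩ := exists_gain_saddleAbscissa ht
  -- Centre -3a/4 and outer radius a/4: the bump lives on [-a, -a/2], where the gain is available.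
  let ζ : ContDiffBump (-(3 * a / 4)) := ⟨a / 8, a / 4, by positivity, by linarith⟩
  have hζA : ∀ x ∉ Icc (-a) (-(a / 2)), ζ x = 0 := by
    intro x hx
    refine ζ.zero_of_le_dist ?_
    show a / 4 ≤ _
    by_contra hlt
    rw [not_le, Real.dist_eq, abs_lt] at hlt
    exact hx ⟨by linarith [hlt.1], by linarith [hlt.2]⟩
  have hζc : Continuous ζ := ζ.continuous
  have hI : 0 < ∫ x in Icc (-a) (-(a / 2)), ζ x := by
    rw [setIntegral_eq_integral_of_forall_compl_eq_zero hζA]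
    exact ζ.integral_pos
  set I := ∫ x in Icc (-a) (-(a / 2)), ζ x with hIdef
  obtain ⟨C, hC⟩ := h.exists_integral_deriv_mul_le hf hft (ζ.contDiff (n := 1))
    (fun x => by rw [abs_of_nonneg ζ.nonneg]; exact ζ.le_one) isCompact_Icc hζA
  set w : ℝ → ℝ := fun c => ∫ x in Icc (-a) (-(a / 2)),
    ζ x * streamAbscissa saddleStream saddleFst c (saddleClock c x + t) with hw
  have hwc : ContinuousOn w (Ioi 0) := h.continuousOn_weighted_abscissa t hζc isCompact_Icc
  have hcont : ∀ n, Continuous fun x =>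
      ζ x * streamAbscissa saddleStream saddleFst (crest n) (saddleClock (crest n) x + t) := fun n =>
    hζc.mul ((h.continuous_shift_abscissa t).comp (by fun_prop :
      Continuous fun x : ℝ => ((⟨crest n, (crest_pos n).ne'⟩, x) : {c : ℝ // c ≠ 0} × ℝ)))
  have hosc : ∀ j, N ≤ j → v / (2 * j + 1 : ℕ) * I ≤ w (crest (2 * j)) - w (crest (2 * j + 1)) := by
    intro j hj
    rw [hw, hIdef]
    simp only
    rw [← integral_sub (hcont _).continuousOn.integrableOn_Icc
      (hcont _).continuousOn.integrableOn_Icc, ← integral_const_mul]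
    refine setIntegral_mono_on (continuous_const.mul hζc).continuousOn.integrableOn_Icc
      ((hcont _).sub (hcont _)).continuousOn.integrableOn_Icc measurableSet_Icc fun x hx => ?_
    have := mul_le_mul_of_nonneg_right (hgain j hj x hx) (ζ.nonneg (x := x))
    linarith
  have hbd : ∀ m : ℕ, v * I / (2 * N + 2) * ∑ j ∈ Finset.range m, (1 / ((j : ℝ) + 1)) ≤ C := by
    intro m
    have h1 := sum_sub_le_of_integral_deriv_mul_le hwc hC (p := fun n => crest (2 * N + n))
      (fun n n' hn => crest_strictAnti.antitone (by omega)) (fun n => crest_pos _)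
      (fun n => crest_le_one _) m
    refine le_trans ?_ h1
    rw [Finset.mul_sum]
    refine Finset.sum_le_sum fun j _ => ?_
    have h2 := hosc (N + j) (by omega)
    rw [show 2 * (N + j) = 2 * N + 2 * j by ring] at h2
    refine le_trans ?_ h2
    -- The comparison with the harmonic series is 2 (N + j) + 1 ≤ (2N + 2)(j + 1).
    rw [div_mul_div_comm, mul_one, div_mul_eq_mul_div]
    refine div_le_div_of_nonneg_left (by positivity) (by positivity) ?_
    push_cast
    have : (0 : ℝ) ≤ N * j := by positivity
    nlinarith
  have hpos : 0 < v * I / (2 * N + 2) := by positivity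
  obtain ⟨m, hm⟩ := ((Real.tendsto_sum_range_one_div_nat_succ_atTop.const_mul_atTop
    hpos).eventually_gt_atTop C).exists
  exact absurd (hbd m) (not_le.2 hm)

theorem proposition1p5 :
    ∃ b : Euc 2 → Euc 2,
      MemLp b (⊤ : ℝ≥0∞) volume ∧
      IsDivFree b ∧
      (∀ p : ℝ≥0∞, 1 ≤ p → p < ⊤ → MemW1pLoc b p) ∧
      (∀ᵐ z : Euc 2, 0 < b z 0) ∧
      -- a regular Lagrangian flow exists for all times
      (∃ X : ℝ → Euc 2 → Euc 2, IsRegularLagrangianFlow ⊤ (fun _ => b) X) ∧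
      -- on every time interval it is unique up to a null set of initial points
      (∀ (T : EReal) (X Y : ℝ → Euc 2 → Euc 2),
        IsRegularLagrangianFlow T (fun _ => b) X → IsRegularLagrangianFlow T (fun _ => b) Y →
          ∀ᵐ z : Euc 2, ∀ t : ℝ, 0 ≤ t → (t : EReal) < T → X t z = Y t z) ∧
      -- and at no positive time is it of locally bounded variation
      (∀ (T : EReal) (X : ℝ → Euc 2 → Euc 2), IsRegularLagrangianFlow T (fun _ => b) X →
        ∀ t : ℝ, 0 < t → (t : EReal) < T → ¬ MemBVLoc (X t)) := by
  have h := isGraphStreamFunction_saddle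
  refine ⟨planeField saddleFst saddleSnd, memLp_top_of_bound
    h.continuous_planeField.aestronglyMeasurable _ (Eventually.of_forall h.norm_planeField_le),
    h.isDivFree_planeField, fun p hp1 hp => memW1pLoc_planeField_saddle hp1 hp, ?_,
    ⟨_, h.isRegularLagrangianFlow_planeFlow⟩, fun T X Y hX hY => ?_, fun T X hX t ht htT => ?_⟩
  · filter_upwards [ae_plane_snd_ne_zero] with z hz
    exact h.pos (z 0) (z 1) hz
  · filter_upwards [h.regularLagrangianFlow_eq hX, h.regularLagrangianFlow_eq hY]
      with z hXz hYz t ht htT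
    rw [hXz t ht htT, hYz t ht htT]
  · refine not_memBVLoc_of_ae_eq_planeFlow_saddle ht ?_
    filter_upwards [h.regularLagrangianFlow_eq hX] with z hz using hz t ht.le htT
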